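/- **Theorem 7.2.** *Setting.* Let $M$ be a (Hausdorff) real-analytic surface, $p,f$ real-valued analytic functions on $T^*M$ with $H_pf=0$, where $H_p=p'_\xi\cdot\partial_x-p'_x\cdot\partial_\xi$. Assume that $p^{-1}(0)$ is compact and connected and that $dp\ne0$ on it. Put $J=f(p^{-1}(0))$ (a compact interval) and $\Lambda_a=p^{-1}(0)\cap f^{-1}(a)$, $a\in J$. Let $S\subset J$ be finite, and assume that for $a\in J\setminus S$ the $\Lambda_a$ are Lagrangian tori depending analytically on $a$: near each $\Lambda_{a_0}$, $a_0\in J\setminus S$, there are analytic action-angle coordinates $(x,\xi)\in\mathbf T^2\times B$, $\mathbf T^2=\mathbf R^2/2\pi\mathbf Z^2$, $B\subset\mathbf R^2$ open, such that $p=p(\xi)$ and, for $a\in J$ near $a_0$, $\Lambda_a=\{\xi=\xi(a)\}$ with $\xi(a)$ analytic. Let $\omega(a)=[\partial_{\xi_2}p:\partial_{\xi_1}p](\xi(a))\in\mathbf R\cup\{\infty\}$ be the rotation number, and for analytic $q:T^*M\to\mathbf R$ let $\langle q\rangle_{\Lambda_a}=(2\pi)^{-2}\int_{\mathbf T^2}q(x,\xi(a))\,dx$,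 $a\in J\setminus S$. Assume that $\omega$ is analytic on $J\setminus S$ (with values in the projective line) and not identically constant on any connected component of $J\setminus S$. For $a\in J$ let $\langle q\rangle_T=\frac1T\int_0^Tq\circ\exp(tH_p)\,dt$, and let $Q_\infty(a)=Q_\infty^q(a)$ be the union over the connected components $C$ of $\Lambda_a$ of the sets $\bigcap_{T\ge1}\langle q\rangle_T(C)$ (equivalently, of the intervals $[\lim_{T\to\infty}\inf_C\langle q\rangle_T,\ \lim_{T\to\infty}\sup_C\langle q\rangle_T]$). Let $|Q_\infty(a)|$ denote its length. Let $g:J\to\mathbf R$ be continuous, analytic on $J\setminus S$ and not identically constant on any connected component of $J\setminus S$. Let $\mathcal F$ be a family of analytic functions $q:T^*M\to\mathbf R$ such that $\langle q\rangle_{\Lambda_a}=g(a)$ for all $q\in\mathcal F$, $a\in J\setminus S$, and such that $\mathcal F$ is uniformly analytic on $p^{-1}(0)$: for every $z\in p^{-1}(0)$ there is $R$ such that $\|D^nq(z)\|\le R^{n+1}n!$ for all $n\ge 0$, $q\in\mathcal F$, in a fixed canonical chart at $z$. (One function $q$ alone always is such a family.) For $\alpha,d>0$ let $\widetilde\Omega_\alpha$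 be the set of $a\in J\setminus S$ with ${\rm dist}(a,S)\ge\alpha$, $\omega(a)\neq\infty$, $|\omega'(a)|\ge\alpha$, $|g'(a)|\ge\alpha$ and $|\omega(a)-\frac mn|\ge\frac{\alpha}{n^{2+d}}$ for all $m\in\mathbf Z$ and all integers $n\ge1$. The set of good values is $\mathcal G_\alpha=g(J)\setminus g(J\setminus\widetilde\Omega_\alpha)$. *Conclusion.* For every $d>0$: 1. The Lebesgue measure of $g(J)\setminus\mathcal G_\alpha$ tends to $0$ as $\alpha\to0^+$. 2. For all $\alpha>0$ and $F_0\in\mathcal G_\alpha$, the set $g^{-1}(F_0)\subset J$ is finite. 3. For $q\in\mathcal F$ and $a\in J\setminus S$, the limit of $\langle q\rangle_T$ as $T\to\infty$ exists pointwise on $\Lambda_a$, and $Q_\infty(a)$ is the range of this limit. 4. For every $\alpha>0$ and every compact $K\subset\mathcal G_\alpha$ (for instance $K=\{F_0\}$) there is $\sigma>0$, the same for all $q\in\mathcal F$ and $F_0\in K$, such that if $q\in\mathcal F$ and $\sup_{a\in J}|Q_\infty(a)|\le\sigma$, then for every $F_0\in K$ and every neighborhood $W$ of $g^{-1}(F_0)$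 there is $C(W)>0$ with $${\rm dist}(Q_\infty(a),F_0)\ge\frac1{C(W)},\qquad a\in J\setminus W.$$ -/

import Mathlib

open Set Filter Topology MeasureTheory
open scoped Manifold ContDiff Bundle

noncomputable section

/-- The model plane of a real-analytic surface. -/
abbrev Plane := EuclideanSpace ℝ (Fin 2)

/-- The model space of the cotangent bundle of a surface: positions and covectors. -/
abbrev PhaseModel := Plane × (Plane →L[ℝ] ℝ)

/-- The model with corners of the cotangent bundle of a surface. -/
abbrev phaseI : ModelWithCorners ℝ PhaseModel (ModelProd Plane (Plane →L[ℝ] ℝ)) :=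
  (𝓘(ℝ, Plane)).prod 𝓘(ℝ, Plane →L[ℝ] ℝ)

section Cotangent

variable (M : Type*) [TopologicalSpace M] [ChartedSpace Plane M] [IsManifold 𝓘(ℝ, Plane) ω M]

/-- The cotangent bundle `T*M`: the points are the pairs `(x, ξ)` with `ξ : T_x M → ℝ` linear. -/
abbrev Cotangent : Type _ :=
  Bundle.TotalSpace (Plane →L[ℝ] ℝ)
    (fun x : M => TangentSpace 𝓘(ℝ, Plane) x →L[ℝ] Bundle.Trivial M ℝ x)

end Cotangent

section Dynamics

variable {M : Type*} [TopologicalSpace M] [ChartedSpace Plane M] [IsManifold 𝓘(ℝ, Plane) ω M]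

/-- The canonical symplectic form `dξ ∧ dx` of `T*M` at the point `z`.
In Mathlib the tangent space at `z` is identified with the model space by the preferred chart
at `z`. For `T*M` this chart is the canonical chart `(x, ξ)` induced by a chart of `M`. -/
def symplecticForm (z : Cotangent M) (u v : TangentSpace phaseI z) : ℝ :=
  let u' : PhaseModel := u
  let v' : PhaseModel := v
  u'.2 v'.1 - v'.2 u'.1

/-- The differential `dp(z)`, a linear form on the tangent space of `T*M` at `z`. -/
def differential (p : Cotangent M → ℝ) (z : Cotangent M) : PhaseModel →L[ℝ] ℝ :=
  mfderiv phaseI 𝓘(ℝ, ℝ) p z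

/-- The Hamilton field `H_p = p'_ξ · ∂_x - p'_x · ∂_ξ`. -/
def hamiltonField (p : Cotangent M → ℝ) (z : Cotangent M) : TangentSpace phaseI z :=
  ((WithLp.toLp 2 fun i : Fin 2 => differential p z (0, EuclideanSpace.proj i),
    -(differential p z).comp (ContinuousLinearMap.inl ℝ Plane (Plane →L[ℝ] ℝ))) : PhaseModel)

open Classical in
/-- The Hamilton flow `exp(t H_p)(z)`; the value is `z` (a junk value) when the maximal integral
curve through `z` is not defined for all times, which does not occur on a compact energy surface. -/
def hamiltonFlow (p : Cotangent M → ℝ) (t : ℝ) (z : Cotangent M) : Cotangent M :=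
  if h : ∃ γ : ℝ → Cotangent M, γ 0 = z ∧ IsMIntegralCurve (I := phaseI) γ (hamiltonField p)
  then h.choose t else z

/-- The flow average `⟨q⟩_T = T⁻¹ ∫_0^T q ∘ exp(t H_p) dt`. -/
def flowAverage (p q : Cotangent M → ℝ) (T : ℝ) (z : Cotangent M) : ℝ :=
  T⁻¹ * ∫ t in (0 : ℝ)..T, q (hamiltonFlow p t z)

/-- The leaf `Λ_a = p⁻¹(0) ∩ f⁻¹(a)`. -/
def leaf (p f : Cotangent M → ℝ) (a : ℝ) : Set (Cotangent M) := {z | p z = 0 ∧ f z = a}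

/-- The parameter set `J = f(p⁻¹(0))`; it is a compact interval when `p⁻¹(0)` is compact and
connected. -/
def leafParams (p f : Cotangent M → ℝ) : Set ℝ := f '' (p ⁻¹' {0})

/-- `Q_∞(a)`: the union, over the connected components `C` of `Λ_a`, of the intersections of the
ranges of `⟨q⟩_T` on `C`, `T ≥ 1`. -/
def QInfty (p f q : Cotangent M → ℝ) (a : ℝ) : Set ℝ :=
  ⋃ z ∈ leaf p f a, ⋂ T ∈ Ici (1 : ℝ),
    flowAverage p q T '' connectedComponentIn (leaf p f a) z

/-- The point `[u : v]` of the real projective line `ℝ ∪ {∞}`, that is `u / v`, or `∞` if `v = 0`. -/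
def projRatio (u v : ℝ) : OnePoint ℝ :=
  open Classical in if v = 0 then OnePoint.infty else ((u / v : ℝ) : OnePoint ℝ)

/-- The real number represented by a point of the projective line (junk value `0` at `∞`). -/
def finitePart (r : OnePoint ℝ) : ℝ := r.elim 0 id

/-- Analyticity on `s` of a map into the real projective line: locally it can be written
`[u : v]` with `u`, `v` analytic and without common zero. -/
def ProjAnalyticOn (r : ℝ → OnePoint ℝ) (s : Set ℝ) : Prop :=
  ∀ a ∈ s, ∃ u v : ℝ → ℝ, AnalyticWithinAt ℝ u s a ∧ AnalyticWithinAt ℝ v s a ∧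
    (u a ≠ 0 ∨ v a ≠ 0) ∧ ∀ᶠ a' in 𝓝[s] a, r a' = projRatio (u a') (v a')

/-- Real-analytic action-angle coordinates near `Λ_{a₀}`, given through the inverse
`κ : 𝕋² × B → T*M`, `𝕋² = ℝ² / 2πℤ²`, of the coordinate map. The leaves `Λ_a` with `a` near `a₀`
are the tori `{ξ = action a}`, depending analytically on `a`. -/
structure ActionAngleChart (p f : Cotangent M → ℝ) (a₀ : ℝ) where
  /-- the parameters of the leaves in the range of the coordinates -/
  V : Set ℝ
  V_mem : V ∈ 𝓝 a₀
  /-- the range of the action variables -/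
  B : Set (Fin 2 → ℝ)
  isOpen_B : IsOpen B
  /-- the point with angles `x` and actions `ξ` -/
  κ : (Fin 2 → ℝ) × (Fin 2 → ℝ) → Cotangent M
  analytic_κ : ContMDiffOn 𝓘(ℝ, (Fin 2 → ℝ) × (Fin 2 → ℝ)) phaseI ω κ (univ ×ˢ B)
  κ_eq_iff : ∀ x x' : Fin 2 → ℝ, ∀ ξ ∈ B, ∀ ξ' ∈ B, κ (x, ξ) = κ (x', ξ') ↔
    ξ = ξ' ∧ ∃ k : Fin 2 → ℤ, ∀ i, x' i = x i + 2 * Real.pi * k i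
  symplectic_κ : ∀ x : Fin 2 → ℝ, ∀ ξ ∈ B, ∀ u v : (Fin 2 → ℝ) × (Fin 2 → ℝ),
    symplecticForm (κ (x, ξ))
        (mfderiv 𝓘(ℝ, (Fin 2 → ℝ) × (Fin 2 → ℝ)) phaseI κ (x, ξ) u)
        (mfderiv 𝓘(ℝ, (Fin 2 → ℝ) × (Fin 2 → ℝ)) phaseI κ (x, ξ) v) =
      (∑ i, u.2 i * v.1 i) - ∑ i, v.2 i * u.1 i
  p_indep_angle : ∀ x : Fin 2 → ℝ, ∀ ξ ∈ B, p (κ (x, ξ)) = p (κ (0, ξ))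
  /-- the actions of the leaf `Λ_a` -/
  action : ℝ → Fin 2 → ℝ
  analytic_action : AnalyticOn ℝ action (V ∩ leafParams p f)
  action_mem : ∀ a ∈ V ∩ leafParams p f, action a ∈ B
  leaf_eq : ∀ a ∈ V ∩ leafParams p f, leaf p f a = range fun x => κ (x, action a)

namespace ActionAngleChart

variable {p f : Cotangent M → ℝ} {a₀ : ℝ}

/-- The frequency `∂p/∂ξ_i` of the torus `Λ_a`, `p` being a function `p(ξ)` of the actions. -/
def frequency (c : ActionAngleChart p f a₀) (i : Fin 2) (a : ℝ) : ℝ :=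
  fderiv ℝ (fun ξ : Fin 2 → ℝ => p (c.κ (0, ξ))) (c.action a) (Pi.single i 1)

/-- The rotation number `[∂p/∂ξ₂ : ∂p/∂ξ₁]` of the torus `Λ_a`. -/
def rotationNumber (c : ActionAngleChart p f a₀) (a : ℝ) : OnePoint ℝ :=
  projRatio (c.frequency 1 a) (c.frequency 0 a)

/-- The average of `q` over the torus `Λ_a` for the measure `(2π)⁻² dx` of the angles. -/
def torusAverage (c : ActionAngleChart p f a₀) (q : Cotangent M → ℝ) (a : ℝ) : ℝ :=
  ((2 * Real.pi) ^ 2)⁻¹ *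
    ∫ x in Icc (0 : Fin 2 → ℝ) (fun _ => 2 * Real.pi), q (c.κ (x, c.action a))

end ActionAngleChart

/-- A family of functions is uniformly analytic along `K` if at each point of `K` its members
satisfy the Cauchy estimates with a common constant; for compact `K` this means that
they have uniformly bounded holomorphic extensions to a common complex neighborhood of `K`. -/
def UniformlyAnalyticOn (F : Set (Cotangent M → ℝ)) (K : Set (Cotangent M)) : Prop :=
  ∀ z ∈ K, ∃ R : ℝ, ∀ q ∈ F, ∀ n : ℕ,
    ‖iteratedFDeriv ℝ n (q ∘ (extChartAt phaseI z).symm) (extChartAt phaseI z z)‖ ≤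
      R ^ (n + 1) * n.factorial

end Dynamics

/-- `r` is not identically constant on any connected component of `s`. -/
def NonconstantOnComponents {X : Type*} (r : ℝ → X) (s : Set ℝ) : Prop :=
  ∀ a ∈ s, ¬ ∀ a' ∈ connectedComponentIn s a, r a' = r a

/-- `Ω_{α,d}`: the parameters `a ∈ J` with `dist(a, S) ≥ α`, for which the rotation number `r(a)`
is finite and `(α,d)`-Diophantine, and `|r'(a)| ≥ α`. -/
def diophantineParams (J S : Set ℝ) (r : ℝ → OnePoint ℝ) (α d : ℝ) : Set ℝ :=
  {a | a ∈ J ∧ (∀ s ∈ S, α ≤ |a - s|) ∧ r a ≠ OnePoint.infty ∧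
    α ≤ |derivWithin (fun a' => finitePart (r a')) J a| ∧
    ∀ m : ℤ, ∀ n : ℕ, 0 < n → α / (n : ℝ) ^ (2 + d) ≤ |finitePart (r a) - m / n|}

/-- `Ω̃_{α,d}`: the points of `Ω_{α,d}` at which `|g'| ≥ α`. -/
def regularParams (J S : Set ℝ) (r : ℝ → OnePoint ℝ) (g : ℝ → ℝ) (α d : ℝ) : Set ℝ :=
  diophantineParams J S r α d ∩ {a | a ∈ J \ S ∧ α ≤ |derivWithin g J a|}

/-- The set of good values `𝒢_α`: the complement in `g(J)` of `g(J \ Ω̃_{α,d})`. -/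
def goodValues (J S : Set ℝ) (r : ℝ → OnePoint ℝ) (g : ℝ → ℝ) (α d : ℝ) : Set ℝ :=
  (g '' J) \ (g '' (J \ regularParams J S r g α d))

end

/-! In action-angle coordinates the flow on `Λ_a` is linear, so `⟨q⟩_T` becomes an average of a
function on the torus along a line. For an irrational rotation number the averages converge
uniformly to the torus average and `Q_∞(a) = {g(a)}`. For a rational one, `m / n`, the orbits are
closed and the limit, as a function on the transversal circle, is invariant under translation by
`2π / n`; as a smooth function it therefore oscillates by `O(n⁻ᴺ)` for every `N`, uniformly in `a`
and in the family. When the rotation number of a nearby `Λ_b` is Diophantine, `n⁻ᴺ` is in turn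
bounded by the square of the difference of the rotation numbers, so `Q_∞(a)` has length
`O(|a - b|²)`. Since `|g(a) - g(b)|` is of order `|a - b|` when `g'(b) ≠ 0`, the set `Q_∞(a)`,
which contains `g(a)`, stays away from the good value `g(b)`. Away from the preimages of the good
value the smallness of `Q_∞(a)` suffices. The parameters in `S` are reached by a limit along tori.

The bad parameters have small image under `g`: locally, `g` and the rotation number have analytic
extensions, whose critical points are isolated, and the non-Diophantine numbers have small
measure. -/

/-! ### Flows of vector fields preserving a compact set -/

section LocalFlow

variable {E : Type*} [NormedAddCommGroup E] [NormedSpace ℝ E]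
  {H : Type*} [TopologicalSpace H] {I : ModelWithCorners ℝ E H}
  {N : Type*} [TopologicalSpace N] [ChartedSpace H N] {v : (x : N) → TangentSpace I x}

/-- Existence of a local flow of the vector field `v` on a neighborhood of `x₀`, for times in
`(-ε, ε)`, jointly continuous in the time and the initial point. -/
def HasLocalFlow (v : (x : N) → TangentSpace I x) (ε : ℝ) (x₀ : N) : Prop :=
  ∃ U ∈ 𝓝 x₀, ∃ Φ : N × ℝ → N, ContinuousOn Φ (U ×ˢ Ioo (-ε) ε) ∧
    ∀ x ∈ U, Φ (x, 0) = x ∧ IsMIntegralCurveOn (fun t => Φ (x, t)) v (Ioo (-ε) ε)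

theorem HasLocalFlow.mono {ε δ : ℝ} {x₀ : N} (h : HasLocalFlow v ε x₀) (hδ : δ ≤ ε) :
    HasLocalFlow v δ x₀ := by
  obtain ⟨U, hU, Φ, hΦ, hcurve⟩ := h
  have hsub : Ioo (-δ) δ ⊆ Ioo (-ε) ε := Ioo_subset_Ioo (neg_le_neg hδ) hδ
  exact ⟨U, hU, Φ, hΦ.mono (prod_mono le_rfl hsub),
    fun x hx => ⟨(hcurve x hx).1, (hcurve x hx).2.mono hsub⟩⟩

theorem HasLocalFlow.eventually {ε : ℝ} {x₀ : N} (h : HasLocalFlow v ε x₀) :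
    ∀ᶠ x in 𝓝 x₀, HasLocalFlow v ε x := by
  obtain ⟨U, hU, Φ, hΦ⟩ := h
  filter_upwards [eventually_mem_nhds_iff.2 hU] with x hx using ⟨U, hx, Φ, hΦ⟩

theorem HasLocalFlow.exists_isMIntegralCurveOn {ε : ℝ} {x₀ : N} (h : HasLocalFlow v ε x₀) :
    ∃ γ : ℝ → N, γ 0 = x₀ ∧ IsMIntegralCurveOn γ v (Ioo (-ε) ε) := by
  obtain ⟨U, hU, Φ, -, hcurve⟩ := h
  exact ⟨fun t => Φ (x₀, t), hcurve x₀ (mem_of_mem_nhds hU)⟩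

variable [IsManifold I 1 N]

theorem hasMFDerivAt_extChartAt_symm_comp {x₀ : N} {f : ℝ → E} {t : ℝ}
    (hft : f t ∈ interior (extChartAt I x₀).target)
    (w : TangentSpace I ((extChartAt I x₀).symm (f t)))
    (hf : HasDerivAt f (tangentCoordChange I ((extChartAt I x₀).symm (f t)) x₀
      ((extChartAt I x₀).symm (f t)) w) t) :
    HasMFDerivAt 𝓘(ℝ, ℝ) I ((extChartAt I x₀).symm ∘ f) t ((1 : ℝ →L[ℝ] ℝ).smulRight w) := by
  let x : N := (extChartAt I x₀).symm (f t)
  have htarget : f t ∈ (extChartAt I x₀).target := interior_subset hft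
  have hx₀ : x ∈ (extChartAt I x₀).source := (extChartAt I x₀).map_target htarget
  have hself : x ∈ (extChartAt I x).source := mem_extChartAt_source x
  suffices hcoord : HasDerivAt ((extChartAt I x ∘ (extChartAt I x₀).symm) ∘ f) (w : E) t from
    ⟨(continuousAt_extChartAt_symm'' htarget).comp hf.continuousAt,
      hcoord.hasFDerivAt.hasFDerivWithinAt⟩
  have hchange : tangentCoordChange I x₀ x x (tangentCoordChange I x x₀ x (w : E)) = (w : E) :=
    (tangentCoordChange_comp ⟨⟨hself, hx₀⟩, hself⟩).trans (tangentCoordChange_self hself)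
  refine HasDerivAt.congr_deriv ?_ hchange
  refine HasFDerivAt.comp_hasDerivAt _ ?_ hf
  refine HasFDerivWithinAt.hasFDerivAt (s := range I) ?_ (mem_of_superset
    (isOpen_interior.mem_nhds hft) (interior_subset.trans (extChartAt_target_subset_range x₀)))
  rw [← (extChartAt I x₀).right_inv htarget]
  exact hasFDerivWithinAt_tangentCoordChange ⟨hx₀, hself⟩

variable [BoundarylessManifold I N] [CompleteSpace E]

theorem exists_hasLocalFlow {x₀ : N}
    (hv : ContMDiffAt I I.tangent 1 (fun x ↦ (⟨x, v x⟩ : TangentBundle I N)) x₀) :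
    ∃ ε > 0, HasLocalFlow v ε x₀ := by
  have hx₀ : I.IsInteriorPoint x₀ := BoundarylessManifold.isInteriorPoint
  obtain ⟨ε, hε, a, r, L, K, hr, hpl⟩ := IsPicardLindelof.of_contDiffAt_one
    ((contMDiffAt_iff.1 hv).2.contDiffAt (range_mem_nhds_isInteriorPoint hx₀)).snd
  obtain ⟨α, hα, hαc⟩ := (hpl 0).exists_forall_mem_closedBall_eq_hasDerivWithinAt_continuousOn
  set φ := extChartAt I x₀
  set D := Metric.closedBall (φ x₀) (r : ℝ) ×ˢ Icc (0 - ε) (0 + ε)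
  have hD : D ∈ 𝓝 (φ x₀, (0 : ℝ)) :=
    prod_mem_nhds (Metric.closedBall_mem_nhds _ hr) (Icc_mem_nhds (by linarith) (by linarith))
  have hα₀ : interior φ.target ∈ 𝓝 (α (φ x₀, 0)) := by
    rw [(hα _ (Metric.mem_closedBall_self r.2)).1]
    exact isOpen_interior.mem_nhds (I.isInteriorPoint_iff.1 hx₀)
  obtain ⟨V, hV, T, hT, hVT⟩ := mem_nhds_prod_iff.1
    (inter_mem ((hαc.continuousAt hD).preimage_mem_nhds hα₀) hD)
  obtain ⟨δ, hδ, hδT⟩ := Metric.mem_nhds_iff.1 hT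
  rw [Real.ball_eq_Ioo, zero_sub, zero_add] at hδT
  have hmem : ∀ y ∈ V, ∀ t ∈ Ioo (-δ) δ, α (y, t) ∈ interior φ.target ∧ (y, t) ∈ D :=
    fun y hy t ht => hVT (mk_mem_prod hy (hδT ht))
  have h0 : (0 : ℝ) ∈ Ioo (-δ) δ := ⟨neg_lt_zero.2 hδ, hδ⟩
  refine ⟨δ, hδ, φ.source ∩ φ ⁻¹' V, inter_mem (extChartAt_source_mem_nhds x₀)
    ((continuousAt_extChartAt x₀).preimage_mem_nhds hV), fun p => φ.symm (α (φ p.1, p.2)), ?_, ?_⟩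
  · have hφ : ContinuousOn (fun p : N × ℝ => (φ p.1, p.2)) ((φ.source ∩ φ ⁻¹' V) ×ˢ Ioo (-δ) δ) :=
      ((continuousOn_extChartAt x₀).comp continuousOn_fst fun p hp => hp.1.1).prodMk
        continuousOn_snd
    exact (continuousOn_extChartAt_symm x₀).comp
      (hαc.comp hφ fun p hp => (hmem _ hp.1.2 _ hp.2).2)
      fun p hp => interior_subset (hmem _ hp.1.2 _ hp.2).1
  · rintro x ⟨hxs, hxV⟩
    have hxα := hα (φ x) (hmem _ hxV 0 h0).2.1
    refine ⟨?_, fun t ht => ?_⟩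
    · change φ.symm (α (φ x, 0)) = x
      rw [hxα.1, φ.left_inv hxs]
    have htI : Icc (0 - ε) (0 + ε) ∈ 𝓝 t :=
      mem_of_superset (Ioo_mem_nhds ht.1 ht.2) fun s hs => (hmem _ hxV s hs).2.2
    exact (hasMFDerivAt_extChartAt_symm_comp (f := fun t => α (φ x, t)) (hmem _ hxV t ht).1 _
      ((hxα.2 t (hmem _ hxV t ht).2.2).hasDerivAt htI)).hasMFDerivWithinAt

theorem exists_forall_hasLocalFlow {K : Set N}
    (hv : ContMDiff I I.tangent 1 (fun x ↦ (⟨x, v x⟩ : TangentBundle I N))) (hK : IsCompact K) :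
    ∃ ε > 0, ∀ x ∈ K, HasLocalFlow v ε x := by
  refine hK.induction_on (p := fun A => ∃ ε > 0, ∀ x ∈ A, HasLocalFlow v ε x)
    ⟨1, one_pos, fun x hx => hx.elim⟩ ?_ ?_ fun x _ => ?_
  · rintro s t hst ⟨ε, hε, h⟩
    exact ⟨ε, hε, fun x hx => h x (hst hx)⟩
  · rintro s t ⟨ε, hε, hs⟩ ⟨δ, hδ, ht⟩
    exact ⟨min ε δ, lt_min hε hδ, fun x hx => hx.elim
      (fun hx => (hs x hx).mono (min_le_left _ _)) fun hx => (ht x hx).mono (min_le_right _ _)⟩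
  · obtain ⟨ε, hε, h⟩ := exists_hasLocalFlow (hv x)
    exact ⟨_, mem_nhdsWithin_of_mem_nhds h.eventually, ε, hε, fun y hy => hy⟩

end LocalFlow

section InvariantSet

variable {E : Type*} [NormedAddCommGroup E] [NormedSpace ℝ E]
  {H : Type*} [TopologicalSpace H] {I : ModelWithCorners ℝ E H}
  {N : Type*} [TopologicalSpace N] [ChartedSpace H N] [IsManifold I 1 N]
  [BoundarylessManifold I N] [T2Space N] {v : (x : N) → TangentSpace I x} {K : Set N}

theorem exists_isMIntegralCurveOn_union
    (hv : ContMDiff I I.tangent 1 (fun x ↦ (⟨x, v x⟩ : TangentBundle I N))) {γ γ' : ℝ → N}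
    {a b τ ε : ℝ} (hγ : IsMIntegralCurveOn γ v (Ioo a b)) (hτ : τ ∈ Ioo a b) (hε : 0 < ε)
    (hγ' : IsMIntegralCurveOn γ' v (Ioo (-ε) ε)) (h : γ' 0 = γ τ) :
    ∃ Γ : ℝ → N, EqOn Γ γ (Ioo a b) ∧ IsMIntegralCurveOn Γ v (Ioo a b ∪ Ioo (τ - ε) (τ + ε)) := by
  have hshift : IsMIntegralCurveOn (γ' ∘ (· - τ)) v (Ioo (τ - ε) (τ + ε)) := by
    convert (isMIntegralCurveOn_comp_sub (dt := τ)).2 hγ' using 1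
    ext t
    simp only [mem_Ioo, mem_ofPred_eq]
    constructor <;> rintro ⟨h₁, h₂⟩ <;> constructor <;> linarith
  exact ⟨_, piecewise_eqOn _ _ _, isMIntegralCurveOn_piecewise (t₀ := τ) hv hγ hshift
    ⟨hτ, by linarith, by linarith⟩ (by simp [h])⟩

theorem exists_isMIntegralCurve_of_invariant
    (hv : ContMDiff I I.tangent 1 (fun x ↦ (⟨x, v x⟩ : TangentBundle I N))) {ε : ℝ} (hε : 0 < ε)
    (hloc : ∀ y ∈ K, ∃ γ : ℝ → N, γ 0 = y ∧ IsMIntegralCurveOn γ v (Ioo (-ε) ε))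
    (hinv : ∀ (γ : ℝ → N) (a : ℝ), IsMIntegralCurveOn γ v (Ioo (-a) a) → γ 0 ∈ K →
      ∀ t ∈ Ioo (-a) a, γ t ∈ K) {x : N} (hx : x ∈ K) :
    ∃ γ : ℝ → N, γ 0 = x ∧ IsMIntegralCurve γ v := by
  have hextend : ∀ n : ℕ, ∃ γ : ℝ → N, γ 0 = x ∧
      IsMIntegralCurveOn γ v (Ioo (-((n + 1) * (ε / 2))) ((n + 1) * (ε / 2))) := by
    intro n
    induction n with
    | zero =>
      obtain ⟨γ, h0, h⟩ := hloc x hx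
      exact ⟨γ, h0, h.mono (Ioo_subset_Ioo (by simp; linarith) (by simp; linarith))⟩
    | succ n ih =>
      obtain ⟨γ, h0, hγ⟩ := ih
      push_cast
      set a : ℝ := (n + 1) * (ε / 2)
      have haε : ε / 2 ≤ a := le_mul_of_one_le_left (by positivity) (by simp)
      have hτ : a - ε / 4 ∈ Ioo (-a) a := ⟨by linarith, by linarith⟩
      have hτ' : -(a - ε / 4) ∈ Ioo (-a) a := ⟨by linarith, by linarith⟩
      have hK : ∀ t ∈ Ioo (-a) a, γ t ∈ K := hinv γ a hγ (h0 ▸ hx)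
      obtain ⟨γ₁, h₁, hγ₁⟩ := hloc _ (hK _ hτ)
      obtain ⟨γ₂, h₂, hγ₂⟩ := hloc _ (hK _ hτ')
      obtain ⟨Γ₁, hΓ₁γ, hΓ₁⟩ := exists_isMIntegralCurveOn_union hv hγ hτ hε hγ₁ h₁
      replace hΓ₁ := hΓ₁.mono (s' := Ioo (-a) (a + ε / 2))
        ((Ioo_subset_Ioo_right (by linarith)).trans
          (Ioo_subset_Ioo_union_Ioo le_rfl (by linarith) le_rfl))
      obtain ⟨Γ₂, hΓ₂Γ₁, hΓ₂⟩ := exists_isMIntegralCurveOn_union hv hΓ₁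
        (Ioo_subset_Ioo_right (by linarith) hτ') hε hγ₂ (h₂.trans (hΓ₁γ hτ').symm)
      replace hΓ₂ := hΓ₂.mono (s' := Ioo (-(a + ε / 2)) (a + ε / 2)) (union_comm _ _ ▸
        (Ioo_subset_Ioo_left (by linarith)).trans
          (Ioo_subset_Ioo_union_Ioo le_rfl (by linarith) le_rfl))
      refine ⟨Γ₂, ?_, by convert hΓ₂ using 2 <;> ring⟩
      rw [hΓ₂Γ₁ ⟨by linarith, by linarith⟩, hΓ₁γ ⟨by linarith, by linarith⟩, h0]
  rw [exists_isMIntegralCurve_iff_exists_isMIntegralCurveOn_Ioo hv]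
  intro a
  obtain ⟨n, hn⟩ := exists_nat_gt (a / (ε / 2))
  obtain ⟨γ, h0, h⟩ := hextend n
  rw [div_lt_iff₀ (by positivity)] at hn
  exact ⟨γ, h0, h.mono (Ioo_subset_Ioo (by linarith) (by linarith))⟩

variable {φ : ℝ → N → N} (hv : ContMDiff I I.tangent 1 (fun x ↦ (⟨x, v x⟩ : TangentBundle I N)))
  (hφ0 : ∀ x ∈ K, φ 0 x = x) (hφ : ∀ x ∈ K, IsMIntegralCurve (fun t => φ t x) v)
include hv hφ0 hφ

theorem flow_add_of_mapsTo (hmaps : ∀ t, MapsTo (φ t) K K) (s t : ℝ) {x : N} (hx : x ∈ K) :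
    φ (s + t) x = φ s (φ t x) :=
  congrFun (isMIntegralCurve_Ioo_eq_of_contMDiff_boundaryless (t₀ := 0) hv
    ((hφ x hx).comp_add t) (hφ _ (hmaps t hx)) (by simp [hφ0 _ (hmaps t hx)])) s

theorem HasLocalFlow.continuousWithinAt_flow {ε : ℝ} {x : N} (h : HasLocalFlow v ε x) (hx : x ∈ K)
    {s : ℝ} (hs : s ∈ Ioo (-ε) ε) : ContinuousWithinAt (φ s) K x := by
  obtain ⟨U, hU, Φ, hΦ, hcurve⟩ := h
  have heq : ∀ y ∈ U, y ∈ K → φ s y = Φ (y, s) := fun y hyU hyK =>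
    isMIntegralCurveOn_Ioo_eqOn_of_contMDiff_boundaryless (t₀ := 0)
      ⟨by linarith [hs.1, hs.2], by linarith [hs.1, hs.2]⟩ hv ((hφ y hyK).isMIntegralCurveOn _)
      (hcurve y hyU).2 (by rw [hφ0 y hyK, (hcurve y hyU).1]) hs
  have hcont : ContinuousAt (fun y => Φ (y, s)) x :=
    ContinuousAt.comp (f := fun y : N => (y, s))
      (hΦ.continuousAt (prod_mem_nhds hU (Ioo_mem_nhds hs.1 hs.2))) (by fun_prop)
  refine hcont.continuousWithinAt.congr_of_eventuallyEq ?_ (heq x (mem_of_mem_nhds hU) hx)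
  filter_upwards [mem_nhdsWithin_of_mem_nhds hU, self_mem_nhdsWithin] with y using heq y

theorem continuousOn_flow_of_mapsTo [CompleteSpace E] (hK : IsCompact K)
    (hmaps : ∀ t, MapsTo (φ t) K K) (t : ℝ) : ContinuousOn (φ t) K := by
  obtain ⟨ε, hε, hloc⟩ := exists_forall_hasLocalFlow hv hK
  obtain ⟨n, hn⟩ := exists_nat_gt (|t| / ε)
  have hn0 : (0 : ℝ) < n := lt_of_le_of_lt (by positivity) hn
  have hsmall : t / n ∈ Ioo (-ε) ε := by
    rw [mem_Ioo, ← abs_lt, abs_div, abs_of_pos hn0, div_lt_iff₀ hn0]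
    rwa [div_lt_iff₀ hε, mul_comm] at hn
  have hiter : ∀ k : ℕ, ContinuousOn (φ (k * (t / n))) K := by
    intro k
    induction k with
    | zero => simpa using continuousOn_id.congr hφ0
    | succ k ih =>
      refine (ih.comp (fun x hx => (hloc x hx).continuousWithinAt_flow hv hφ0 hφ hx hsmall)
        (hmaps _)).congr fun x hx => ?_
      rw [Function.comp, ← flow_add_of_mapsTo hv hφ0 hφ hmaps _ _ hx]
      congr 1
      push_cast
      ring
  simpa only [mul_div_cancel₀ t hn0.ne'] using hiter n

end InvariantSet

/-! ### The Hamilton flow on the cotangent bundle -/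

theorem t2Space_totalSpace {B F : Type*} [TopologicalSpace B] [TopologicalSpace F]
    (E : B → Type*) [TopologicalSpace (Bundle.TotalSpace F E)] [∀ b, TopologicalSpace (E b)]
    [FiberBundle F E] [T2Space B] [T2Space F] : T2Space (Bundle.TotalSpace F E) := by
  refine ⟨fun x y hxy => ?_⟩
  by_cases hb : x.proj = y.proj
  · set e := trivializationAt F E x.proj
    have hx : x ∈ e.source := FiberBundle.mem_trivializationAt_proj_source
    have hy : y ∈ e.source := by
      rw [e.mem_source, ← hb]
      exact FiberBundle.mem_baseSet_trivializationAt' _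
    obtain ⟨u, v, hu, hv, hxu, hyv, huv⟩ := t2_separation (e.injOn.ne hx hy hxy)
    exact ⟨e.source ∩ e ⁻¹' u, e.source ∩ e ⁻¹' v,
      e.continuousOn.isOpen_inter_preimage e.open_source hu,
      e.continuousOn.isOpen_inter_preimage e.open_source hv, ⟨hx, hxu⟩, ⟨hy, hyv⟩,
      (huv.preimage e).mono inter_subset_right inter_subset_right⟩
  · obtain ⟨u, v, hu, hv, hxu, hyv, huv⟩ := t2_separation hb
    exact ⟨_, _, hu.preimage (FiberBundle.continuous_proj F E),
      hv.preimage (FiberBundle.continuous_proj F E), hxu, hyv, huv.preimage _⟩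

section ModelForm

variable {V : Type*} [NormedAddCommGroup V] [NormedSpace ℝ V]

/-- The standard symplectic form `dξ ∧ dx` of `V × V*`. -/
def modelForm (u v : V × (V →L[ℝ] ℝ)) : ℝ := u.2 v.1 - v.2 u.1

theorem modelForm_sub_left (u u' v : V × (V →L[ℝ] ℝ)) :
    modelForm (u - u') v = modelForm u v - modelForm u' v := by
  simp only [modelForm, Prod.fst_sub, Prod.snd_sub, sub_apply, map_sub]
  ring

theorem symplectic_fderiv_of_tautological {W : Type*} [NormedAddCommGroup W] [NormedSpace ℝ W]
    (B : W →L[ℝ] V →L[ℝ] ℝ) {τ : V × W → V × W} {w₀ : V × W} (hτ : ContDiffAt ℝ 2 τ w₀)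
    (h : ∀ᶠ w in 𝓝 w₀, ∀ u, B (τ w).2 (fderiv ℝ τ w u).1 = B w.2 u.1) (u v : V × W) :
    B (fderiv ℝ τ w₀ u).2 (fderiv ℝ τ w₀ v).1 - B (fderiv ℝ τ w₀ v).2 (fderiv ℝ τ w₀ u).1 =
      B u.2 v.1 - B v.2 u.1 := by
  have hτ' : HasFDerivAt τ (fderiv ℝ τ w₀) w₀ := (hτ.differentiableAt two_ne_zero).hasFDerivAt
  have hτ'' : HasFDerivAt (fderiv ℝ τ) (fderiv ℝ (fderiv ℝ τ) w₀) w₀ :=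
    ((hτ.fderiv_right (m := 1) (by norm_num)).differentiableAt one_ne_zero).hasFDerivAt
  have hsymm : IsSymmSndFDerivAt ℝ τ w₀ := hτ.isSymmSndFDerivAt (by simp)
  -- Differentiate `h` in the direction `v`; antisymmetrizing kills the second derivatives of `τ`.
  have hdiff : ∀ u v : V × W, B (fderiv ℝ τ w₀ v).2 (fderiv ℝ τ w₀ u).1 +
      B (τ w₀).2 (fderiv ℝ (fderiv ℝ τ) w₀ v u).1 = B v.2 u.1 := by
    intro u v
    have hfst : HasFDerivAt (fun w => (fderiv ℝ τ w u).1) _ w₀ :=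
      (ContinuousLinearMap.fst ℝ V W).hasFDerivAt.comp w₀
        ((ContinuousLinearMap.apply ℝ (V × W) u).hasFDerivAt.comp w₀ hτ'')
    have hleft := ((B.hasFDerivAt.comp w₀ hτ'.snd).clm_apply hfst).congr_of_eventuallyEq
      (f₁ := fun w : V × W => B w.2 u.1) (h.mono fun w hw => (hw u).symm)
    have hright : HasFDerivAt (fun w : V × W => B w.2 u.1) _ w₀ :=
      (ContinuousLinearMap.apply ℝ ℝ u.1).hasFDerivAt.comp w₀
        (B.hasFDerivAt.comp w₀ hasFDerivAt_snd)
    simpa [add_comm] using congrArg (fun L => L v) (hleft.unique hright)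
  have huv := hdiff u v
  have hvu := hdiff v u
  rw [hsymm.eq v u] at huv
  linarith

end ModelForm

section ModelHamilton

variable {ι : Type*} [Fintype ι]

theorem eq_zero_of_modelForm_eq_zero {u : EuclideanSpace ℝ ι × (EuclideanSpace ℝ ι →L[ℝ] ℝ)}
    (h : ∀ v, modelForm u v = 0) : u = 0 := by
  refine Prod.ext ?_ ?_
  · ext i
    simpa [modelForm] using h (0, EuclideanSpace.proj i)
  · ext x
    simpa [modelForm] using h (x, 0)

/-- The Hamilton vector of a linear form `L` on `ℝ^ι × (ℝ^ι)*`, that is the vector dual to `-L`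
for `modelForm`; the Hamilton field of `p` at `z` is the Hamilton vector of `dp(z)`. -/
noncomputable def modelHamilton (L : EuclideanSpace ℝ ι × (EuclideanSpace ℝ ι →L[ℝ] ℝ) →L[ℝ] ℝ) :
    EuclideanSpace ℝ ι × (EuclideanSpace ℝ ι →L[ℝ] ℝ) :=
  (WithLp.toLp 2 fun i => L (0, EuclideanSpace.proj i),
    -L.comp (ContinuousLinearMap.inl ℝ (EuclideanSpace ℝ ι) (EuclideanSpace ℝ ι →L[ℝ] ℝ)))

theorem modelForm_modelHamilton (L : EuclideanSpace ℝ ι × (EuclideanSpace ℝ ι →L[ℝ] ℝ) →L[ℝ] ℝ)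
    (v : EuclideanSpace ℝ ι × (EuclideanSpace ℝ ι →L[ℝ] ℝ)) :
    modelForm (modelHamilton L) v = -L v := by
  classical
  obtain ⟨y, η⟩ := v
  have hη : ∀ x, η x = ∑ i, x i * η (EuclideanSpace.single i 1) := fun x => by
    conv_lhs => rw [← (EuclideanSpace.basisFun ι ℝ).sum_repr x]
    simp
  have hη' : η = ∑ i, η (EuclideanSpace.single i 1) • EuclideanSpace.proj i := by
    ext x
    simp [hη x, mul_comm]
  have hL : L (0, η) = η (modelHamilton L).1 := by
    calc L (0, η) = L.comp (ContinuousLinearMap.inr ℝ _ _) η := rfl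
      _ = ∑ i, η (EuclideanSpace.single i 1) * L (0, EuclideanSpace.proj i) := by
        conv_lhs => rw [hη', map_sum]
        simp
      _ = η (modelHamilton L).1 := by
        rw [hη]
        exact Finset.sum_congr rfl fun i _ => mul_comm _ _
  have hsplit : L (y, η) = L (y, 0) + L (0, η) := by rw [← map_add]; simp
  rw [hsplit, hL, modelForm, neg_add, ← sub_eq_add_neg]
  rfl

set_option synthInstance.maxHeartbeats 200000 in
-- The instances on spaces of linear maps between spaces of linear maps are slow to synthesize.
theorem contDiff_modelHamilton {n : WithTop ℕ∞} :
    ContDiff ℝ n (modelHamilton (ι := ι)) := by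
  refine ContDiff.prodMk ?_ (contDiff_id.clm_comp contDiff_const).neg
  exact contDiff_euclidean.2 fun i => contDiff_id.clm_apply contDiff_const

end ModelHamilton

section ChartChange

variable {E H N : Type*} [NormedAddCommGroup E] [NormedSpace ℝ E] [TopologicalSpace H]
  {I : ModelWithCorners ℝ E H} [I.Boundaryless] [TopologicalSpace N] [ChartedSpace H N] {x y z : N}

theorem hasFDerivAt_tangentCoordChange [IsManifold I 1 N]
    (h : z ∈ (extChartAt I x).source ∩ (extChartAt I y).source) :
    HasFDerivAt (extChartAt I y ∘ (extChartAt I x).symm) (tangentCoordChange I x y z)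
      (extChartAt I x z) := by
  simpa [I.range_eq_univ] using hasFDerivWithinAt_tangentCoordChange h

theorem eventually_mem_target_and_symm_mem_source
    (h : z ∈ (extChartAt I x).source ∩ (extChartAt I y).source) :
    ∀ᶠ w in 𝓝 (extChartAt I x z), w ∈ (extChartAt I x).target ∧
      (extChartAt I x).symm w ∈ (extChartAt I y).source := by
  have htarget : (extChartAt I x).target ∈ 𝓝 (extChartAt I x z) :=
    (isOpen_extChartAt_target x).mem_nhds ((extChartAt I x).map_source h.1)
  refine (eventually_mem_set.2 htarget).and ((continuousAt_extChartAt_symm' h.1).eventually ?_)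
  rw [(extChartAt I x).left_inv h.1]
  exact (isOpen_extChartAt_source y).mem_nhds h.2

theorem contDiffAt_extChartAt_comp_symm {n : WithTop ℕ∞} [IsManifold I n N]
    (h : z ∈ (extChartAt I x).source ∩ (extChartAt I y).source) :
    ContDiffAt ℝ n (extChartAt I y ∘ (extChartAt I x).symm) (extChartAt I x z) := by
  have hs : extChartAt I x z ∈ ((extChartAt I x).symm ≫ extChartAt I y).source := by
    rw [PartialEquiv.trans_source'', PartialEquiv.symm_symm, PartialEquiv.symm_target]
    exact mem_image_of_mem _ h
  have := contDiffWithinAt_ext_coord_change (n := n) y x hs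
  rwa [I.range_eq_univ, contDiffWithinAt_univ] at this

end ChartChange

section Cotangent

variable {M : Type*} [TopologicalSpace M] [ChartedSpace Plane M] [IsManifold 𝓘(ℝ, Plane) ω M]

instance [T2Space M] : T2Space (Cotangent M) := t2Space_totalSpace _

theorem extChartAt_cotangent_fst (z₀ z : Cotangent M) :
    (extChartAt phaseI z₀ z).1 = extChartAt 𝓘(ℝ, Plane) z₀.1 z.1 :=
  rfl

theorem mem_extChartAt_cotangent_source (z₀ z : Cotangent M) :
    z ∈ (extChartAt phaseI z₀).source ↔ z.1 ∈ (extChartAt 𝓘(ℝ, Plane) z₀.1).source := by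
  rw [extChartAt_source, FiberBundle.chartedSpace_chartAt, extChartAt_source]
  simp only [mfld_simps]
  exact ⟨fun h => h.1.1, fun h => ⟨⟨h, trivial⟩, by rwa [hom_trivializationAt_apply]⟩⟩

theorem extChartAt_cotangent_snd (z₀ z : Cotangent M) (h : z ∈ (extChartAt phaseI z₀).source)
    (u : Plane) : (extChartAt phaseI z₀ z).2 u =
      (show Plane →L[ℝ] ℝ from z.2) (tangentCoordChange 𝓘(ℝ, Plane) z₀.1 z.1 z.1 u) := by
  rw [mem_extChartAt_cotangent_source, extChartAt_source] at h
  have hchart : extChartAt phaseI z₀ z = chartAt (ModelProd Plane (Plane →L[ℝ] ℝ)) z₀ z := rfl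
  rw [hchart, hom_chart, ContinuousLinearMap.inCoordinates,
    TangentBundle.symmL_trivializationAt_eq_core h]
  simp only [Bundle.Trivial.fiberBundle_trivializationAt',
    Bundle.Trivial.continuousLinearMapAt_trivialization]
  rfl

theorem tangentCoordChange_cotangent_fst {z₁ z₀ z : Cotangent M}
    (h : z ∈ (extChartAt phaseI z₁).source ∩ (extChartAt phaseI z₀).source) (u : PhaseModel) :
    (tangentCoordChange phaseI z₁ z₀ z u).1 =
      tangentCoordChange 𝓘(ℝ, Plane) z₁.1 z₀.1 z.1 u.1 := by
  have hbase : HasFDerivAt (extChartAt 𝓘(ℝ, Plane) z₀.1 ∘ (extChartAt 𝓘(ℝ, Plane) z₁.1).symm)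
      (tangentCoordChange 𝓘(ℝ, Plane) z₁.1 z₀.1 z.1) (extChartAt phaseI z₁ z).1 := by
    rw [extChartAt_cotangent_fst]
    exact hasFDerivAt_tangentCoordChange
      ⟨(mem_extChartAt_cotangent_source _ _).1 h.1, (mem_extChartAt_cotangent_source _ _).1 h.2⟩
  have hcomp := (hbase.comp _ (hasFDerivAt_fst (𝕜 := ℝ) (E := Plane) (F := Plane →L[ℝ] ℝ)))
  have hcover : (fun w => ((extChartAt phaseI z₀ ∘ (extChartAt phaseI z₁).symm) w).1)
      =ᶠ[𝓝 (extChartAt phaseI z₁ z)]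
      (extChartAt 𝓘(ℝ, Plane) z₀.1 ∘ (extChartAt 𝓘(ℝ, Plane) z₁.1).symm) ∘ Prod.fst := by
    filter_upwards [eventually_mem_target_and_symm_mem_source h] with w hw
    have hfst : w.1 = extChartAt 𝓘(ℝ, Plane) z₁.1 ((extChartAt phaseI z₁).symm w).1 := by
      rw [← extChartAt_cotangent_fst, (extChartAt phaseI z₁).right_inv hw.1]
    simp only [Function.comp_apply, extChartAt_cotangent_fst]
    rw [hfst, (extChartAt 𝓘(ℝ, Plane) z₁.1).left_inv
      ((mem_extChartAt_cotangent_source _ _).1 ((extChartAt phaseI z₁).map_target hw.1))]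
  exact congrArg (fun L => L u)
    ((hasFDerivAt_tangentCoordChange h).fst.unique (hcomp.congr_of_eventuallyEq hcover))

theorem tautologicalForm_tangentCoordChange {z₁ z₀ z : Cotangent M}
    (h : z ∈ (extChartAt phaseI z₁).source ∩ (extChartAt phaseI z₀).source) (u : PhaseModel) :
    (extChartAt phaseI z₀ z).2 (tangentCoordChange phaseI z₁ z₀ z u).1 =
      (extChartAt phaseI z₁ z).2 u.1 := by
  rw [tangentCoordChange_cotangent_fst h, extChartAt_cotangent_snd _ _ h.2,
    extChartAt_cotangent_snd _ _ h.1, tangentCoordChange_comp ⟨⟨?_, ?_⟩, mem_extChartAt_source _⟩]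
  · exact (mem_extChartAt_cotangent_source _ _).1 h.1
  · exact (mem_extChartAt_cotangent_source _ _).1 h.2

theorem modelForm_tangentCoordChange {z₁ z₀ z : Cotangent M}
    (h : z ∈ (extChartAt phaseI z₁).source ∩ (extChartAt phaseI z₀).source) (u v : PhaseModel) :
    modelForm (tangentCoordChange phaseI z₁ z₀ z u) (tangentCoordChange phaseI z₁ z₀ z v) =
      modelForm u v := by
  rw [← (hasFDerivAt_tangentCoordChange h).fderiv]
  refine symplectic_fderiv_of_tautological (ContinuousLinearMap.id ℝ (Plane →L[ℝ] ℝ))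
    (contDiffAt_extChartAt_comp_symm h) ?_ u v
  filter_upwards [eventually_mem_target_and_symm_mem_source h] with w ⟨hwt, hws⟩ u
  have hw := (extChartAt phaseI z₁).right_inv hwt
  have h' := And.intro ((extChartAt phaseI z₁).map_target hwt) hws
  have hτ := hasFDerivAt_tangentCoordChange h'
  rw [hw] at hτ
  rw [hτ.fderiv]
  have htaut := tautologicalForm_tangentCoordChange h' u
  rwa [hw] at htaut

end Cotangent

section HamiltonFlow

variable {M : Type*} [TopologicalSpace M] [ChartedSpace Plane M] [IsManifold 𝓘(ℝ, Plane) ω M]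
  {p : Cotangent M → ℝ}

theorem contDiffAt_comp_extChartAt_symm {n : WithTop ℕ∞} {q : Cotangent M → ℝ}
    (hq : ContMDiff phaseI 𝓘(ℝ, ℝ) n q) (z₀ : Cotangent M) {w : PhaseModel}
    (hw : w ∈ (extChartAt phaseI z₀).target) :
    ContDiffAt ℝ n (q ∘ (extChartAt phaseI z₀).symm) w := by
  have hsymm : ContMDiffAt 𝓘(ℝ, PhaseModel) phaseI n (extChartAt phaseI z₀).symm w :=
    ((contMDiffOn_extChartAt_symm z₀).contMDiffAt
      ((isOpen_extChartAt_target z₀).mem_nhds hw)).of_le le_top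
  exact ((hq _).comp w hsymm).contDiffAt

theorem hasFDerivAt_comp_extChartAt_symm {z₀ z : Cotangent M}
    (hp : MDifferentiableAt phaseI 𝓘(ℝ, ℝ) p z) (h : z ∈ (extChartAt phaseI z₀).source) :
    HasFDerivAt (p ∘ (extChartAt phaseI z₀).symm)
      (fderiv ℝ (p ∘ (extChartAt phaseI z₀).symm) (extChartAt phaseI z₀ z))
      (extChartAt phaseI z₀ z) := by
  have htarget := (extChartAt phaseI z₀).map_source h
  have hsymm : MDifferentiableAt 𝓘(ℝ, PhaseModel) phaseI (extChartAt phaseI z₀).symm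
      (extChartAt phaseI z₀ z) :=
    ((contMDiffOn_extChartAt_symm (n := 1) z₀).contMDiffAt
      ((isOpen_extChartAt_target z₀).mem_nhds htarget)).mdifferentiableAt one_ne_zero
  rw [← (extChartAt phaseI z₀).left_inv h] at hp
  exact (hp.comp _ hsymm).differentiableAt.hasFDerivAt

theorem differential_apply {z₀ z : Cotangent M} (hp : MDifferentiableAt phaseI 𝓘(ℝ, ℝ) p z)
    (h : z ∈ (extChartAt phaseI z₀).source) (u : PhaseModel) :
    differential p z u = fderiv ℝ (p ∘ (extChartAt phaseI z₀).symm) (extChartAt phaseI z₀ z)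
      (tangentCoordChange phaseI z z₀ z u) := by
  have hz := And.intro (mem_extChartAt_source (I := phaseI) z) h
  have hcenter : HasFDerivAt (p ∘ (extChartAt phaseI z).symm) (differential p z)
      (extChartAt phaseI z z) := by
    have hd : HasFDerivWithinAt (p ∘ (extChartAt phaseI z).symm) (differential p z)
      (range phaseI) (extChartAt phaseI z z) := hp.hasMFDerivAt.2
    rwa [ModelWithCorners.range_eq_univ, hasFDerivWithinAt_univ] at hd
  have hchart := hasFDerivAt_comp_extChartAt_symm hp h
  have hpoint : extChartAt phaseI z₀ z =
      (extChartAt phaseI z₀ ∘ (extChartAt phaseI z).symm) (extChartAt phaseI z z) := by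
    rw [Function.comp_apply, (extChartAt phaseI z).left_inv hz.1]
  have hcomp := (hpoint ▸ hchart).comp _ (hasFDerivAt_tangentCoordChange hz)
  have hcover : (p ∘ (extChartAt phaseI z).symm) =ᶠ[𝓝 (extChartAt phaseI z z)]
      (p ∘ (extChartAt phaseI z₀).symm) ∘ (extChartAt phaseI z₀ ∘ (extChartAt phaseI z).symm) := by
    filter_upwards [eventually_mem_target_and_symm_mem_source hz] with w hw
    simp only [Function.comp_apply, (extChartAt phaseI z₀).left_inv hw.2]
  rw [hcenter.unique (hcomp.congr_of_eventuallyEq hcover), hpoint]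
  rfl

theorem tangentCoordChange_hamiltonField {z₀ z : Cotangent M}
    (hp : MDifferentiableAt phaseI 𝓘(ℝ, ℝ) p z) (h : z ∈ (extChartAt phaseI z₀).source) :
    tangentCoordChange phaseI z z₀ z (hamiltonField p z) =
      modelHamilton (fderiv ℝ (p ∘ (extChartAt phaseI z₀).symm) (extChartAt phaseI z₀ z)) := by
  change tangentCoordChange phaseI z z₀ z (modelHamilton (differential p z)) = _
  rw [← sub_eq_zero]
  refine eq_zero_of_modelForm_eq_zero fun v => ?_
  have hz : z ∈ (extChartAt phaseI z).source := mem_extChartAt_source z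
  have hv : v = tangentCoordChange phaseI z z₀ z (tangentCoordChange phaseI z₀ z z v) := by
    rw [tangentCoordChange_comp ⟨⟨h, hz⟩, h⟩, tangentCoordChange_self h]
  rw [modelForm_sub_left, modelForm_modelHamilton, sub_neg_eq_add, hv,
    modelForm_tangentCoordChange ⟨hz, h⟩, ← differential_apply hp h, modelForm_modelHamilton,
    neg_add_cancel]

theorem contMDiff_hamiltonField (hp : ContMDiff phaseI 𝓘(ℝ, ℝ) 2 p) :
    ContMDiff phaseI phaseI.tangent 1
      (fun z ↦ (⟨z, hamiltonField p z⟩ : TangentBundle phaseI (Cotangent M))) := by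
  intro z₀
  rw [Bundle.contMDiffAt_totalSpace]
  refine ⟨contMDiffAt_id, ?_⟩
  have hcoord : (fun z => (trivializationAt PhaseModel (TangentSpace phaseI) z₀
        (⟨z, hamiltonField p z⟩ : TangentBundle phaseI (Cotangent M))).2) =ᶠ[𝓝 z₀] fun z =>
      modelHamilton (fderiv ℝ (p ∘ (extChartAt phaseI z₀).symm) (extChartAt phaseI z₀ z)) := by
    filter_upwards [extChartAt_source_mem_nhds (I := phaseI) z₀] with z hz
    rw [← tangentCoordChange_hamiltonField ((hp z).mdifferentiableAt two_ne_zero) hz]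
    rfl
  have hmodel : ContDiffAt ℝ 1
      (fun w => modelHamilton (fderiv ℝ (p ∘ (extChartAt phaseI z₀).symm) w))
      (extChartAt phaseI z₀ z₀) :=
    (contDiff_modelHamilton (ι := Fin 2)).contDiffAt.comp _
      ((contDiffAt_comp_extChartAt_symm hp z₀ (mem_extChartAt_target z₀)).fderiv_right le_rfl)
  exact (hmodel.contMDiffAt.comp z₀ contMDiffAt_extChartAt).congr_of_eventuallyEq hcoord

theorem apply_eq_of_differential_eq_zero {v : ∀ z : Cotangent M, TangentSpace phaseI z}
    {f : Cotangent M → ℝ} (hf : MDifferentiable phaseI 𝓘(ℝ, ℝ) f)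
    (hfv : ∀ z, differential f z (v z) = 0) {γ : ℝ → Cotangent M} {a b : ℝ}
    (hγ : IsMIntegralCurveOn γ v (Ioo a b)) {s t : ℝ} (hs : s ∈ Ioo a b) (ht : t ∈ Ioo a b) :
    f (γ s) = f (γ t) := by
  have hd : ∀ t ∈ Ioo a b, HasFDerivAt (f ∘ γ) (0 : ℝ →L[ℝ] ℝ) t := by
    intro t ht
    have hγt := (hγ t ht).hasMFDerivAt (Ioo_mem_nhds ht.1 ht.2)
    refine (((hf (γ t)).hasMFDerivAt.comp t hγt).hasFDerivAt).congr_fderiv ?_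
    ext
    change differential f (γ t) ((1 : ℝ) • v (γ t)) = 0
    rw [one_smul]
    exact hfv (γ t)
  exact (convex_Ioo a b).is_const_of_fderivWithin_eq_zero (𝕜 := ℝ) (f := f ∘ γ)
    (fun t ht => (hd t ht).differentiableAt.differentiableWithinAt)
    (fun t ht => by rw [fderivWithin_of_isOpen isOpen_Ioo ht, (hd t ht).fderiv]) hs ht

theorem differential_hamiltonField_self (z : Cotangent M) :
    differential p z (hamiltonField p z) = 0 := by
  have hself : (0 : ℝ) = -differential p z (hamiltonField p z) :=
    (sub_self _).symm.trans
      (modelForm_modelHamilton (differential p z) (modelHamilton (differential p z)))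
  linarith

instance : FirstCountableTopology (Cotangent M) :=
  ⟨fun z => by
    rw [← map_extChartAt_symm_nhdsWithin_range (I := phaseI) z]
    infer_instance⟩

variable [T2Space M] (hp : ContMDiff phaseI 𝓘(ℝ, ℝ) 2 p)
include hp

theorem hamiltonFlow_eq {γ : ℝ → Cotangent M}
    (hγ : IsMIntegralCurve (I := phaseI) γ (hamiltonField p)) (t : ℝ) :
    hamiltonFlow p t (γ 0) = γ t := by
  have h : ∃ γ' : ℝ → Cotangent M, γ' 0 = γ 0 ∧
    IsMIntegralCurve (I := phaseI) γ' (hamiltonField p) := ⟨γ, rfl, hγ⟩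
  rw [hamiltonFlow, dif_pos h]
  exact congrFun (isMIntegralCurve_Ioo_eq_of_contMDiff_boundaryless (t₀ := 0)
    (contMDiff_hamiltonField hp) h.choose_spec.2 hγ h.choose_spec.1) t

variable (hcompact : IsCompact (p ⁻¹' {0}))
include hcompact

theorem exists_hamilton_integralCurve {z : Cotangent M} (hz : p z = 0) :
    ∃ γ : ℝ → Cotangent M, γ 0 = z ∧ IsMIntegralCurve (I := phaseI) γ (hamiltonField p) := by
  obtain ⟨ε, hε, hloc⟩ := exists_forall_hasLocalFlow (contMDiff_hamiltonField hp) hcompact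
  refine exists_isMIntegralCurve_of_invariant (K := p ⁻¹' {0}) (contMDiff_hamiltonField hp) hε
    (fun y hy => (hloc y hy).exists_isMIntegralCurveOn) ?_ hz
  intro γ a hγ hγ0 t ht
  have h0 : (0 : ℝ) ∈ Ioo (-a) a := ⟨by linarith [ht.1, ht.2], by linarith [ht.1, ht.2]⟩
  exact (apply_eq_of_differential_eq_zero (hp.mdifferentiable two_ne_zero)
    differential_hamiltonField_self hγ ht h0).trans hγ0

theorem isMIntegralCurve_hamiltonFlow {z : Cotangent M} (hz : p z = 0) :
    IsMIntegralCurve (I := phaseI) (fun t => hamiltonFlow p t z) (hamiltonField p) := by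
  obtain ⟨γ, rfl, hγ⟩ := exists_hamilton_integralCurve hp hcompact hz
  simpa only [hamiltonFlow_eq hp hγ] using hγ

theorem hamiltonFlow_zero {z : Cotangent M} (hz : p z = 0) : hamiltonFlow p 0 z = z := by
  obtain ⟨γ, rfl, hγ⟩ := exists_hamilton_integralCurve hp hcompact hz
  exact hamiltonFlow_eq hp hγ 0

theorem apply_hamiltonFlow {z : Cotangent M} (hz : p z = 0) (t : ℝ) :
    p (hamiltonFlow p t z) = 0 := by
  have hcurve := (isMIntegralCurve_hamiltonFlow hp hcompact hz).isMIntegralCurveOn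
    (Ioo (-(|t| + 1)) (|t| + 1))
  have hconst := apply_eq_of_differential_eq_zero (hp.mdifferentiable two_ne_zero)
    differential_hamiltonField_self hcurve (s := t) (t := 0) (abs_lt.1 (lt_add_one _))
    (abs_lt.1 (by rw [abs_zero]; positivity))
  rwa [hamiltonFlow_zero hp hcompact hz, hz] at hconst

theorem continuousOn_hamiltonFlow (t : ℝ) : ContinuousOn (hamiltonFlow p t) (p ⁻¹' {0}) :=
  continuousOn_flow_of_mapsTo (contMDiff_hamiltonField hp)
    (fun _ hx => hamiltonFlow_zero hp hcompact hx)
    (fun _ hx => isMIntegralCurve_hamiltonFlow hp hcompact hx) hcompact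
    (fun t _ hz => apply_hamiltonFlow hp hcompact hz t) t

theorem continuousOn_flowAverage {q : Cotangent M → ℝ} (hq : Continuous q) (T : ℝ) :
    ContinuousOn (flowAverage p q T) (p ⁻¹' {0}) := by
  refine continuousOn_const.mul fun z hz => ?_
  obtain ⟨C, hC⟩ := hcompact.exists_bound_of_continuousOn hq.continuousOn
  refine intervalIntegral.continuousWithinAt_of_dominated_interval (bound := fun _ => C) ?_ ?_
    intervalIntegrable_const (Eventually.of_forall fun t _ =>
      hq.continuousAt.comp_continuousWithinAt (continuousOn_hamiltonFlow hp hcompact t z hz))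
  · filter_upwards [self_mem_nhdsWithin] with w hw
    exact (hq.comp (isMIntegralCurve_hamiltonFlow hp hcompact hw).continuous).aestronglyMeasurable
  · filter_upwards [self_mem_nhdsWithin] with w hw
    exact Eventually.of_forall fun t _ => hC _ (apply_hamiltonFlow hp hcompact hw t)

end HamiltonFlow

/-! ### Averages along lines and on tori -/

section LineAverage

variable {V E : Type*} [NormedAddCommGroup V] [NormedSpace ℝ V] [NormedAddCommGroup E]
  {Q P : V → E}

theorem intervalIntegrable_line (hQ : Continuous Q) (w x : V) (a b : ℝ) :
    IntervalIntegrable (fun t : ℝ => Q (x + t • w)) volume a b :=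
  (hQ.comp (by fun_prop)).intervalIntegrable a b

variable [NormedSpace ℝ E]

/-- The average of `Q` over the segment from `x` to `x + T w`; the flow averages are of this form
in action-angle coordinates. For `T = 0` it has the junk value `0`. -/
noncomputable def lineAverage (Q : V → E) (w : V) (T : ℝ) (x : V) : E :=
  T⁻¹ • ∫ t in (0 : ℝ)..T, Q (x + t • w)

theorem lineAverage_sub (hQ : Continuous Q) (hP : Continuous P) (w : V) (T : ℝ) (x : V) :
    lineAverage (fun x => Q x - P x) w T x = lineAverage Q w T x - lineAverage P w T x := by
  simp only [lineAverage]
  rw [intervalIntegral.integral_sub (intervalIntegrable_line hQ w x _ _)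
    (intervalIntegrable_line hP w x _ _), smul_sub]

theorem lineAverage_add (hQ : Continuous Q) (hP : Continuous P) (w : V) (T : ℝ) (x : V) :
    lineAverage (fun x => Q x + P x) w T x = lineAverage Q w T x + lineAverage P w T x := by
  simp only [lineAverage]
  rw [intervalIntegral.integral_add (intervalIntegrable_line hQ w x _ _)
    (intervalIntegrable_line hP w x _ _), smul_add]

theorem norm_lineAverage_le {C : ℝ} (hC : ∀ x, ‖Q x‖ ≤ C) (w : V) {T : ℝ} (hT : 0 < T) (x : V) :
    ‖lineAverage Q w T x‖ ≤ C := by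
  rw [lineAverage, norm_smul, norm_inv, Real.norm_of_nonneg hT.le, inv_mul_le_iff₀ hT]
  have := intervalIntegral.norm_integral_le_of_norm_le_const (a := 0) (b := T) (C := C)
    (f := fun t : ℝ => Q (x + t • w)) (fun t _ => hC _)
  rwa [sub_zero, abs_of_pos hT, mul_comm] at this

theorem norm_lineAverage_sub_le (hQ : Continuous Q) (hP : Continuous P) {C : ℝ}
    (hC : ∀ x, ‖Q x - P x‖ ≤ C) (w : V) {T : ℝ} (hT : 0 < T) (x : V) :
    ‖lineAverage Q w T x - lineAverage P w T x‖ ≤ C := by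
  rw [← lineAverage_sub hQ hP]
  exact norm_lineAverage_le hC w hT x

theorem continuous_lineAverage (hQ : Continuous Q) (w : V) (T : ℝ) :
    Continuous (lineAverage Q w T) :=
  continuous_const.smul (intervalIntegral.continuous_parametric_intervalIntegral_of_continuous'
    (f := fun x t => Q (x + t • w)) (hQ.comp (by fun_prop)) 0 T)

end LineAverage

theorem finrank_phaseModel : Module.finrank ℝ PhaseModel = 4 := by
  have h : Module.finrank ℝ (Plane →L[ℝ] ℝ) = 2 := by
    rw [← (LinearMap.toContinuousLinearMap (𝕜 := ℝ) (E := Plane) (F' := ℝ)).finrank_eq,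
      Module.finrank_linearMap]
    simp
  rw [Module.finrank_prod, h]
  simp

theorem surjective_of_symplectic (D : (Fin 2 → ℝ) × (Fin 2 → ℝ) →L[ℝ] PhaseModel)
    (h : ∀ u v, modelForm (D u) (D v) = (∑ i, u.2 i * v.1 i) - ∑ i, v.2 i * u.1 i) :
    Function.Surjective D := by
  have hinj : Function.Injective D := by
    rw [injective_iff_map_eq_zero]
    intro u hu
    have hpairing : ∀ v : (Fin 2 → ℝ) × (Fin 2 → ℝ),
        (∑ i, u.2 i * v.1 i) - ∑ i, v.2 i * u.1 i = 0 := fun v => by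
      rw [← h, hu]
      simp [modelForm]
    refine Prod.ext (funext fun i => ?_) (funext fun i => ?_)
    · simpa [Pi.single_apply] using hpairing (0, Pi.single i 1)
    · simpa [Pi.single_apply] using hpairing (Pi.single i 1, 0)
  exact (LinearMap.injective_iff_surjective_of_finrank_eq_finrank (f := D.toLinearMap)
    (by rw [finrank_phaseModel]; simp)).1 hinj

namespace ActionAngleChart

variable {M : Type*} [TopologicalSpace M] [ChartedSpace Plane M] [IsManifold 𝓘(ℝ, Plane) ω M]
  {p f : Cotangent M → ℝ} {a₀ : ℝ} (c : ActionAngleChart p f a₀)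

/-- The frequency vector of the torus with parameter `a`. -/
noncomputable def frequencyVector (a : ℝ) : Fin 2 → ℝ := fun i => c.frequency i a

theorem contMDiffAt_κ (x : Fin 2 → ℝ) {ξ : Fin 2 → ℝ} (hξ : ξ ∈ c.B) :
    ContMDiffAt 𝓘(ℝ, (Fin 2 → ℝ) × (Fin 2 → ℝ)) phaseI ω c.κ (x, ξ) :=
  c.analytic_κ.contMDiffAt ((isOpen_univ.prod c.isOpen_B).mem_nhds ⟨mem_univ _, hξ⟩)

theorem continuous_κ_left {ξ : Fin 2 → ℝ} (hξ : ξ ∈ c.B) : Continuous fun x => c.κ (x, ξ) :=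
  continuous_iff_continuousAt.2 fun x =>
    (c.contMDiffAt_κ x hξ).continuousAt.comp (f := fun x => (x, ξ)) (by fun_prop)

theorem κ_periodic (x : Fin 2 → ℝ) {ξ : Fin 2 → ℝ} (hξ : ξ ∈ c.B) (k : Fin 2 → ℤ) :
    c.κ (fun i => x i + 2 * Real.pi * k i, ξ) = c.κ (x, ξ) :=
  ((c.κ_eq_iff x _ ξ hξ ξ hξ).2 ⟨rfl, k, fun _ => rfl⟩).symm

theorem hasMFDerivAt_κ (x : Fin 2 → ℝ) {ξ : Fin 2 → ℝ} (hξ : ξ ∈ c.B) :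
    HasMFDerivAt 𝓘(ℝ, (Fin 2 → ℝ) × (Fin 2 → ℝ)) phaseI c.κ (x, ξ)
      (mfderiv 𝓘(ℝ, (Fin 2 → ℝ) × (Fin 2 → ℝ)) phaseI c.κ (x, ξ)) :=
  ((c.contMDiffAt_κ x hξ).mdifferentiableAt (by simp)).hasMFDerivAt

theorem differential_mfderiv_κ (hp : MDifferentiable phaseI 𝓘(ℝ, ℝ) p) (x : Fin 2 → ℝ) {a : ℝ}
    (ha : c.action a ∈ c.B) (v : (Fin 2 → ℝ) × (Fin 2 → ℝ)) :
    differential p (c.κ (x, c.action a))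
        (mfderiv 𝓘(ℝ, (Fin 2 → ℝ) × (Fin 2 → ℝ)) phaseI c.κ (x, c.action a) v) =
      ∑ i, v.2 i * c.frequency i a := by
  let D : (Fin 2 → ℝ) × (Fin 2 → ℝ) →L[ℝ] PhaseModel :=
    mfderiv 𝓘(ℝ, (Fin 2 → ℝ) × (Fin 2 → ℝ)) phaseI c.κ (x, c.action a)
  have hκ : HasMFDerivAt 𝓘(ℝ, (Fin 2 → ℝ) × (Fin 2 → ℝ)) phaseI c.κ (x, c.action a) D :=
    c.hasMFDerivAt_κ x ha
  have hpκ : HasFDerivAt (p ∘ c.κ) ((differential p (c.κ (x, c.action a))).comp D)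
      (x, c.action a) := ((hp _).hasMFDerivAt.comp _ hκ).hasFDerivAt
  have haction : DifferentiableAt ℝ (fun ξ : Fin 2 → ℝ => p (c.κ (0, ξ))) (c.action a) :=
    ((hp _).hasMFDerivAt.comp _ (c.hasMFDerivAt_κ 0 ha)).hasFDerivAt.differentiableAt.comp
      (c.action a) (f := fun ξ : Fin 2 → ℝ => ((0 : Fin 2 → ℝ), ξ)) (by fun_prop)
  have hsnd := (haction.hasFDerivAt.comp (x, c.action a)
    (hasFDerivAt_snd (𝕜 := ℝ) (E := Fin 2 → ℝ) (F := Fin 2 → ℝ))).congr_of_eventuallyEq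
    (f₁ := p ∘ c.κ) (by
      filter_upwards [(isOpen_univ.prod c.isOpen_B).mem_nhds
        (show (x, c.action a) ∈ univ ×ˢ c.B from ⟨mem_univ _, ha⟩)] with w hw
      exact c.p_indep_angle w.1 w.2 hw.2)
  have heq : differential p (c.κ (x, c.action a)) (D v) =
      fderiv ℝ (fun ξ : Fin 2 → ℝ => p (c.κ (0, ξ))) (c.action a) v.2 :=
    congrArg (fun L => L v) (hpκ.unique hsnd)
  refine heq.trans ?_
  conv_lhs => rw [pi_eq_sum_univ' v.2]
  simp only [map_sum, map_smul, smul_eq_mul, frequency]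

theorem mfderiv_κ_frequency (hp : MDifferentiable phaseI 𝓘(ℝ, ℝ) p) (x : Fin 2 → ℝ) {a : ℝ}
    (ha : c.action a ∈ c.B) :
    mfderiv 𝓘(ℝ, (Fin 2 → ℝ) × (Fin 2 → ℝ)) phaseI c.κ (x, c.action a)
      ((c.frequencyVector a, 0) : (Fin 2 → ℝ) × (Fin 2 → ℝ)) =
        hamiltonField p (c.κ (x, c.action a)) := by
  let D : (Fin 2 → ℝ) × (Fin 2 → ℝ) →L[ℝ] PhaseModel :=
    mfderiv 𝓘(ℝ, (Fin 2 → ℝ) × (Fin 2 → ℝ)) phaseI c.κ (x, c.action a)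
  have hD : ∀ u v, modelForm (D u) (D v) = (∑ i, u.2 i * v.1 i) - ∑ i, v.2 i * u.1 i :=
    fun u v => c.symplectic_κ x _ ha u v
  have hdp : ∀ v, differential p (c.κ (x, c.action a)) (D v) = ∑ i, v.2 i * c.frequency i a :=
    c.differential_mfderiv_κ hp x ha
  change D (c.frequencyVector a, 0) = modelHamilton (differential p (c.κ (x, c.action a)))
  rw [← sub_eq_zero]
  refine eq_zero_of_modelForm_eq_zero fun w => ?_
  obtain ⟨v, rfl⟩ := surjective_of_symplectic D hD w
  rw [modelForm_sub_left, modelForm_modelHamilton, hD, hdp]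
  simp [frequencyVector]

theorem isMIntegralCurve_κ (hp : MDifferentiable phaseI 𝓘(ℝ, ℝ) p) (x : Fin 2 → ℝ) {a : ℝ}
    (ha : c.action a ∈ c.B) :
    IsMIntegralCurve (I := phaseI) (fun t : ℝ => c.κ (x + t • c.frequencyVector a, c.action a))
      (hamiltonField p) := by
  intro t
  have hline : HasDerivAt (fun t : ℝ => (x + t • c.frequencyVector a, c.action a))
      ((c.frequencyVector a, 0) : (Fin 2 → ℝ) × (Fin 2 → ℝ)) t := by
    refine HasDerivAt.prodMk ?_ (hasDerivAt_const _ _)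
    simpa using ((hasDerivAt_id t).smul_const (c.frequencyVector a)).const_add x
  let D : (Fin 2 → ℝ) × (Fin 2 → ℝ) →L[ℝ] PhaseModel :=
    mfderiv 𝓘(ℝ, (Fin 2 → ℝ) × (Fin 2 → ℝ)) phaseI c.κ (x + t • c.frequencyVector a, c.action a)
  have hD : D ((1 : ℝ) • (c.frequencyVector a, 0)) =
      hamiltonField p (c.κ (x + t • c.frequencyVector a, c.action a)) :=
    (congrArg D (one_smul ℝ _)).trans (c.mfderiv_κ_frequency hp _ ha)
  refine ((c.hasMFDerivAt_κ _ ha).comp t hline.hasFDerivAt.hasMFDerivAt).congr_mfderiv ?_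
  ext
  exact hD.trans (one_smul ℝ _).symm

variable [T2Space M] (hp : ContMDiff phaseI 𝓘(ℝ, ℝ) 2 p)
include hp

theorem hamiltonFlow_κ (x : Fin 2 → ℝ) {a : ℝ} (ha : c.action a ∈ c.B) (t : ℝ) :
    hamiltonFlow p t (c.κ (x, c.action a)) = c.κ (x + t • c.frequencyVector a, c.action a) := by
  simpa using hamiltonFlow_eq hp (c.isMIntegralCurve_κ (hp.mdifferentiable two_ne_zero) x ha) t

theorem flowAverage_κ (q : Cotangent M → ℝ) (x : Fin 2 → ℝ) {a : ℝ} (ha : c.action a ∈ c.B)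
    (T : ℝ) :
    flowAverage p q T (c.κ (x, c.action a)) =
      lineAverage (fun x => q (c.κ (x, c.action a))) (c.frequencyVector a) T x := by
  simp only [flowAverage, lineAverage, c.hamiltonFlow_κ hp x ha, smul_eq_mul]

end ActionAngleChart

section Trigonometric

variable {ι : Type*}

/-- `Q` is `2π`-periodic in every variable, i.e. it is a function on the torus `ℝ^ι / 2πℤ^ι`. -/
def TorusPeriodic {α : Type*} (Q : (ι → ℝ) → α) : Prop :=
  ∀ k : ι → ℤ, Function.Periodic Q fun i => 2 * Real.pi * k i

/-- The fundamental domain `[0, 2π]^ι` of the torus `ℝ^ι / 2πℤ^ι`. -/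
def torusBox (ι : Type*) : Set (ι → ℝ) := Icc 0 fun _ => 2 * Real.pi

theorem isCompact_torusBox : IsCompact (torusBox ι) := isCompact_Icc

theorem torusBox_eq_pi : torusBox ι = univ.pi fun _ => Icc 0 (2 * Real.pi) :=
  (pi_univ_Icc _ _).symm

/-- The projection `x ↦ x / 2π` of `ℝ^ι` onto the standard torus `ℝ^ι / ℤ^ι`. -/
noncomputable def toUnitAddTorus (x : ι → ℝ) : UnitAddTorus ι :=
  fun i => (((2 * Real.pi)⁻¹ * x i : ℝ) : UnitAddCircle)

theorem isQuotientMap_toUnitAddTorus : IsQuotientMap (toUnitAddTorus (ι := ι)) := by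
  have hproj : IsOpenQuotientMap (Pi.map fun _ t => (t : UnitAddCircle) :
      (ι → ℝ) → UnitAddTorus ι) :=
    IsOpenQuotientMap.piMap fun _ => QuotientAddGroup.isOpenQuotientMap_mk
  exact hproj.isQuotientMap.comp
    (Homeomorph.smulOfNeZero (2 * Real.pi)⁻¹ (by positivity)).isQuotientMap

theorem exists_add_two_pi_of_toUnitAddTorus_eq {x y : ι → ℝ}
    (h : toUnitAddTorus x = toUnitAddTorus y) :
    ∃ k : ι → ℤ, y = x + fun i => 2 * Real.pi * k i := by
  have hcoord : ∀ i, ∃ n : ℤ, y i = x i + 2 * Real.pi * n := fun i => by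
    obtain ⟨n, hn⟩ := AddSubgroup.mem_zmultiples_iff.1 (QuotientAddGroup.eq.1 (congrFun h i))
    refine ⟨n, ?_⟩
    simp only [zsmul_eq_mul, mul_one] at hn
    rw [hn]
    field_simp
    ring
  choose k hk using hcoord
  exact ⟨k, funext hk⟩

variable [Fintype ι]

theorem integrableOn_torusBox {E : Type*} [NormedAddCommGroup E] {Q : (ι → ℝ) → E}
    (hQ : Continuous Q) : IntegrableOn Q (torusBox ι) :=
  hQ.continuousOn.integrableOn_compact isCompact_torusBox

theorem volume_torusBox : volume.real (torusBox ι) = (2 * Real.pi) ^ Fintype.card ι := by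
  rw [torusBox, Measure.real, Real.volume_Icc_pi_toReal (a := 0) fun _ => Real.two_pi_pos.le]
  simp

theorem dist_integral_torusBox_le {F G : (ι → ℝ) → ℂ} (hF : Continuous F) (hG : Continuous G)
    {ε : ℝ} (h : ∀ x, ‖F x - G x‖ ≤ ε) :
    dist (∫ x in torusBox ι, F x) (∫ x in torusBox ι, G x) ≤
      ε * (2 * Real.pi) ^ Fintype.card ι := by
  rw [dist_eq_norm, ← integral_sub (integrableOn_torusBox hF) (integrableOn_torusBox hG),
    ← volume_torusBox]
  exact norm_setIntegral_le_of_norm_le_const isCompact_torusBox.measure_lt_top fun x _ => h x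

/-- The character `exp(i k·x)` of the torus. -/
noncomputable def torusChar (k : ι → ℤ) (x : ι → ℝ) : ℂ :=
  ∏ i, Complex.exp (k i * x i * Complex.I)

theorem continuous_torusChar (k : ι → ℤ) : Continuous (torusChar k) := by
  unfold torusChar
  fun_prop

theorem norm_torusChar (k : ι → ℤ) (x : ι → ℝ) : ‖torusChar k x‖ = 1 := by
  rw [torusChar, norm_prod]
  exact Finset.prod_eq_one fun i _ => mod_cast Complex.norm_exp_ofReal_mul_I (k i * x i)

theorem torusChar_add_smul (k : ι → ℤ) (x w : ι → ℝ) (t : ℝ) :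
    torusChar k (x + t • w) =
      torusChar k x * Complex.exp (((∑ i, k i * w i : ℝ) : ℂ) * Complex.I * t) := by
  simp only [torusChar, ← Complex.exp_sum, ← Complex.exp_add]
  congr 1
  push_cast
  simp only [Pi.add_apply, Pi.smul_apply, smul_eq_mul, Finset.sum_mul, ← Finset.sum_add_distrib]
  refine Finset.sum_congr rfl fun i _ => ?_
  push_cast
  ring

theorem integral_torusChar {k : ι → ℤ} (hk : k ≠ 0) : ∫ x in torusBox ι, torusChar k x = 0 := by
  obtain ⟨i, hi⟩ := Function.ne_iff.1 hk
  have hprod : ∫ x in torusBox ι, torusChar k x =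
      ∏ i, ∫ t in Icc 0 (2 * Real.pi), Complex.exp (k i * (t : ℝ) * Complex.I) := by
    rw [torusBox_eq_pi, volume_pi, Measure.restrict_pi_pi]
    exact integral_fintype_prod_eq_prod (fun i (t : ℝ) => Complex.exp (k i * t * Complex.I))
  rw [hprod]
  refine Finset.prod_eq_zero (Finset.mem_univ i) ?_
  rw [integral_Icc_eq_integral_Ioc, ← intervalIntegral.integral_of_le Real.two_pi_pos.le]
  have hki : (k i * Complex.I : ℂ) ≠ 0 := by simpa using hi
  have hperiod : Complex.exp (k i * Complex.I * ((2 * Real.pi : ℝ) : ℂ)) = 1 :=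
    Complex.exp_eq_one_iff.2 ⟨k i, by push_cast; ring⟩
  simp only [mul_right_comm _ _ Complex.I]
  rw [integral_exp_mul_complex hki, hperiod]
  simp

variable {w : ι → ℝ} {k : ι → ℤ}

theorem lineAverage_torusChar (w : ι → ℝ) (k : ι → ℤ) (T : ℝ) (x : ι → ℝ) :
    lineAverage (torusChar k) w T x = torusChar k x *
      (T⁻¹ * ∫ t in (0 : ℝ)..T, Complex.exp (((∑ i, k i * w i : ℝ) : ℂ) * Complex.I * t)) := by
  simp only [lineAverage, torusChar_add_smul]
  rw [intervalIntegral.integral_const_mul, Complex.real_smul]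
  push_cast
  ring

theorem lineAverage_torusChar_of_resonant (h : ∑ i, k i * w i = 0) {T : ℝ} (hT : 0 < T)
    (x : ι → ℝ) : lineAverage (torusChar k) w T x = torusChar k x := by
  rw [lineAverage_torusChar, h]
  simp [Complex.ofReal_ne_zero.2 hT.ne']

theorem norm_lineAverage_torusChar_le (h : ∑ i, k i * w i ≠ 0) {T : ℝ} (hT : 0 < T) (x : ι → ℝ) :
    ‖lineAverage (torusChar k) w T x‖ ≤ T⁻¹ * (2 / |∑ i, k i * w i|) := by
  rw [lineAverage_torusChar]
  generalize (∑ i, k i * w i) = c at h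
  have hcI : (c * Complex.I : ℂ) ≠ 0 := by simpa using h
  have hexp : ∀ t : ℝ, ‖Complex.exp (c * Complex.I * t)‖ = 1 := fun t => by
    simp [Complex.norm_exp]
  rw [norm_mul, norm_torusChar, one_mul, integral_exp_mul_complex hcI, norm_mul,
    Complex.norm_real, Real.norm_of_nonneg (inv_nonneg.2 hT.le), norm_div, norm_mul,
    Complex.norm_real, Complex.norm_I, mul_one, Real.norm_eq_abs]
  gcongr
  refine (norm_sub_le _ _).trans ?_
  rw [hexp, hexp, one_add_one_eq_two]

theorem exists_norm_lineAverage_torusChar_le (h : ∑ i, k i * w i ≠ 0) {ε : ℝ} (hε : 0 < ε) :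
    ∃ T₀ > 0, ∀ T ≥ T₀, ∀ x, ‖lineAverage (torusChar k) w T x‖ ≤ ε := by
  refine ⟨2 / |∑ i, k i * w i| / ε, by positivity, fun T hT x => ?_⟩
  have hT0 : 0 < T := lt_of_lt_of_le (by positivity) hT
  refine (norm_lineAverage_torusChar_le h hT0 x).trans ?_
  rwa [inv_mul_le_iff₀ hT0, ← div_le_iff₀ hε]

/-- The averages of `P` in direction `w` converge uniformly, to a constant if `w` is
nonresonant, and they have the same mean value as `P`. -/
structure AveragesConverge (w : ι → ℝ) (P : (ι → ℝ) → ℂ) : Prop where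
  continuous : Continuous P
  cauchy : ∀ ε > 0, ∃ T₀ > 0, ∀ T ≥ T₀, ∀ T' ≥ T₀, ∀ x,
    ‖lineAverage P w T x - lineAverage P w T' x‖ ≤ ε
  osc : (∀ k : ι → ℤ, ∑ i, k i * w i = 0 → k = 0) →
    ∀ ε > 0, ∃ T₀ > 0, ∀ T ≥ T₀, ∀ x y, ‖lineAverage P w T x - lineAverage P w T y‖ ≤ ε
  mean : ∀ T > 0, ∫ x in torusBox ι, lineAverage P w T x = ∫ x in torusBox ι, P x

theorem norm_lineAverage_sub_le_of_approx {P Q : (ι → ℝ) → ℂ} (hP : Continuous P)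
    (hQ : Continuous Q) {δ : ℝ} (hPQ : ∀ x, ‖Q x - P x‖ ≤ δ) {T T' : ℝ} (hT : 0 < T)
    (hT' : 0 < T') {x y : ι → ℝ} (h : ‖lineAverage P w T x - lineAverage P w T' y‖ ≤ δ) :
    ‖lineAverage Q w T x - lineAverage Q w T' y‖ ≤ 3 * δ := by
  have hx := norm_lineAverage_sub_le hQ hP hPQ w hT x
  have hy := norm_lineAverage_sub_le hQ hP hPQ w hT' y
  rw [← dist_eq_norm] at *
  have htri := dist_triangle4 (lineAverage Q w T x) (lineAverage P w T x) (lineAverage P w T' y)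
    (lineAverage Q w T' y)
  rw [dist_comm (lineAverage P w T' y)] at htri
  linarith

namespace AveragesConverge

theorem of_approx {Q : (ι → ℝ) → ℂ} (hQ : Continuous Q)
    (h : ∀ ε > 0, ∃ P, AveragesConverge w P ∧ ∀ x, ‖Q x - P x‖ ≤ ε) : AveragesConverge w Q where
  continuous := hQ
  cauchy ε hε := by
    obtain ⟨P, hP, hPQ⟩ := h (ε / 3) (by positivity)
    obtain ⟨T₀, hT₀, hcauchy⟩ := hP.cauchy (ε / 3) (by positivity)
    exact ⟨T₀, hT₀, fun T hT T' hT' x => (norm_lineAverage_sub_le_of_approx hP.continuous hQ hPQ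
      (hT₀.trans_le hT) (hT₀.trans_le hT') (hcauchy T hT T' hT' x)).trans_eq (by ring)⟩
  osc hw ε hε := by
    obtain ⟨P, hP, hPQ⟩ := h (ε / 3) (by positivity)
    obtain ⟨T₀, hT₀, hosc⟩ := hP.osc hw (ε / 3) (by positivity)
    exact ⟨T₀, hT₀, fun T hT x y => (norm_lineAverage_sub_le_of_approx hP.continuous hQ hPQ
      (hT₀.trans_le hT) (hT₀.trans_le hT) (hosc T hT x y)).trans_eq (by ring)⟩
  mean T hT := by
    refine eq_of_forall_dist_le fun ε hε => ?_
    have hvol : 0 < (2 * Real.pi) ^ Fintype.card ι := by positivity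
    obtain ⟨P, hP, hPQ⟩ := h (ε / 2 / (2 * Real.pi) ^ Fintype.card ι) (by positivity)
    have haverage := dist_integral_torusBox_le (continuous_lineAverage hQ w T)
      (continuous_lineAverage hP.continuous w T)
      (norm_lineAverage_sub_le hQ hP.continuous hPQ w hT)
    have hmean := dist_integral_torusBox_le hQ hP.continuous hPQ
    rw [hP.mean T hT, div_mul_cancel₀ _ hvol.ne'] at haverage
    rw [div_mul_cancel₀ _ hvol.ne'] at hmean
    exact (dist_triangle_right _ _ (∫ x in torusBox ι, P x)).trans (by linarith)

theorem add {P Q : (ι → ℝ) → ℂ} (hP : AveragesConverge w P) (hQ : AveragesConverge w Q) :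
    AveragesConverge w (fun x => P x + Q x) where
  continuous := hP.continuous.add hQ.continuous
  cauchy ε hε := by
    obtain ⟨T₀, hT₀, hcauchyP⟩ := hP.cauchy (ε / 2) (by positivity)
    obtain ⟨T₁, -, hcauchyQ⟩ := hQ.cauchy (ε / 2) (by positivity)
    refine ⟨max T₀ T₁, lt_max_of_lt_left hT₀, fun T hT T' hT' x => ?_⟩
    rw [lineAverage_add hP.continuous hQ.continuous, lineAverage_add hP.continuous hQ.continuous,
      add_sub_add_comm, ← add_halves ε]
    exact norm_add_le_of_le
      (hcauchyP T (le_of_max_le_left hT) T' (le_of_max_le_left hT') x)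
      (hcauchyQ T (le_of_max_le_right hT) T' (le_of_max_le_right hT') x)
  osc hw ε hε := by
    obtain ⟨T₀, hT₀, hoscP⟩ := hP.osc hw (ε / 2) (by positivity)
    obtain ⟨T₁, -, hoscQ⟩ := hQ.osc hw (ε / 2) (by positivity)
    refine ⟨max T₀ T₁, lt_max_of_lt_left hT₀, fun T hT x y => ?_⟩
    rw [lineAverage_add hP.continuous hQ.continuous, lineAverage_add hP.continuous hQ.continuous,
      add_sub_add_comm, ← add_halves ε]
    exact norm_add_le_of_le (hoscP T (le_of_max_le_left hT) x y)
      (hoscQ T (le_of_max_le_right hT) x y)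
  mean T hT := by
    simp only [lineAverage_add hP.continuous hQ.continuous]
    rw [integral_add (integrableOn_torusBox (continuous_lineAverage hP.continuous w T))
      (integrableOn_torusBox (continuous_lineAverage hQ.continuous w T)),
      integral_add (integrableOn_torusBox hP.continuous) (integrableOn_torusBox hQ.continuous),
      hP.mean T hT, hQ.mean T hT]

theorem const_mul {P : (ι → ℝ) → ℂ} (c : ℂ) (hP : AveragesConverge w P) :
    AveragesConverge w (fun x => c * P x) := by
  have haverage : ∀ T x, lineAverage (fun x => c * P x) w T x = c * lineAverage P w T x :=
    fun T x => by
      simp only [lineAverage]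
      rw [intervalIntegral.integral_const_mul, mul_smul_comm]
  have hscale : ∀ (ε : ℝ) (z : ℂ), ‖z‖ ≤ ε / (‖c‖ + 1) → ‖c * z‖ ≤ ε := fun ε z hz => by
    rw [norm_mul]
    rw [le_div_iff₀ (by positivity)] at hz
    nlinarith [norm_nonneg z]
  refine ⟨continuous_const.mul hP.continuous, fun ε hε => ?_, fun hw ε hε => ?_, fun T hT => ?_⟩
  · obtain ⟨T₀, hT₀, hcauchy⟩ := hP.cauchy (ε / (‖c‖ + 1)) (by positivity)
    refine ⟨T₀, hT₀, fun T hT T' hT' x => ?_⟩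
    rw [haverage, haverage, ← mul_sub]
    exact hscale ε _ (hcauchy T hT T' hT' x)
  · obtain ⟨T₀, hT₀, hosc⟩ := hP.osc hw (ε / (‖c‖ + 1)) (by positivity)
    refine ⟨T₀, hT₀, fun T hT x y => ?_⟩
    rw [haverage, haverage, ← mul_sub]
    exact hscale ε _ (hosc T hT x y)
  · simp only [haverage]
    rw [integral_const_mul, integral_const_mul, hP.mean T hT]

theorem torusChar_of_resonant (h : ∑ i, k i * w i = 0) : AveragesConverge w (torusChar k) where
  continuous := continuous_torusChar k
  cauchy ε hε := by
    refine ⟨1, one_pos, fun T hT T' hT' x => ?_⟩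
    rw [lineAverage_torusChar_of_resonant h (by linarith),
      lineAverage_torusChar_of_resonant h (by linarith), sub_self, norm_zero]
    exact hε.le
  osc hw ε hε := by
    refine ⟨1, one_pos, fun T hT x y => ?_⟩
    rw [lineAverage_torusChar_of_resonant h (by linarith),
      lineAverage_torusChar_of_resonant h (by linarith), hw k h]
    simpa [torusChar] using hε.le
  mean T hT := by simp only [lineAverage_torusChar_of_resonant h hT]

theorem torusChar_of_nonresonant (h : ∑ i, k i * w i ≠ 0) :
    AveragesConverge w (torusChar k) where
  continuous := continuous_torusChar k
  cauchy ε hε := by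
    obtain ⟨T₀, hT₀, hsmall⟩ := exists_norm_lineAverage_torusChar_le h (half_pos hε)
    exact ⟨T₀, hT₀, fun T hT T' hT' x =>
      (norm_sub_le_of_le (hsmall T hT x) (hsmall T' hT' x)).trans_eq (add_halves ε)⟩
  osc _ ε hε := by
    obtain ⟨T₀, hT₀, hsmall⟩ := exists_norm_lineAverage_torusChar_le h (half_pos hε)
    exact ⟨T₀, hT₀, fun T hT x y =>
      (norm_sub_le_of_le (hsmall T hT x) (hsmall T hT y)).trans_eq (add_halves ε)⟩
  mean T _ := by
    have hk : k ≠ 0 := by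
      rintro rfl
      simp at h
    simp only [lineAverage_torusChar]
    rw [integral_mul_const, integral_torusChar hk, zero_mul]

theorem of_mem_span {P : (ι → ℝ) → ℂ} (hP : P ∈ Submodule.span ℂ (range torusChar)) :
    AveragesConverge w P := by
  have hchar : ∀ k : ι → ℤ, AveragesConverge w (torusChar k) := fun k =>
    (eq_or_ne (∑ i, k i * w i) 0).elim torusChar_of_resonant torusChar_of_nonresonant
  induction hP using Submodule.span_induction with
  | mem x hx =>
    obtain ⟨k, rfl⟩ := hx
    exact hchar k
  | zero => simpa using! (hchar 0).const_mul 0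
  | add x y _ _ hx hy => exact hx.add hy
  | smul c x _ hx => exact hx.const_mul c

end AveragesConverge

theorem mFourier_toUnitAddTorus (k : ι → ℤ) (x : ι → ℝ) :
    UnitAddTorus.mFourier k (toUnitAddTorus x) = torusChar k x := by
  refine Finset.prod_congr rfl fun i _ => ?_
  rw [toUnitAddTorus, fourier_coe_apply]
  congr 1
  push_cast
  field_simp

theorem exists_trigonometric_approx {Q : (ι → ℝ) → ℂ} (hQ : Continuous Q)
    (hper : TorusPeriodic Q) {ε : ℝ} (hε : 0 < ε) :
    ∃ P ∈ Submodule.span ℂ (range torusChar), ∀ x, ‖Q x - P x‖ ≤ ε := by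
  let proj : C(ι → ℝ, UnitAddTorus ι) := ⟨toUnitAddTorus, isQuotientMap_toUnitAddTorus.continuous⟩
  have hproj : IsQuotientMap proj := isQuotientMap_toUnitAddTorus
  have hfactor : ∀ x y, proj x = proj y → (⟨Q, hQ⟩ : C(ι → ℝ, ℂ)) x = Q y := fun x y hxy => by
    obtain ⟨k, rfl⟩ := exists_add_two_pi_of_toUnitAddTorus_eq hxy
    exact (hper k x).symm
  let G : C(UnitAddTorus ι, ℂ) := hproj.lift ⟨Q, hQ⟩ hfactor
  have hG : ∀ x, G (toUnitAddTorus x) = Q x :=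
    ContinuousMap.congr_fun (hproj.lift_comp ⟨Q, hQ⟩ hfactor)
  have hdense : G ∈ (Submodule.span ℂ (range (UnitAddTorus.mFourier (d := ι)))
      ).topologicalClosure := by
    rw [UnitAddTorus.span_mFourier_closure_eq_top]
    trivial
  obtain ⟨P, hP, hdist⟩ := Metric.mem_closure_iff.1 hdense ε hε
  let pullback : C(UnitAddTorus ι, ℂ) →ₗ[ℂ] (ι → ℝ) → ℂ :=
    { toFun := fun g x => g (toUnitAddTorus x)
      map_add' := fun _ _ => rfl
      map_smul' := fun _ _ => rfl }
  refine ⟨pullback P, ?_, fun x => ?_⟩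
  · have hpull := Submodule.mem_map_of_mem (f := pullback) hP
    rw [Submodule.map_span, ← range_comp] at hpull
    convert hpull using 3
    exact funext fun k => funext fun x => (mFourier_toUnitAddTorus k x).symm
  · rw [← hG, ← dist_eq_norm]
    exact (ContinuousMap.dist_apply_le_dist _).trans hdist.le

theorem averagesConverge_of_periodic {Q : (ι → ℝ) → ℂ} (hQ : Continuous Q)
    (hper : TorusPeriodic Q) (w : ι → ℝ) : AveragesConverge w Q :=
  AveragesConverge.of_approx hQ fun _ hε =>
    have ⟨P, hP, hQP⟩ := exists_trigonometric_approx hQ hper hε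
    ⟨P, .of_mem_span hP, hQP⟩

end Trigonometric

section PeriodicOscillation

variable {h : ℝ → ℝ} {P C : ℝ}

theorem periodic_abs_sub_le_of_abs_deriv_le (hP : 0 < P) (hper : Function.Periodic h P)
    (hd : Differentiable ℝ h) (hC : ∀ t, |deriv h t| ≤ C) (x y : ℝ) : |h x - h y| ≤ P * C := by
  obtain ⟨z, ⟨hxz, hzx⟩, hzy⟩ := hper.exists_mem_Ico hP y x
  have hmean : |h x - h z| ≤ C * |x - z| := Convex.norm_image_sub_le_of_norm_deriv_le
    (fun t _ => hd t) (fun t _ => hC t) convex_univ (mem_univ z) (mem_univ x)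
  have hdist : |x - z| ≤ P := by
    rw [abs_sub_comm, abs_of_nonneg (by linarith)]
    linarith
  rw [hzy, mul_comm P]
  exact hmean.trans (mul_le_mul_of_nonneg_left hdist ((abs_nonneg _).trans (hC 0)))

theorem periodic_deriv (hper : Function.Periodic h P) : Function.Periodic (deriv h) P := fun t => by
  rw [← deriv_comp_add_const, show (fun s => h (s + P)) = h from funext hper]

theorem periodic_abs_sub_le_of_abs_iteratedDeriv_le (hP : 0 < P) (N : ℕ) :
    ∀ {h : ℝ → ℝ}, Function.Periodic h P → ContDiff ℝ (N + 1 : ℕ) h →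
      (∀ t, |iteratedDeriv (N + 1) h t| ≤ C) → ∀ x y, |h x - h y| ≤ P ^ (N + 1) * C := by
  induction N with
  | zero =>
    intro h hper hd hC x y
    rw [zero_add, pow_one]
    refine periodic_abs_sub_le_of_abs_deriv_le hP hper (hd.differentiable (by simp)) ?_ x y
    simpa [iteratedDeriv_one] using hC
  | succ N ih =>
    intro h hper hd hC x y
    have hd' : ContDiff ℝ (N + 1 : ℕ) (deriv h) :=
      (contDiff_succ_iff_deriv.1 (show ContDiff ℝ ((N + 1 : ℕ) + 1) h from mod_cast hd)).2.2
    have hosc := ih (periodic_deriv hper) hd' fun t => by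
      rw [← iteratedDeriv_succ']
      exact hC t
    have hdiff : Differentiable ℝ h := hd.differentiable (by simp)
    obtain ⟨ξ, -, hξ⟩ := exists_deriv_eq_zero (f := h) hP hdiff.continuous.continuousOn
      (by simpa using (hper 0).symm)
    rw [pow_succ', mul_assoc]
    exact periodic_abs_sub_le_of_abs_deriv_le hP hper hdiff
      (fun t => by simpa [hξ] using hosc t ξ) x y

/-- The average of `h` over the `n` translates of `s` by multiples of `P / n`; it turns a function
of period `P` into one of period `P / n`. -/
noncomputable def shiftAverage (h : ℝ → ℝ) (P : ℝ) (n : ℕ) (s : ℝ) : ℝ :=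
  (n : ℝ)⁻¹ * ∑ l ∈ Finset.range n, h (s + l * (P / n))

theorem shiftAverage_periodic (hper : Function.Periodic h P) {n : ℕ} (hn : n ≠ 0) :
    Function.Periodic (shiftAverage h P n) (P / n) := fun s => by
  have hn' : (n : ℝ) ≠ 0 := Nat.cast_ne_zero.2 hn
  have hfirst := Finset.sum_range_succ' (fun l : ℕ => h (s + l * (P / n))) n
  have hlast := Finset.sum_range_succ (fun l : ℕ => h (s + l * (P / n))) n
  rw [mul_div_cancel₀ _ hn', hper] at hlast
  have hshift : ∀ l : ℕ, s + P / n + l * (P / n) = s + (l + 1 : ℕ) * (P / n) := fun l => by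
    push_cast
    ring
  simp only [Nat.cast_zero, zero_mul, add_zero] at hfirst
  simp only [shiftAverage, hshift]
  congr 1
  linarith

theorem abs_shiftAverage_sub_le (hP : 0 < P) (hper : Function.Periodic h P) {n : ℕ} (hn : n ≠ 0)
    {N : ℕ} (hsmooth : ContDiff ℝ (N + 1 : ℕ) h) (hC : ∀ t, |iteratedDeriv (N + 1) h t| ≤ C)
    (x y : ℝ) : |shiftAverage h P n x - shiftAverage h P n y| ≤ (P / n) ^ (N + 1) * C := by
  have hn' : 0 < (n : ℝ) := Nat.cast_pos.2 hn.bot_lt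
  have hshift : ∀ l ∈ Finset.range n, ContDiff ℝ (N + 1 : ℕ) fun s => h (s + l * (P / n)) :=
    fun _ _ => hsmooth.comp (by fun_prop)
  refine periodic_abs_sub_le_of_abs_iteratedDeriv_le (by positivity) N
    (shiftAverage_periodic hper hn) (contDiff_const.mul (ContDiff.sum hshift)) (fun t => ?_) x y
  unfold shiftAverage
  rw [iteratedDeriv_const_mul_field, iteratedDeriv_fun_sum fun l hl => (hshift l hl).contDiffAt,
    abs_mul, abs_of_pos (inv_pos.2 hn'), inv_mul_le_iff₀ hn']
  refine (Finset.abs_sum_le_sum_abs _ _).trans ?_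
  refine (Finset.sum_le_card_nsmul _ _ C fun l _ => ?_).trans_eq (by simp)
  rw [iteratedDeriv_comp_add_const]
  exact hC _

end PeriodicOscillation

section LinePeriod

variable {V E : Type*} [NormedAddCommGroup V] [NormedSpace ℝ V] [NormedAddCommGroup E]
  [NormedSpace ℝ E]

theorem lineAverage_comp_add (Q : V → E) (w : V) (T : ℝ) (v x : V) :
    lineAverage (fun x => Q (x + v)) w T x = lineAverage Q w T (x + v) := by
  simp only [lineAverage, add_right_comm x v]

theorem lineAverage_periodic {Q : V → E} {v : V} (hv : Function.Periodic Q v) (w : V) (T : ℝ) :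
    Function.Periodic (lineAverage Q w T) v := fun x => by
  rw [← lineAverage_comp_add, show (fun x => Q (x + v)) = Q from funext hv]

theorem lineAverage_periodic_smul {Q : V → E} {w : V} {T : ℝ}
    (hT : Function.Periodic Q (T • w)) (s : ℝ) :
    Function.Periodic (lineAverage Q w T) (s • w) := fun x => by
  have hline : Function.Periodic (fun t : ℝ => Q (x + t • w)) T := fun t => by
    simp only [add_smul, ← add_assoc]
    exact hT _
  have hperiod := hline.intervalIntegral_add_eq s 0
  have hshift := intervalIntegral.integral_comp_add_right (a := 0) (b := T)
    (fun t : ℝ => Q (x + t • w)) s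
  rw [zero_add] at hperiod hshift
  simp only [lineAverage]
  rw [← hperiod, add_comm s, ← hshift]
  simp only [add_smul, add_assoc, add_comm (s • w)]

theorem lineAverage_shiftAverage {Q : V → ℝ} (hQ : Continuous Q) (w e : V) (T P : ℝ) (n : ℕ)
    (x : V) : lineAverage (fun x => shiftAverage (fun s => Q (x + s • e)) P n 0) w T x =
      shiftAverage (fun s => lineAverage Q w T (x + s • e)) P n 0 := by
  simp only [lineAverage, shiftAverage, smul_eq_mul]
  rw [intervalIntegral.integral_const_mul, intervalIntegral.integral_finsetSum, mul_left_comm,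
    Finset.mul_sum]
  · simp only [add_right_comm x]
  · exact fun l _ => (hQ.comp (by fun_prop)).intervalIntegrable _ _

/-- If the averages have the additional period `(P / n) e`, then `Q` may be replaced by its
`shiftAverage` along `e`, whose oscillation is small by smoothness. -/
theorem abs_lineAverage_sub_le_of_periodic {Q : V → ℝ} (hQ : Continuous Q) {w e : V} {P C : ℝ}
    (hP : 0 < P) {n : ℕ} (hn : n ≠ 0) {T : ℝ} (hT : 0 < T) (hper : Function.Periodic Q (P • e))
    (hperT : Function.Periodic (lineAverage Q w T) ((P / n) • e)) {N : ℕ}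
    (hsmooth : ∀ x, ContDiff ℝ (N + 1 : ℕ) fun s : ℝ => Q (x + s • e))
    (hC : ∀ x s, |iteratedDeriv (N + 1) (fun s : ℝ => Q (x + s • e)) s| ≤ C) (x : V) (s : ℝ) :
    |lineAverage Q w T (x + s • e) - lineAverage Q w T x| ≤ (P / n) ^ (N + 1) * C := by
  let F : V → ℝ := fun x => shiftAverage (fun s => Q (x + s • e)) P n 0
  have hF : Continuous F := continuous_const.mul <|
    continuous_finsetSum _ fun l _ => hQ.comp (by fun_prop)
  have haverage : ∀ x, lineAverage F w T x = lineAverage Q w T x := fun x => by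
    have hconst : ∀ l : ℕ, lineAverage Q w T (x + (l * (P / n)) • e) = lineAverage Q w T x :=
      fun l => by
        rw [← smul_smul, Nat.cast_smul_eq_nsmul]
        exact hperT.nsmul l x
    rw [lineAverage_shiftAverage hQ, shiftAverage]
    simp [hconst, hn]
  have hF_osc : ∀ x, |F (x + s • e) - F x| ≤ (P / n) ^ (N + 1) * C := fun x => by
    have hline : Function.Periodic (fun s : ℝ => Q (x + s • e)) P := fun s => by
      simp only [add_smul, ← add_assoc]
      exact hper _
    have hFs : F (x + s • e) = shiftAverage (fun s => Q (x + s • e)) P n s := by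
      simp only [F, shiftAverage, add_smul, add_assoc, zero_add]
    rw [hFs]
    exact abs_shiftAverage_sub_le hP hline hn (hsmooth x) (hC x) s 0
  rw [← haverage, ← haverage, ← lineAverage_comp_add]
  exact norm_lineAverage_sub_le (hF.comp (by fun_prop)) hF hF_osc w hT x

end LinePeriod

section TorusAverage

section Real

variable {ι : Type*} [Fintype ι] {Q : (ι → ℝ) → ℝ} (hQ : Continuous Q) (hper : TorusPeriodic Q)
include hQ hper

theorem averagesConverge_ofReal (w : ι → ℝ) : AveragesConverge w fun x => (Q x : ℂ) :=
  averagesConverge_of_periodic (by fun_prop) (fun k x => congrArg Complex.ofReal (hper k x)) w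

omit hQ hper in
theorem lineAverage_ofReal (Q : (ι → ℝ) → ℝ) (w : ι → ℝ) (T : ℝ) (x : ι → ℝ) :
    lineAverage (fun x => (Q x : ℂ)) w T x = (lineAverage Q w T x : ℝ) := by
  simp only [lineAverage]
  rw [intervalIntegral.integral_ofReal]
  simp

theorem lineAverage_cauchy (w : ι → ℝ) {ε : ℝ} (hε : 0 < ε) :
    ∃ T₀ > 0, ∀ T ≥ T₀, ∀ T' ≥ T₀, ∀ x, |lineAverage Q w T x - lineAverage Q w T' x| ≤ ε := by
  simpa only [lineAverage_ofReal, ← Complex.ofReal_sub, Complex.norm_real, Real.norm_eq_abs]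
    using (averagesConverge_ofReal hQ hper w).cauchy ε hε

theorem lineAverage_osc {w : ι → ℝ} (hw : ∀ k : ι → ℤ, ∑ i, k i * w i = 0 → k = 0)
    {ε : ℝ} (hε : 0 < ε) :
    ∃ T₀ > 0, ∀ T ≥ T₀, ∀ x y, |lineAverage Q w T x - lineAverage Q w T y| ≤ ε := by
  simpa only [lineAverage_ofReal, ← Complex.ofReal_sub, Complex.norm_real, Real.norm_eq_abs]
    using (averagesConverge_ofReal hQ hper w).osc hw ε hε

theorem integral_lineAverage (w : ι → ℝ) {T : ℝ} (hT : 0 < T) :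
    ∫ x in torusBox ι, lineAverage Q w T x = ∫ x in torusBox ι, Q x := by
  have hmean := (averagesConverge_ofReal hQ hper w).mean T hT
  simp only [lineAverage_ofReal] at hmean
  rw [integral_complex_ofReal, integral_complex_ofReal] at hmean
  exact_mod_cast hmean

theorem exists_lineAverage_eq_mean (w : ι → ℝ) {T : ℝ} (hT : 0 < T) :
    ∃ x, lineAverage Q w T x =
      ((2 * Real.pi) ^ Fintype.card ι)⁻¹ * ∫ x in torusBox ι, Q x := by
  have hc : Continuous (lineAverage Q w T) := continuous_lineAverage hQ w T
  have hvol : volume (torusBox ι) ≠ 0 := fun h => by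
    have := volume_torusBox (ι := ι)
    rw [Measure.real, h, ENNReal.toReal_zero] at this
    exact (pow_pos Real.two_pi_pos _).ne this
  have hconn : IsConnected (torusBox ι) :=
    ⟨nonempty_of_measure_ne_zero hvol, (convex_Icc _ _).isPreconnected⟩
  obtain ⟨x, -, hx⟩ := exists_eq_setAverage hconn hc.continuousOn (integrableOn_torusBox hc)
    isCompact_torusBox.measure_ne_top hvol
  exact ⟨x, by rw [hx, setAverage_eq, volume_torusBox, integral_lineAverage hQ hper w hT,
    smul_eq_mul]⟩

end Real

variable {Q : (Fin 2 → ℝ) → ℝ} {w : Fin 2 → ℝ} (hw : w 0 ≠ 0) {r : ℚ} (hr : w 1 = r * w 0)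
include hw hr

theorem exists_period_of_rational (hper : TorusPeriodic Q) :
    ∃ T ≥ 1, Function.Periodic Q ((T : ℝ) • w) := by
  have hr' : (r : ℝ) * r.den = r.num := mod_cast Rat.mul_den_eq_num r
  obtain ⟨k, hk⟩ := exists_nat_ge |w 0|
  have hkT : 1 ≤ |2 * Real.pi * (r.den * k) / w 0| := by
    have hden : (1 : ℝ) ≤ r.den := mod_cast r.pos
    rw [abs_div, one_le_div (abs_pos.2 hw), abs_of_nonneg (a := _ * _) (by positivity)]
    nlinarith [Real.pi_gt_three, mul_nonneg (sub_nonneg.2 hden) (Nat.cast_nonneg (α := ℝ) k)]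
  have hclosed : Function.Periodic Q ((2 * Real.pi * (r.den * k) / w 0) • w) := by
    convert hper ![r.den * k, r.num * k] using 1
    ext i
    fin_cases i
    · simp [hw]
    · simp [hr, ← hr']
      field_simp
  refine ⟨_, hkT, ?_⟩
  rcases abs_choice (2 * Real.pi * (r.den * k) / w 0) with h | h <;> rw [h]
  · exact hclosed
  · simpa only [neg_smul] using hclosed.neg

/-- Bézout: some point of the line `ℝ w` is congruent to `(0, 2π / r.den)` modulo `2πℤ²`. -/
theorem periodic_of_rational {A : (Fin 2 → ℝ) → ℝ} (hper : TorusPeriodic A)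
    (hline : ∀ s : ℝ, Function.Periodic A (s • w)) :
    Function.Periodic A ((2 * Real.pi / r.den) • Pi.single 1 1) := by
  have hr' : (r : ℝ) = r.num / r.den := mod_cast (Rat.num_div_den r).symm
  obtain ⟨u, v, huv⟩ := Rat.isCoprime_num_den r
  have huv' : (u : ℝ) * r.num + v * r.den = 1 := mod_cast huv
  have hden : (r.den : ℝ) ≠ 0 := mod_cast r.den_ne_zero
  have hcongr : (2 * Real.pi / r.den) • (Pi.single 1 1 : Fin 2 → ℝ) =
      (2 * Real.pi * u / w 0) • w + fun i => 2 * Real.pi * ((![-u, v] i : ℤ) : ℝ) := by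
    ext i
    fin_cases i
    · simp [hw]
    · simp [hr, hr']
      field_simp
      linear_combination -huv'
  rw [hcongr]
  exact (hline _).add_period (hper _)

theorem exists_lineAverage_osc_le_of_rational (hQ : Continuous Q) (hper : TorusPeriodic Q)
    {N : ℕ} {C : ℝ}
    (hsmooth : ∀ x, ContDiff ℝ (N + 1 : ℕ) fun s : ℝ => Q (x + s • Pi.single 1 1))
    (hC : ∀ x s, |iteratedDeriv (N + 1) (fun s : ℝ => Q (x + s • Pi.single 1 1)) s| ≤ C) :
    ∃ T ≥ 1, ∀ x y, |lineAverage Q w T x - lineAverage Q w T y| ≤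
      (2 * Real.pi / r.den) ^ (N + 1) * C := by
  obtain ⟨T, hT1, hT⟩ := exists_period_of_rational hw hr hper
  have hline := lineAverage_periodic_smul hT
  have hfine := periodic_of_rational hw hr (fun k => lineAverage_periodic (hper k) w T) hline
  have hper_e : Function.Periodic Q ((2 * Real.pi) • Pi.single 1 1) := by
    convert hper (Pi.single 1 1) using 1
    ext i
    fin_cases i <;> simp
  refine ⟨T, hT1, fun x y => ?_⟩
  have hflow : ∀ x, lineAverage Q w T x = lineAverage Q w T ((x 1 - r * x 0) • Pi.single 1 1) :=
    fun x => by
      rw [← hline (x 0 / w 0) ((x 1 - r * x 0) • _)]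
      congr 1
      ext i
      fin_cases i
      · simp [hw]
      · simp [hr]
        field_simp
        ring
  rw [hflow x, hflow y, ← add_sub_cancel (y 1 - r * y 0) (x 1 - r * x 0), add_smul]
  exact abs_lineAverage_sub_le_of_periodic hQ Real.two_pi_pos r.den_ne_zero
    (one_pos.trans_le hT1) hper_e hfine hsmooth hC _ _

end TorusAverage

/-! ### Uniform Cauchy estimates -/

section CauchyEstimates

variable {E F : Type*} [NormedAddCommGroup E] [NormedSpace ℝ E] [NormedAddCommGroup F]
  [NormedSpace ℝ F]

theorem inv_le_radius_of_norm_le_pow {P : FormalMultilinearSeries ℝ E F} {A R : ℝ} (hR : 0 < R)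
    (hP : ∀ n, ‖P n‖ ≤ A * R ^ n) : ENNReal.ofReal R⁻¹ ≤ P.radius := by
  refine P.le_radius_of_bound A fun n => ?_
  rw [Real.coe_toNNReal _ (inv_pos.2 hR).le]
  calc ‖P n‖ * R⁻¹ ^ n ≤ A * R ^ n * R⁻¹ ^ n := by gcongr; exact hP n
    _ = A := by rw [mul_assoc, ← mul_pow, mul_inv_cancel₀ hR.ne', one_pow, mul_one]

theorem norm_sum_le_of_norm_le_pow {P : FormalMultilinearSeries ℝ E F} {A R : ℝ} (hR : 0 < R)
    (hP : ∀ n, ‖P n‖ ≤ A * R ^ n) {v : E} (hv : ‖v‖ ≤ (2 * R)⁻¹) : ‖P.sum v‖ ≤ 2 * A := by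
  have hA : 0 ≤ A := by simpa using (norm_nonneg _).trans (hP 0)
  have hgeom : HasSum (fun n : ℕ => A * (1 / 2) ^ n) (2 * A) :=
    mul_comm A 2 ▸ hasSum_geometric_two.mul_left A
  refine tsum_of_norm_bounded hgeom fun n => ((P n).le_opNorm _).trans ?_
  simp only [Finset.prod_const, Finset.card_univ, Fintype.card_fin]
  calc ‖P n‖ * ‖v‖ ^ n ≤ (A * R ^ n) * ((2 * R)⁻¹) ^ n := by gcongr; exact hP n
    _ = A * (1 / 2) ^ n := by rw [mul_assoc, ← mul_pow]; congr 2; field_simp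

/-- The Taylor series of `f` at `y₀` as a power series, that is with the factors `1 / n!`
which Mathlib's `ftaylorSeries` does not include. -/
noncomputable def taylorPowerSeries (f : E → F) (y₀ : E) : FormalMultilinearSeries ℝ E F :=
  fun n => ((n.factorial : ℝ)⁻¹) • iteratedFDeriv ℝ n f y₀

variable {f : E → F} {y₀ : E}

theorem norm_taylorPowerSeries_le {A R : ℝ}
    (hf : ∀ n : ℕ, ‖iteratedFDeriv ℝ n f y₀‖ ≤ A * R ^ n * n.factorial) (n : ℕ) :
    ‖taylorPowerSeries f y₀ n‖ ≤ A * R ^ n := by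
  rw [taylorPowerSeries, norm_smul, norm_inv, Real.norm_natCast,
    inv_mul_le_iff₀ (by positivity), mul_comm]
  exact hf n

theorem norm_iteratedFDeriv_iteratedFDeriv (m n : ℕ) (x : E) :
    ‖iteratedFDeriv ℝ n (iteratedFDeriv ℝ m f) x‖ = ‖iteratedFDeriv ℝ (n + m) f x‖ := by
  induction m generalizing n with
  | zero =>
    rw [iteratedFDeriv_zero_eq_comp]
    exact (continuousMultilinearCurryFin0 ℝ E F).symm.norm_iteratedFDeriv_comp_left f x n
  | succ m ih =>
    let : NormedAddCommGroup (E →L[ℝ] E [×m]→L[ℝ] F) := ContinuousLinearMap.toNormedAddCommGroup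
    have hcurry := LinearIsometryEquiv.norm_iteratedFDeriv_comp_left (𝕜 := ℝ)
      (F := E →L[ℝ] E [×m]→L[ℝ] F) (G := E [×(m + 1)]→L[ℝ] F)
      (continuousMultilinearCurryLeftEquiv ℝ (fun _ : Fin (m + 1) => E) F).symm
      (fderiv ℝ (iteratedFDeriv ℝ m f)) x n
    rw [iteratedFDeriv_succ_eq_comp_left, hcurry, norm_iteratedFDeriv_fderiv, ih, add_right_comm,
      add_assoc]

variable [CompleteSpace F]

theorem eqOn_taylorPowerSeries_sum {ρ : ℝ} (hρ : 0 < ρ)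
    (hf : AnalyticOnNhd ℝ f (Metric.ball y₀ ρ))
    (hrad : ENNReal.ofReal ρ ≤ (taylorPowerSeries f y₀).radius) :
    EqOn f (fun y => (taylorPowerSeries f y₀).sum (y - y₀)) (Metric.ball y₀ ρ) := by
  have hsum := (taylorPowerSeries f y₀).hasFPowerSeriesOnBall
    ((ENNReal.ofReal_pos.2 hρ).trans_le hrad)
  have hsub : ∀ {s : ENNReal} {y : E}, y ∈ Metric.eball y₀ s → y - y₀ ∈ Metric.eball 0 s :=
    fun hy => by simpa [edist_eq_enorm_sub] using hy
  refine AnalyticOnNhd.eqOn_of_preconnected_of_eventuallyEq hf (fun y hy => ?_)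
    (convex_ball y₀ ρ).isPreconnected (Metric.mem_ball_self hρ) ?_
  · rw [← Metric.eball_ofReal] at hy
    exact (hsum.analyticOnNhd _ (Metric.eball_subset_eball hrad (hsub hy))).comp_of_eq
      (f := fun y => y - y₀) (by fun_prop) rfl
  · obtain ⟨P, s, hP⟩ := hf y₀ (Metric.mem_ball_self hρ)
    filter_upwards [Metric.eball_mem_nhds y₀ hP.r_pos,
      Metric.eball_mem_nhds y₀ hsum.r_pos] with y hy hy'
    have hfy := hP.hasSum_iteratedFDeriv (hsub hy)
    have hTy := hsum.hasSum (hsub hy')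
    rw [zero_add] at hTy
    rw [add_sub_cancel] at hfy
    exact hfy.unique hTy

theorem norm_le_of_cauchyEstimates {A R r : ℝ} (hR : 0 < R) (hr : 0 < r)
    (hf : AnalyticOnNhd ℝ f (Metric.ball y₀ r))
    (hest : ∀ n : ℕ, ‖iteratedFDeriv ℝ n f y₀‖ ≤ A * R ^ n * n.factorial) :
    ∀ y ∈ Metric.ball y₀ (min r (2 * R)⁻¹), ‖f y‖ ≤ 2 * A := by
  intro y hy
  have hbound := norm_taylorPowerSeries_le hest
  have hsmall : min r (2 * R)⁻¹ ≤ R⁻¹ :=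
    (min_le_right _ _).trans (inv_anti₀ hR (by linarith))
  rw [eqOn_taylorPowerSeries_sum (lt_min hr (by positivity))
    (hf.mono (Metric.ball_subset_ball (min_le_left _ _)))
    ((ENNReal.ofReal_le_ofReal hsmall).trans (inv_le_radius_of_norm_le_pow hR hbound)) hy]
  refine norm_sum_le_of_norm_le_pow hR hbound ?_
  rw [← dist_eq_norm]
  exact (Metric.mem_ball.1 hy).le.trans (min_le_right _ _)

theorem norm_iteratedFDeriv_le_of_cauchyEstimates {A R r : ℝ} (hR : 0 < R) (hr : 0 < r)
    (hf : AnalyticOnNhd ℝ f (Metric.ball y₀ r))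
    (hest : ∀ n : ℕ, ‖iteratedFDeriv ℝ n f y₀‖ ≤ A * R ^ n * n.factorial) (m : ℕ) :
    ∀ y ∈ Metric.ball y₀ (min r (4 * R)⁻¹),
      ‖iteratedFDeriv ℝ m f y‖ ≤ 2 * (A * (2 * R) ^ m * m.factorial) := by
  have hA : 0 ≤ A := by simpa using (norm_nonneg _).trans (hest 0)
  have hfactorial (n : ℕ) :
      ((n + m).factorial : ℝ) ≤ 2 ^ (n + m) * n.factorial * m.factorial := by
    have := Nat.add_choose_mul_factorial_mul_factorial n m
    rw [← this]
    push_cast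
    gcongr
    exact_mod_cast Nat.choose_le_two_pow _ _
  rw [show 4 * R = 2 * (2 * R) by ring]
  refine norm_le_of_cauchyEstimates (by positivity) hr (hf.iteratedFDeriv m) fun n => ?_
  rw [norm_iteratedFDeriv_iteratedFDeriv]
  calc ‖iteratedFDeriv ℝ (n + m) f y₀‖ ≤ A * R ^ (n + m) * (n + m).factorial := hest _
    _ ≤ A * R ^ (n + m) * (2 ^ (n + m) * n.factorial * m.factorial) := by
        gcongr
        exact hfactorial n
    _ = A * (2 * R) ^ m * m.factorial * (2 * R) ^ n * n.factorial := by
        simp only [mul_pow, pow_add]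
        ring

end CauchyEstimates

theorem norm_iteratedFDeriv_comp_le_of_contDiffAt {E F G : Type*} [NormedAddCommGroup E]
    [NormedSpace ℝ E] [NormedAddCommGroup F] [NormedSpace ℝ F] [NormedAddCommGroup G]
    [NormedSpace ℝ G] {g : F → G} {f : E → F} {x : E} {n : ℕ} {C D : ℝ}
    (hg : ContDiffAt ℝ n g (f x)) (hf : ContDiffAt ℝ n f x)
    (hC : ∀ i ≤ n, ‖iteratedFDeriv ℝ i g (f x)‖ ≤ C)
    (hD : ∀ i, 1 ≤ i → i ≤ n → ‖iteratedFDeriv ℝ i f x‖ ≤ D ^ i) :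
    ‖iteratedFDeriv ℝ n (g ∘ f) x‖ ≤ n.factorial * C * D ^ n := by
  obtain ⟨t, htg, hto, hxt⟩ := eventually_nhds_iff.1 (hg.eventually (by simp))
  have hpre : ∀ᶠ y in 𝓝 x, ContDiffAt ℝ n f y ∧ f y ∈ t :=
    (hf.eventually (by simp)).and (hf.continuousAt (hto.mem_nhds hxt))
  obtain ⟨s, hs, hso, hxs⟩ := eventually_nhds_iff.1 hpre
  have := norm_iteratedFDerivWithin_comp_le (C := C) (D := D)
    (fun y hy => (htg y hy).contDiffWithinAt) (fun y hy => (hs y hy).1.contDiffWithinAt) le_rfl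
    hto.uniqueDiffOn hso.uniqueDiffOn (fun y hy => (hs y hy).2) hxs
    (fun i hi => by rw [iteratedFDerivWithin_of_isOpen i hto hxt]; exact hC i hi)
    (fun i hi hi' => by rw [iteratedFDerivWithin_of_isOpen i hso hxs]; exact hD i hi hi')
  rwa [iteratedFDerivWithin_of_isOpen n hso hxs] at this

theorem norm_iteratedFDeriv_add_smul_le {E : Type*} [NormedAddCommGroup E] [NormedSpace ℝ E]
    (x : E) {v : E} (hv : ‖v‖ ≤ 1) {i : ℕ} (hi : 1 ≤ i) (s : ℝ) :
    ‖iteratedFDeriv ℝ i (fun s : ℝ => x + s • v) s‖ ≤ 1 := by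
  obtain ⟨j, rfl⟩ := Nat.exists_eq_add_of_le' hi
  have hfderiv : fderiv ℝ (fun s : ℝ => x + s • v) =
      fun _ => ContinuousLinearMap.toSpanSingleton ℝ v :=
    funext fun _ =>
      ((ContinuousLinearMap.toSpanSingleton ℝ v).hasFDerivAt.const_add x).fderiv
  rw [← norm_iteratedFDeriv_fderiv, hfderiv]
  rcases Nat.eq_zero_or_pos j with rfl | hj
  · simpa using hv
  · simp [iteratedFDeriv_const_of_ne hj.ne']

theorem exists_add_two_pi_mem_torusBox {ι : Type*} (x : ι → ℝ) :
    ∃ k : ι → ℤ, (x + fun i => 2 * Real.pi * k i) ∈ torusBox ι := by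
  refine ⟨fun i => -toIcoDiv Real.two_pi_pos 0 (x i), ?_⟩
  have hmem (i : ι) :
      x i + 2 * Real.pi * (-toIcoDiv Real.two_pi_pos 0 (x i) : ℤ) ∈ Ico 0 (2 * Real.pi) := by
    have h := toIcoMod_mem_Ico Real.two_pi_pos 0 (x i)
    rw [← self_sub_toIcoDiv_zsmul] at h
    push_cast
    simpa [sub_eq_add_neg, mul_comm] using h
  exact ⟨fun i => (hmem i).1, fun i => (hmem i).2.le⟩

theorem exists_uniform_bound_of_eventually {α β : Type*} {l : Filter α} {u : ℕ → α → β → ℝ}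
    {s : Set β} (h : ∀ i, ∃ C : ℝ, ∀ᶠ w in l, ∀ b ∈ s, u i w b ≤ C) (N : ℕ) :
    ∃ C : ℝ, ∀ᶠ w in l, ∀ i ≤ N, ∀ b ∈ s, u i w b ≤ C := by
  choose C hC using h
  obtain ⟨B, hB⟩ := ((finite_Iic N).image C).bddAbove
  refine ⟨B, ((eventually_all_finite (finite_Iic N)).2 fun i _ => hC i).mono ?_⟩
  exact fun w hw i hi b hb => (hw i hi b hb).trans (hB (mem_image_of_mem C hi))

section UniformBounds

variable {M : Type*} [TopologicalSpace M] [ChartedSpace Plane M] [IsManifold 𝓘(ℝ, Plane) ω M]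
  {p f : Cotangent M → ℝ} {a₀ : ℝ} {F : Set (Cotangent M → ℝ)} {K : Set (Cotangent M)}

theorem UniformlyAnalyticOn.exists_bound (hF : UniformlyAnalyticOn F K)
    (hF_an : ∀ q ∈ F, ContMDiff phaseI 𝓘(ℝ, ℝ) ω q) {z : Cotangent M} (hz : z ∈ K) (m : ℕ) :
    ∃ C : ℝ, ∀ᶠ y in 𝓝 (extChartAt phaseI z z), ∀ q ∈ F,
      ‖iteratedFDeriv ℝ m (q ∘ (extChartAt phaseI z).symm) y‖ ≤ C := by
  obtain ⟨R, hR⟩ := hF z hz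
  obtain ⟨r, hr, hball⟩ := Metric.isOpen_iff.1 (isOpen_extChartAt_target (I := phaseI) z)
    (extChartAt phaseI z z) (mem_extChartAt_target z)
  set R' := max |R| 1
  have hR' : 0 < R' := by positivity
  refine ⟨2 * (R' * (2 * R') ^ m * m.factorial), ?_⟩
  filter_upwards [Metric.ball_mem_nhds _ (lt_min hr (inv_pos.2 (mul_pos four_pos hR')))]
    with y hy q hq
  refine norm_iteratedFDeriv_le_of_cauchyEstimates hR' hr (fun w hw => ?_) (fun n => ?_) m y hy
  · exact (contDiffAt_comp_extChartAt_symm (hF_an q hq) z (hball hw)).analyticAt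
  · have hpow : R ^ (n + 1) ≤ R' ^ (n + 1) :=
      (le_abs_self _).trans (by rw [abs_pow]; gcongr; exact le_max_left _ _)
    calc _ ≤ R ^ (n + 1) * (n.factorial : ℝ) := hR q hq n
      _ ≤ R' ^ (n + 1) * n.factorial := by gcongr
      _ = R' * R' ^ n * n.factorial := by ring

namespace ActionAngleChart

variable (c : ActionAngleChart p f a₀)

theorem contDiffAt_comp_κ {q : Cotangent M → ℝ} (hq : ContMDiff phaseI 𝓘(ℝ, ℝ) ω q)
    (x : Fin 2 → ℝ) {ξ : Fin 2 → ℝ} (hξ : ξ ∈ c.B) : ContDiffAt ℝ ω (q ∘ c.κ) (x, ξ) :=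
  ContMDiffAt.contDiffAt ((hq _).comp _ (c.contMDiffAt_κ x hξ))

theorem exists_norm_iteratedFDeriv_comp_κ_le_nhds (hF : UniformlyAnalyticOn F K)
    (hF_an : ∀ q ∈ F, ContMDiff phaseI 𝓘(ℝ, ℝ) ω q) (x₀ : Fin 2 → ℝ) {ξ₀ : Fin 2 → ℝ}
    (hξ₀ : ξ₀ ∈ c.B) (hK : c.κ (x₀, ξ₀) ∈ K) (N : ℕ) :
    ∃ C : ℝ, ∀ᶠ w in 𝓝 (x₀, ξ₀), ∀ q ∈ F, ‖iteratedFDeriv ℝ N (q ∘ c.κ) w‖ ≤ C := by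
  set φ := extChartAt phaseI (c.κ (x₀, ξ₀))
  have hcont : ContinuousAt c.κ (x₀, ξ₀) := (c.contMDiffAt_κ x₀ hξ₀).continuousAt
  have hφκ : AnalyticAt ℝ (φ ∘ c.κ) (x₀, ξ₀) := by
    have hcomp : ContMDiffAt 𝓘(ℝ, (Fin 2 → ℝ) × (Fin 2 → ℝ)) 𝓘(ℝ, PhaseModel) ω (φ ∘ c.κ)
        (x₀, ξ₀) := (contMDiffAt_extChartAt (I := phaseI)).comp _ (c.contMDiffAt_κ x₀ hξ₀)
    exact hcomp.contDiffAt.analyticAt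
  have hφκ_bound (i : ℕ) : ∃ D : ℝ, ∀ᶠ w in 𝓝 (x₀, ξ₀), ∀ _ ∈ (univ : Set Unit),
      ‖iteratedFDeriv ℝ i (φ ∘ c.κ) w‖ ≤ D := by
    obtain ⟨u, hu, hφκu⟩ := hφκ.exists_mem_nhds_analyticOnNhd
    have hlim := (hφκu.iteratedFDeriv i _ (mem_of_mem_nhds hu)).continuousAt.norm
    exact ⟨_, (hlim.eventually (gt_mem_nhds (lt_add_one _))).mono fun _ h _ _ => h.le⟩
  obtain ⟨C, hC⟩ := exists_uniform_bound_of_eventually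
    (fun i => (hF.exists_bound hF_an hK i).imp fun _ h => hφκ.continuousAt.eventually h) N
  obtain ⟨D, hD⟩ := exists_uniform_bound_of_eventually hφκ_bound N
  have hsource : ∀ᶠ w in 𝓝 (x₀, ξ₀), ∀ᶠ w' in 𝓝 w, c.κ w' ∈ φ.source := by
    rw [eventually_eventually_nhds]
    exact hcont (extChartAt_source_mem_nhds (I := phaseI) _)
  refine ⟨N.factorial * C * max D 1 ^ N, ?_⟩
  filter_upwards [hC, hD, hsource, hφκ.eventually_analyticAt] with w hCw hDw hsw hφκw q hq
  have heq : q ∘ c.κ =ᶠ[𝓝 w] (q ∘ φ.symm) ∘ (φ ∘ c.κ) := by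
    filter_upwards [hsw] with w' hw'
    simp only [Function.comp, φ.left_inv hw']
  rw [(heq.iteratedFDeriv ℝ N).eq_of_nhds]
  refine norm_iteratedFDeriv_comp_le_of_contDiffAt
    ((contDiffAt_comp_extChartAt_symm (hF_an q hq) _ (φ.map_source hsw.self_of_nhds)).of_le le_top)
    (hφκw.contDiffAt.of_le le_top) (fun i hi => hCw i hi q hq) fun i hi hiN => ?_
  calc ‖iteratedFDeriv ℝ i (φ ∘ c.κ) w‖ ≤ max D 1 :=
        (hDw i hiN () (mem_univ _)).trans (le_max_left _ _)
    _ ≤ max D 1 ^ i := le_self_pow₀ (le_max_right _ _) (by omega)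

theorem norm_iteratedFDeriv_comp_κ_le {q : Cotangent M → ℝ} {ξ : Fin 2 → ℝ} (hξ : ξ ∈ c.B) {n : ℕ}
    {C : ℝ} (hC : ∀ x ∈ torusBox (Fin 2), ‖iteratedFDeriv ℝ n (q ∘ c.κ) (x, ξ)‖ ≤ C)
    (x : Fin 2 → ℝ) : ‖iteratedFDeriv ℝ n (q ∘ c.κ) (x, ξ)‖ ≤ C := by
  obtain ⟨k, hk⟩ := exists_add_two_pi_mem_torusBox x
  let v : (Fin 2 → ℝ) × (Fin 2 → ℝ) := (fun i => 2 * Real.pi * k i, 0)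
  have hv (w : (Fin 2 → ℝ) × (Fin 2 → ℝ)) : w + v = (fun i => w.1 i + 2 * Real.pi * k i, w.2) :=
    Prod.ext rfl (add_zero _)
  have heq : (fun w => (q ∘ c.κ) (w + v)) =ᶠ[𝓝 (x, ξ)] q ∘ c.κ := by
    filter_upwards [(isOpen_univ.prod c.isOpen_B).mem_nhds ⟨mem_univ x, hξ⟩] with w hw
    rw [hv, Function.comp_apply, Function.comp_apply, c.κ_periodic w.1 hw.2 k]
  rw [← (heq.iteratedFDeriv ℝ n).eq_of_nhds, iteratedFDeriv_comp_add_right, hv]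
  exact hC _ hk

theorem contDiff_comp_κ_line {q : Cotangent M → ℝ} (hq : ContMDiff phaseI 𝓘(ℝ, ℝ) ω q)
    {ξ : Fin 2 → ℝ} (hξ : ξ ∈ c.B) (n : ℕ) (x v : Fin 2 → ℝ) :
    ContDiff ℝ n fun s : ℝ => q (c.κ (x + s • v, ξ)) :=
  contDiff_iff_contDiffAt.2 fun s =>
    ContDiffAt.comp (g := q ∘ c.κ) (f := fun s : ℝ => (x + s • v, ξ)) s
      ((c.contDiffAt_comp_κ hq _ hξ).of_le le_top) (by fun_prop)

theorem exists_norm_iteratedFDeriv_comp_κ_le (hF : UniformlyAnalyticOn F K)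
    (hF_an : ∀ q ∈ F, ContMDiff phaseI 𝓘(ℝ, ℝ) ω q) {ξ₀ : Fin 2 → ℝ} (hξ₀ : ξ₀ ∈ c.B)
    (hK : ∀ x, c.κ (x, ξ₀) ∈ K) (N : ℕ) :
    ∃ C : ℝ, ∀ᶠ ξ in 𝓝 ξ₀, ∀ q ∈ F, ∀ x, ‖iteratedFDeriv ℝ N (q ∘ c.κ) (x, ξ)‖ ≤ C := by
  have hbox : ∃ C : ℝ, ∀ᶠ ξ in 𝓝 ξ₀, ∀ x ∈ torusBox (Fin 2), ∀ q ∈ F,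
      ‖iteratedFDeriv ℝ N (q ∘ c.κ) (x, ξ)‖ ≤ C := by
    refine isCompact_torusBox.induction_on (p := fun A => ∃ C : ℝ, ∀ᶠ ξ in 𝓝 ξ₀, ∀ x ∈ A, ∀ q ∈ F,
      ‖iteratedFDeriv ℝ N (q ∘ c.κ) (x, ξ)‖ ≤ C) ⟨0, by simp⟩ ?_ ?_ ?_
    · rintro A B hAB ⟨C, hC⟩
      exact ⟨C, hC.mono fun ξ h x hx => h x (hAB hx)⟩
    · rintro A B ⟨C, hC⟩ ⟨C', hC'⟩
      refine ⟨max C C', ?_⟩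
      filter_upwards [hC, hC'] with ξ h h' x hx q hq
      exact hx.elim (fun hx => (h x hx q hq).trans (le_max_left _ _))
        fun hx => (h' x hx q hq).trans (le_max_right _ _)
    · intro x₀ _
      obtain ⟨C, hC⟩ :=
        c.exists_norm_iteratedFDeriv_comp_κ_le_nhds hF hF_an x₀ hξ₀ (hK x₀) N
      rw [nhds_prod_eq, eventually_prod_iff] at hC
      obtain ⟨pa, hpa, pb, hpb, h⟩ := hC
      exact ⟨{x | pa x}, mem_nhdsWithin_of_mem_nhds hpa, C, hpb.mono fun ξ hξ x hx => h hx hξ⟩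
  obtain ⟨C, hC⟩ := hbox
  refine ⟨C, ?_⟩
  filter_upwards [hC, c.isOpen_B.mem_nhds hξ₀] with ξ hξC hξB q hq x
  exact c.norm_iteratedFDeriv_comp_κ_le hξB (fun y hy => hξC y hy q hq) x

theorem exists_abs_iteratedDeriv_comp_κ_le (hF : UniformlyAnalyticOn F K)
    (hF_an : ∀ q ∈ F, ContMDiff phaseI 𝓘(ℝ, ℝ) ω q) {ξ₀ : Fin 2 → ℝ} (hξ₀ : ξ₀ ∈ c.B)
    (hK : ∀ x, c.κ (x, ξ₀) ∈ K) {v : Fin 2 → ℝ} (hv : ‖v‖ ≤ 1) (N : ℕ) :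
    ∃ C : ℝ, ∀ᶠ ξ in 𝓝 ξ₀, ∀ q ∈ F, ∀ (x : Fin 2 → ℝ) (s : ℝ),
      |iteratedDeriv N (fun s : ℝ => q (c.κ (x + s • v, ξ))) s| ≤ C := by
  obtain ⟨C, hC⟩ := exists_uniform_bound_of_eventually
    (u := fun i ξ (b : (Cotangent M → ℝ) × (Fin 2 → ℝ)) =>
      ‖iteratedFDeriv ℝ i (b.1 ∘ c.κ) (b.2, ξ)‖) (s := F ×ˢ univ)
    (fun i => (c.exists_norm_iteratedFDeriv_comp_κ_le hF hF_an hξ₀ hK i).imp fun _ h =>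
      h.mono fun _ hξ b hb => hξ b.1 hb.1 b.2) N
  refine ⟨N.factorial * C * 1 ^ N, ?_⟩
  filter_upwards [hC, c.isOpen_B.mem_nhds hξ₀] with ξ hξC hξB q hq x s
  have hline (s : ℝ) : (x, ξ) + s • ((v, 0) : (Fin 2 → ℝ) × (Fin 2 → ℝ)) = (x + s • v, ξ) := by
    simp
  have heq : (fun s : ℝ => q (c.κ (x + s • v, ξ))) =
      (q ∘ c.κ) ∘ fun s : ℝ => (x, ξ) + s • ((v, 0) : (Fin 2 → ℝ) × (Fin 2 → ℝ)) :=
    funext fun s => by rw [Function.comp_apply, hline, Function.comp_apply]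
  rw [← Real.norm_eq_abs, ← norm_iteratedFDeriv_eq_norm_iteratedDeriv, heq]
  refine norm_iteratedFDeriv_comp_le_of_contDiffAt ?_ (by fun_prop) (fun i hi => ?_)
    fun i hi _ => ?_
  · rw [hline]
    exact (c.contDiffAt_comp_κ (hF_an q hq) _ hξB).of_le le_top
  · rw [hline]
    exact hξC i hi (q, _) ⟨hq, mem_univ _⟩
  · rw [one_pow]
    exact norm_iteratedFDeriv_add_smul_le _ (by simpa using hv) hi s

end ActionAngleChart

end UniformBounds

/-! ### Regular parameters and good values -/

theorem projRatio_eq_infty_iff {u v : ℝ} : projRatio u v = OnePoint.infty ↔ v = 0 := by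
  unfold projRatio
  split_ifs with h <;> simp [h]

theorem projRatio_of_ne_zero {u v : ℝ} (hv : v ≠ 0) :
    projRatio u v = ((u / v : ℝ) : OnePoint ℝ) := by
  simp [projRatio, hv]

theorem projRatio_eq_coe_iff {u v y : ℝ} (h : u ≠ 0 ∨ v ≠ 0) :
    projRatio u v = (y : OnePoint ℝ) ↔ u - y * v = 0 := by
  unfold projRatio
  split_ifs with hv
  · have hu : u ≠ 0 := h.resolve_right (not_not.2 hv)
    simp [hv, hu]
  · rw [OnePoint.coe_eq_coe, div_eq_iff hv, sub_eq_zero]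

@[simp] theorem finitePart_coe (x : ℝ) : finitePart (x : OnePoint ℝ) = x := rfl

/-- Near each point of `A` every value is either taken identically or not taken, except possibly at
the point itself. This is the form of the identity theorem common to real-valued analytic functions
and to analytic functions with values in the projective line. -/
def IsRigidOn {X : Type*} (r : ℝ → X) (A : Set ℝ) : Prop :=
  ∀ a ∈ A, ∀ x, (∀ᶠ b in 𝓝[A] a, r b = x) ∨ ∀ᶠ b in 𝓝[A \ {a}] a, r b ≠ x

theorem IsRigidOn.not_eventually_eq {X : Type*} {r : ℝ → X} {A : Set ℝ} (h : IsRigidOn r A)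
    (hnc : NonconstantOnComponents r A) {a : ℝ} (ha : a ∈ A) (x : X) :
    ¬ ∀ᶠ b in 𝓝[A] a, r b = x := by
  intro hconst
  -- The open sets near which `r` is identically `x`, and near which no point has that property,
  -- cover the component of `a`.
  set u : Set ℝ := {b | ∀ᶠ b' in 𝓝 b, b' ∈ A → r b' = x}
  set v : Set ℝ := {b | ∀ᶠ b' in 𝓝 b, b' ∈ A → b' ∉ u}
  have hCA : connectedComponentIn A a ⊆ A := connectedComponentIn_subset A a
  have hau : a ∈ u := eventually_nhdsWithin_iff.1 hconst
  have hcover : connectedComponentIn A a ⊆ u ∪ v := by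
    refine fun b hb => or_iff_not_imp_left.2 fun hbu => ?_
    have hb_ne := (h b (hCA hb) x).resolve_left fun h => hbu (eventually_nhdsWithin_iff.1 h)
    filter_upwards [eventually_nhdsWithin_iff.1 hb_ne] with b' hb' hb'A hb'u
    rcases eq_or_ne b' b with rfl | hbb
    · exact hbu hb'u
    · exact hb' ⟨hb'A, hbb⟩ (hb'u.self_of_nhds hb'A)
  have hCu : connectedComponentIn A a ⊆ u := by
    intro b hb
    by_contra hbu
    obtain ⟨b', hb', hb'u, hb'v⟩ := isPreconnected_connectedComponentIn u v
      isOpen_setOfPred_eventually_nhds isOpen_setOfPred_eventually_nhds hcover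
      ⟨a, mem_connectedComponentIn ha, hau⟩ ⟨b, hb, (hcover hb).resolve_left hbu⟩
    exact (hb'v.self_of_nhds (hCA hb')) hb'u
  refine hnc a ha fun b hb => ?_
  rw [(hCu hb).self_of_nhds (hCA hb), hau.self_of_nhds ha]

theorem isRigidOn_of_analyticOn {g : ℝ → ℝ} {A : Set ℝ} (hg : AnalyticOn ℝ g A) :
    IsRigidOn g A := by
  intro a ha x
  obtain ⟨G, -, hgG, hG⟩ := (hg a ha).exists_analyticAt
  refine (hG.eventually_eq_or_eventually_ne (analyticAt_const (v := x))).imp (fun h => ?_)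
    fun h => ?_
  · filter_upwards [nhdsWithin_le_nhds h, self_mem_nhdsWithin] with b hb hbA
    rw [hgG (mem_insert_of_mem _ hbA), hb]
  · filter_upwards [nhdsWithin_mono a (fun b hb => hb.2 : A \ {a} ⊆ {a}ᶜ) h, self_mem_nhdsWithin]
      with b hb hbA
    rwa [hgG (mem_insert_of_mem _ hbA.1)]

theorem ProjAnalyticOn.exists_analyticAt {r : ℝ → OnePoint ℝ} {A : Set ℝ} (hr : ProjAnalyticOn r A)
    {a : ℝ} (ha : a ∈ A) : ∃ u v : ℝ → ℝ, AnalyticAt ℝ u a ∧ AnalyticAt ℝ v a ∧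
      (∀ᶠ b in 𝓝 a, u b ≠ 0 ∨ v b ≠ 0) ∧ ∀ᶠ b in 𝓝[A] a, r b = projRatio (u b) (v b) := by
  obtain ⟨u, v, hu, hv, hne, hr⟩ := hr a ha
  obtain ⟨u', hua, huA, hu'⟩ := hu.exists_analyticAt
  obtain ⟨v', hva, hvA, hv'⟩ := hv.exists_analyticAt
  refine ⟨u', v', hu', hv', ?_, ?_⟩
  · rw [hua, hva] at hne
    rcases hne with hne | hne
    · exact (hu'.continuousAt.eventually_ne hne).mono fun _ => Or.inl
    · exact (hv'.continuousAt.eventually_ne hne).mono fun _ => Or.inr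
  · filter_upwards [hr, self_mem_nhdsWithin] with b hb hbA
    rw [hb, huA (mem_insert_of_mem _ hbA), hvA (mem_insert_of_mem _ hbA)]

theorem ProjAnalyticOn.isRigidOn {r : ℝ → OnePoint ℝ} {A : Set ℝ} (hr : ProjAnalyticOn r A) :
    IsRigidOn r A := by
  intro a ha x
  obtain ⟨u, v, hu, hv, hne, hruv⟩ := hr.exists_analyticAt ha
  obtain ⟨D, hD, hDx⟩ : ∃ D : ℝ → ℝ, AnalyticAt ℝ D a ∧ ∀ b, (u b ≠ 0 ∨ v b ≠ 0) →
      (projRatio (u b) (v b) = x ↔ D b = 0) := by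
    induction x using OnePoint.rec with
    | infty => exact ⟨v, hv, fun b _ => projRatio_eq_infty_iff⟩
    | coe y => exact ⟨fun b => u b - y * v b, hu.sub (analyticAt_const.mul hv),
        fun b hb => projRatio_eq_coe_iff hb⟩
  refine hD.eventually_eq_zero_or_eventually_ne_zero.imp (fun h => ?_) fun h => ?_
  · filter_upwards [nhdsWithin_le_nhds h, nhdsWithin_le_nhds hne, hruv] with b hDb hb hrb
    rw [hrb]
    exact (hDx b hb).2 hDb
  · filter_upwards [nhdsWithin_mono a (fun b hb => hb.2 : A \ {a} ⊆ {a}ᶜ) h,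
      nhdsWithin_le_nhds hne, nhdsWithin_mono a sdiff_subset hruv] with b hDb hb hrb
    rw [hrb]
    exact fun hx => hDb ((hDx b hb).1 hx)

theorem eventually_eq_of_eventually_deriv_eq_zero {G : ℝ → ℝ} {a : ℝ} (hG : AnalyticAt ℝ G a)
    (h : ∀ᶠ b in 𝓝 a, deriv G b = 0) : ∀ᶠ b in 𝓝 a, G b = G a := by
  obtain ⟨ε, hε, hball⟩ := Metric.eventually_nhds_iff_ball.1 (h.and hG.eventually_analyticAt)
  filter_upwards [Metric.ball_mem_nhds a hε] with b hb
  exact Metric.isOpen_ball.is_const_of_deriv_eq_zero (convex_ball a ε).isPreconnected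
    (fun y hy => (hball y hy).2.differentiableAt.differentiableWithinAt)
    (fun y hy => (hball y hy).1) hb (Metric.mem_ball_self hε)

theorem eventually_deriv_ne_zero_of_analyticAt {G : ℝ → ℝ} {a : ℝ} (hG : AnalyticAt ℝ G a)
    (h : ¬ ∀ᶠ b in 𝓝 a, G b = G a) : ∀ᶠ b in 𝓝[≠] a, deriv G b ≠ 0 :=
  hG.deriv.eventually_eq_zero_or_eventually_ne_zero.resolve_left fun h' =>
    h (eventually_eq_of_eventually_deriv_eq_zero hG h')

section AnalyticExtension

variable {J S : Set ℝ} {rot : ℝ → OnePoint ℝ} {g : ℝ → ℝ}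

theorem nhdsWithin_sdiff_of_isClosed {X : Type*} [TopologicalSpace X] {s t : Set X} {a : X}
    (ht : IsClosed t) (ha : a ∉ t) : 𝓝[s \ t] a = 𝓝[s] a := by
  rw [sdiff_eq]
  exact nhdsWithin_inter_of_mem' (nhdsWithin_le_nhds (ht.isOpen_compl.mem_nhds ha))

theorem exists_analyticAt_extensions (hrot_an : ProjAnalyticOn rot (J \ S))
    (hrot_nc : NonconstantOnComponents rot (J \ S)) (hg_an : AnalyticOn ℝ g (J \ S))
    (hg_nc : NonconstantOnComponents g (J \ S)) (hS : IsClosed S) {a : ℝ} (ha : a ∈ J \ S)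
    (hfin : rot a ≠ OnePoint.infty) :
    ∃ G U : ℝ → ℝ, AnalyticAt ℝ G a ∧ AnalyticAt ℝ U a ∧
      (∀ᶠ b in 𝓝[J] a, b ∉ S ∧ g b = G b ∧ rot b = (U b : OnePoint ℝ)) ∧
      ∀ᶠ b in 𝓝[≠] a, deriv G b ≠ 0 ∧ deriv U b ≠ 0 := by
  obtain ⟨G, -, hgG, hG⟩ := (hg_an a ha).exists_analyticAt
  obtain ⟨u, v, hu, hv, -, hruv⟩ := hrot_an.exists_analyticAt ha
  have hva : v a ≠ 0 := fun h =>
    hfin ((hruv.self_of_nhdsWithin ha).trans (projRatio_eq_infty_iff.2 h))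
  have hU : AnalyticAt ℝ (fun b => u b / v b) a := hu.div hv hva
  have hgG' : ∀ᶠ b in 𝓝[J \ S] a, g b = G b := by
    filter_upwards [self_mem_nhdsWithin] with b hb using hgG (mem_insert_of_mem _ hb)
  have hrU : ∀ᶠ b in 𝓝[J \ S] a, rot b = ((u b / v b : ℝ) : OnePoint ℝ) := by
    filter_upwards [hruv, nhdsWithin_le_nhds (hv.continuousAt.eventually_ne hva)] with b hb hvb
    rw [hb, projRatio_of_ne_zero hvb]
  refine ⟨G, fun b => u b / v b, hG, hU, ?_, ?_⟩
  · rw [← nhdsWithin_sdiff_of_isClosed hS ha.2]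
    filter_upwards [hgG', hrU, self_mem_nhdsWithin] with b hgb hrb hb using ⟨hb.2, hgb, hrb⟩
  · refine (eventually_deriv_ne_zero_of_analyticAt hG fun h => ?_).and
      (eventually_deriv_ne_zero_of_analyticAt hU fun h => ?_)
    · refine (isRigidOn_of_analyticOn hg_an).not_eventually_eq hg_nc ha (G a) ?_
      filter_upwards [hgG', nhdsWithin_le_nhds h] with b hgb hGb
      rw [hgb, hGb]
    · refine hrot_an.isRigidOn.not_eventually_eq hrot_nc ha ((u a / v a : ℝ) : OnePoint ℝ) ?_
      filter_upwards [hrU, nhdsWithin_le_nhds h] with b hrb hUb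
      rw [hrb, hUb]

theorem interior_nonempty_of_nonconstantOnComponents {X : Type*} {r : ℝ → X} (hJ : J.OrdConnected)
    (hr : NonconstantOnComponents r (J \ S)) (h : (J \ S).Nonempty) : (interior J).Nonempty := by
  obtain ⟨a, ha⟩ := h
  obtain ⟨b, hb, hba⟩ : ∃ b ∈ connectedComponentIn (J \ S) a, r b ≠ r a := by
    simpa using hr a ha
  have hbJ : b ∈ J := (connectedComponentIn_subset _ _ hb).1
  have hnontrivial : J.Nontrivial := ⟨a, ha.1, b, hbJ, fun h => hba (h ▸ rfl)⟩
  exact hJ.convex.nontrivial_iff_nonempty_interior.1 hnontrivial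

theorem uniqueDiffOn_of_nonconstantOnComponents {X : Type*} {r : ℝ → X} (hJ : J.OrdConnected)
    (hr : NonconstantOnComponents r (J \ S)) (h : (J \ S).Nonempty) : UniqueDiffOn ℝ J :=
  uniqueDiffOn_convex hJ.convex (interior_nonempty_of_nonconstantOnComponents hJ hr h)

end AnalyticExtension

theorem finite_fiber_of_derivWithin_ne_zero {J : Set ℝ} {g : ℝ → ℝ} {y : ℝ} (hJ : IsCompact J)
    (hg : ContinuousOn g J) (hg' : ∀ a ∈ J, g a = y → derivWithin g J a ≠ 0) :
    {a | a ∈ J ∧ g a = y}.Finite := by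
  have hclosed : IsClosed {a | a ∈ J ∧ g a = y} :=
    hg.preimage_isClosed_of_isClosed hJ.isClosed (isClosed_singleton (x := y))
  have hcompact : IsCompact {a | a ∈ J ∧ g a = y} := hJ.of_isClosed_subset hclosed fun a h => h.1
  by_contra hinf
  obtain ⟨a, ha, hacc⟩ := Set.Infinite.exists_accPt_of_subset_isCompact hinf hcompact subset_rfl
  have hne := hg' a ha.1 ha.2
  have hev : ∀ᶠ b in 𝓝[J \ {a}] a, g b ≠ y :=
    (differentiableWithinAt_of_derivWithin_ne_zero hne).hasDerivWithinAt.eventually_ne hne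
  rw [accPt_iff_frequently_nhdsNE] at hacc
  obtain ⟨b, hb, hbJ, hby⟩ := ((eventually_nhdsWithin_iff.1 hev).filter_mono
    nhdsWithin_le_nhds).and_frequently (hacc.and_eventually self_mem_nhdsWithin) |>.exists
  exact hb ⟨hbJ.1, hby⟩ hbJ.2

section GoodValues

variable {J S : Set ℝ} {rot : ℝ → OnePoint ℝ} {g : ℝ → ℝ} {α d y a : ℝ}

theorem mem_regularParams_of_mem_goodValues (hy : y ∈ goodValues J S rot g α d) (ha : a ∈ J)
    (hga : g a = y) : a ∈ regularParams J S rot g α d := by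
  by_contra h
  exact hy.2 ⟨a, ⟨ha, h⟩, hga⟩

theorem finite_fiber_of_mem_goodValues (hJ : IsCompact J) (hg : ContinuousOn g J) (hα : 0 < α)
    (hy : y ∈ goodValues J S rot g α d) : {a | a ∈ J ∧ g a = y}.Finite :=
  finite_fiber_of_derivWithin_ne_zero hJ hg fun _ ha hga =>
    abs_pos.1 (hα.trans_le (mem_regularParams_of_mem_goodValues hy ha hga).2.2)

theorem image_diff_goodValues :
    (g '' J) \ goodValues J S rot g α d = g '' (J \ regularParams J S rot g α d) :=
  sdiff_sdiff_cancel_left (image_mono sdiff_subset)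

end GoodValues

section Diophantine

theorem volume_image_le_of_lipschitzOnWith {K : NNReal} {f : ℝ → ℝ} {s : Set ℝ}
    (h : LipschitzOnWith K f s) : volume (f '' s) ≤ K * volume s := by
  have := h.hausdorffMeasure_image_le (d := 1) zero_le_one
  rwa [hausdorffMeasure_real, ENNReal.rpow_one] at this

theorem volume_inter_preimage_eq_zero_of_hasStrictDerivAt {U : ℝ → ℝ} {s L : Set ℝ}
    (hU : ∀ x ∈ s, ∃ U' ≠ 0, HasStrictDerivAt U U' x) (hL : volume L = 0) :
    volume (s ∩ U ⁻¹' L) = 0 := by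
  refine measure_null_of_locally_null _ fun x hx => ?_
  obtain ⟨U', hU', hUx⟩ := hU x hx.1
  set V := hUx.localInverse U U' x hU'
  obtain ⟨K, t, ht, hK⟩ := (hUx.to_localInverse hU').hasStrictFDerivAt.exists_lipschitzOnWith
  have hinv : ∀ᶠ y in 𝓝 x, V (U y) = y :=
    (hUx.hasStrictFDerivAt_equiv hU').eventually_left_inverse
  have hpre : ∀ᶠ y in 𝓝 x, U y ∈ t := hUx.hasDerivAt.continuousAt ht
  have hVL : volume (V '' (t ∩ L)) = 0 := by
    have h := volume_image_le_of_lipschitzOnWith (hK.mono (inter_subset_left (t := L)))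
    rwa [measure_mono_null inter_subset_right hL, mul_zero, nonpos_iff_eq_zero] at h
  refine ⟨_, inter_mem (nhdsWithin_le_nhds (hinv.and hpre)) self_mem_nhdsWithin,
    measure_mono_null ?_ hVL⟩
  rintro y ⟨⟨hVU, hUt⟩, -, hUL⟩
  exact ⟨U y, ⟨hUt, hUL⟩, hVU⟩

/-- The real numbers satisfying the Diophantine condition with exponent `τ` and constant `α`.
Rational numbers are excluded as soon as `α > 0`, since all fractions `m / n` are tested. -/
def diophantineNumbers (τ α : ℝ) : Set ℝ :=
  {x | ∀ m : ℤ, ∀ n : ℕ, 0 < n → α / (n : ℝ) ^ τ ≤ |x - m / n|}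

theorem isClosed_diophantineNumbers (τ α : ℝ) : IsClosed (diophantineNumbers τ α) := by
  simp only [diophantineNumbers, ofPred_forall]
  exact isClosed_iInter fun m => isClosed_iInter fun n => isClosed_iInter fun _ =>
    isClosed_le continuous_const (by fun_prop)

theorem antitone_diophantineNumbers (τ : ℝ) : Antitone (diophantineNumbers τ) :=
  fun α β hαβ x hx m n hn => le_trans (by gcongr) (hx m n hn)

theorem exists_le_abs_sub_div_of_irrational {x : ℝ} (hx : Irrational x) (n : ℕ) :
    ∃ β > 0, ∀ m : ℤ, β ≤ |x - m / n| := by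
  rcases n.eq_zero_or_pos with rfl | hn
  · exact ⟨|x|, abs_pos.2 hx.ne_zero, fun m => by simp⟩
  have hn' : (0 : ℝ) < n := by exact_mod_cast hn
  have hround : 0 < |n * x - round (n * x)| :=
    abs_pos.2 (sub_ne_zero.2 ((hx.natCast_mul hn.ne').ne_int _))
  refine ⟨|n * x - round (n * x)| / n, by positivity, fun m => ?_⟩
  rw [div_le_iff₀ hn']
  calc |n * x - round (n * x)| ≤ |n * x - m| := round_le _ m
    _ = |x - m / n| * n := by
      rw [← abs_of_pos hn', ← abs_mul, abs_of_pos hn', sub_mul, div_mul_cancel₀ _ hn'.ne',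
        mul_comm]

theorem eventually_le_abs_sub_div_of_not_liouvilleWith {x τ : ℝ} (hx : Irrational x)
    (h : ¬ LiouvilleWith τ x) : ∀ᶠ n : ℕ in atTop, ∀ m : ℤ, 1 / (n : ℝ) ^ τ ≤ |x - m / n| := by
  simp only [LiouvilleWith, not_exists, not_frequently, not_and, not_lt] at h
  filter_upwards [h 1] with n hn m
  refine hn m fun hxm => hx ⟨m / n, ?_⟩
  rw [hxm]
  push_cast
  rfl

theorem exists_mem_diophantineNumbers {x τ : ℝ} (hτ : 0 ≤ τ) (hx : Irrational x)
    (h : ¬ LiouvilleWith τ x) : ∃ α > 0, x ∈ diophantineNumbers τ α := by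
  obtain ⟨N, hN⟩ := eventually_atTop.1 (eventually_le_abs_sub_div_of_not_liouvilleWith hx h)
  choose β hβ hβx using exists_le_abs_sub_div_of_irrational hx
  obtain ⟨n₀, -, hmin⟩ := (Finset.range (N + 1)).exists_min_image β ⟨0, by simp⟩
  refine ⟨min (β n₀) 1, lt_min (hβ n₀) one_pos, fun m n hn => ?_⟩
  have hn1 : (1 : ℝ) ≤ n := by exact_mod_cast hn
  rcases le_total N n with hNn | hnN
  · refine le_trans ?_ (hN n hNn m)
    gcongr
    exact min_le_right _ _
  · calc min (β n₀) 1 / (n : ℝ) ^ τ ≤ min (β n₀) 1 :=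
          div_le_self (le_min (hβ n₀).le zero_le_one) (Real.one_le_rpow hn1 hτ)
      _ ≤ β n := (min_le_left _ _).trans (hmin n (by simpa using Nat.lt_succ_of_le hnN))
      _ ≤ |x - m / n| := hβx n m

theorem volume_notMem_diophantineNumbers {τ : ℝ} (hτ : 2 < τ) :
    volume {x : ℝ | ¬ ∃ α > 0, x ∈ diophantineNumbers τ α} = 0 := by
  have hnull : volume (range ((↑) : ℚ → ℝ) ∪ {x | ¬ ∀ p > (2 : ℝ), ¬ LiouvilleWith p x}) = 0 :=
    measure_union_null ((countable_range _).measure_zero _) ae_not_liouvilleWith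
  refine measure_mono_null (fun x hx => ?_) hnull
  by_contra hx'
  rw [mem_union, not_or] at hx'
  exact hx (exists_mem_diophantineNumbers (by linarith) hx'.1 (not_not.1 hx'.2 τ hτ))

theorem tendsto_volume_diff_diophantine {I : Set ℝ} {m U : ℝ → ℝ} {τ : ℝ} (hI : IsCompact I)
    (hm : ContinuousOn m I) (hU : ContinuousOn U I)
    (hnull : volume {b ∈ I | ¬ (0 < m b ∧ ∃ α > 0, U b ∈ diophantineNumbers τ α)} = 0) :
    Tendsto (fun α => volume (I \ {b | α ≤ m b ∧ U b ∈ diophantineNumbers τ α})) (𝓝[>] 0)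
      (𝓝 0) := by
  set E : ℝ → Set ℝ := fun α => I \ {b | α ≤ m b ∧ U b ∈ diophantineNumbers τ α} with hE
  have hmeas : ∀ α, MeasurableSet (E α) := fun α => by
    have hclosed : IsClosed (I ∩ m ⁻¹' Ici α ∩ (I ∩ U ⁻¹' diophantineNumbers τ α)) :=
      (hm.preimage_isClosed_of_isClosed hI.isClosed isClosed_Ici).inter
        (hU.preimage_isClosed_of_isClosed hI.isClosed (isClosed_diophantineNumbers τ α))
    convert hI.measurableSet.diff hclosed.measurableSet using 1
    ext b
    simp only [hE, Set.mem_sdiff, mem_ofPred_eq, mem_inter_iff, mem_preimage, mem_Ici]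
    tauto
  have hmono : ∀ α β : ℝ, 0 < α → α ≤ β → E α ⊆ E β := fun α β _ hαβ =>
    sdiff_subset_sdiff_right fun b hb => ⟨hαβ.trans hb.1, antitone_diophantineNumbers τ hαβ hb.2⟩
  have hinter : volume (⋂ α > (0 : ℝ), E α) = 0 := by
    refine measure_mono_null (fun b hb => ?_) hnull
    rw [mem_iInter₂] at hb
    refine ⟨(hb 1 one_pos).1, fun ⟨hmb, α, hα, hαb⟩ => (hb (min α (m b)) (lt_min hα hmb)).2 ?_⟩
    exact ⟨min_le_right _ _, antitone_diophantineNumbers τ (min_le_left _ _) hαb⟩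
  rw [← hinter]
  exact tendsto_measure_biInter_gt (fun α _ => (hmeas α).nullMeasurableSet) hmono
    ⟨1, one_pos, ((measure_mono sdiff_subset).trans_lt hI.measure_lt_top).ne⟩

end Diophantine

theorem tendsto_volume_image_of_locally {J P : Set ℝ} {g : ℝ → ℝ} {E : ℝ → Set ℝ} {l : Filter ℝ}
    (hJ : IsCompact J) (hg : ContinuousOn g J) (hP : P.Countable)
    (hloc : ∀ a ∈ J \ P, ∃ I ∈ 𝓝[J] a, Tendsto (fun α => volume (g '' (I \ E α))) l (𝓝 0)) :
    Tendsto (fun α => volume (g '' (J \ E α))) l (𝓝 0) := by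
  rw [ENNReal.tendsto_nhds_zero]
  intro ε hε
  have hε2 : 0 < ε / 2 := ENNReal.half_pos hε.ne'
  obtain ⟨O, hPO, hO, hOε⟩ := Set.exists_isOpen_lt_of_lt (μ := volume) (g '' P) (ε / 2)
    (by rwa [(hP.image g).measure_zero])
  obtain ⟨O', hO', hOO'⟩ := continuousOn_iff'.1 hg O hO
  have hO'_iff : ∀ a ∈ J, a ∈ O' ↔ g a ∈ O := fun a ha => by
    simpa [ha] using (Set.ext_iff.1 hOO' a).symm
  have hrest : Tendsto (fun α => volume (g '' ((J \ O') \ E α))) l (𝓝 0) := by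
    refine (hJ.diff hO').induction_on
      (p := fun A => Tendsto (fun α => volume (g '' (A \ E α))) l (𝓝 0))
      (by simpa using tendsto_const_nhds) ?_ ?_ ?_
    · intro A B hAB hB
      exact tendsto_of_tendsto_of_tendsto_of_le_of_le tendsto_const_nhds hB (fun _ => bot_le)
        fun α => measure_mono (image_mono (sdiff_subset_sdiff_left hAB))
    · intro A B hA hB
      refine tendsto_of_tendsto_of_tendsto_of_le_of_le tendsto_const_nhds
        (by simpa only [add_zero] using hA.add hB) (fun _ => bot_le) fun α => ?_
      simp only [union_sdiff_distrib, image_union]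
      exact measure_union_le _ _
    · intro a ha
      have haP : a ∉ P := fun h => ha.2 ((hO'_iff a ha.1).2 (hPO (mem_image_of_mem g h)))
      obtain ⟨I, hI, hlim⟩ := hloc a ⟨ha.1, haP⟩
      exact ⟨I, nhdsWithin_mono a sdiff_subset hI, hlim⟩
  filter_upwards [(ENNReal.tendsto_nhds_zero.1 hrest) (ε / 2) hε2] with α hα
  have hcover : g '' (J \ E α) ⊆ O ∪ g '' ((J \ O') \ E α) := by
    rintro _ ⟨a, ⟨haJ, haE⟩, rfl⟩
    by_cases haO : a ∈ O'
    · exact Or.inl ((hO'_iff a haJ).1 haO)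
    · exact Or.inr ⟨a, ⟨⟨haJ, haO⟩, haE⟩, rfl⟩
  calc volume (g '' (J \ E α)) ≤ volume O + volume (g '' ((J \ O') \ E α)) :=
        (measure_mono hcover).trans (measure_union_le _ _)
    _ ≤ ε / 2 + ε / 2 := by gcongr
    _ = ε := ENNReal.add_halves ε

section RegularParams

variable {J S : Set ℝ} {rot : ℝ → OnePoint ℝ} {g : ℝ → ℝ} {α d : ℝ}

theorem mem_regularParams_iff_of_eventuallyEq (hJu : UniqueDiffOn ℝ J) {G U : ℝ → ℝ} {b : ℝ}
    (hbJ : b ∈ J) (hev : ∀ᶠ y in 𝓝[J] b, y ∉ S ∧ g y = G y ∧ rot y = (U y : OnePoint ℝ))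
    (hG : DifferentiableAt ℝ G b) (hU : DifferentiableAt ℝ U b) :
    b ∈ regularParams J S rot g α d ↔ (∀ s ∈ S, α ≤ |b - s|) ∧ α ≤ |deriv U b| ∧
      α ≤ |deriv G b| ∧ U b ∈ diophantineNumbers (2 + d) α := by
  obtain ⟨hbS, hgb, hrb⟩ := hev.self_of_nhdsWithin hbJ
  have hg' : derivWithin g J b = deriv G b := by
    rw [Filter.EventuallyEq.derivWithin_eq (hev.mono fun y hy => hy.2.1) hgb,
      hG.derivWithin (hJu b hbJ)]
  have hrot' : derivWithin (fun y => finitePart (rot y)) J b = deriv U b := by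
    have heq : (fun y => finitePart (rot y)) =ᶠ[𝓝[J] b] U := by
      filter_upwards [hev] with y hy
      rw [hy.2.2, finitePart_coe]
    rw [heq.derivWithin_eq (heq.self_of_nhdsWithin hbJ), hU.derivWithin (hJu b hbJ)]
  simp only [regularParams, diophantineParams, diophantineNumbers, mem_inter_iff, mem_ofPred_eq,
    hg', hrot', hrb, finitePart_coe, Set.mem_sdiff, hbJ, hbS, ne_eq, OnePoint.coe_ne_infty,
    not_false_eq_true, true_and]
  tauto

theorem exists_eventually_le_abs_sub {a : ℝ} (hS : IsClosed S) (ha : a ∉ S) :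
    ∃ ε > 0, ∀ᶠ b in 𝓝 a, ∀ s ∈ S, ε ≤ |b - s| := by
  obtain ⟨ε, hε, hball⟩ := Metric.isOpen_iff.1 hS.isOpen_compl a ha
  refine ⟨ε / 2, half_pos hε, ?_⟩
  filter_upwards [Metric.ball_mem_nhds a (half_pos hε)] with b hb s hs
  have has : ε ≤ dist s a := not_lt.1 fun h => hball h hs
  have htri := dist_triangle s b a
  rw [Metric.mem_ball] at hb
  rw [← Real.dist_eq, dist_comm]
  linarith

theorem exists_nhds_mem_regularParams_iff (hJ : IsCompact J) (hJu : UniqueDiffOn ℝ J)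
    (hrot_an : ProjAnalyticOn rot (J \ S)) (hrot_nc : NonconstantOnComponents rot (J \ S))
    (hg_an : AnalyticOn ℝ g (J \ S)) (hg_nc : NonconstantOnComponents g (J \ S))
    (hS : IsClosed S) {a : ℝ} (ha : a ∈ J \ S) (hfin : rot a ≠ OnePoint.infty) (d : ℝ) :
    ∃ I ∈ 𝓝[J] a, IsCompact I ∧ (∃ K, LipschitzOnWith K g I) ∧ ∃ m U : ℝ → ℝ,
      ContinuousOn m I ∧ ContinuousOn U I ∧
      (∀ b ∈ I \ {a}, 0 < m b ∧ ∃ U' ≠ 0, HasStrictDerivAt U U' b) ∧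
      ∃ ε > 0, ∀ α ≤ ε, ∀ b ∈ I,
        b ∈ regularParams J S rot g α d ↔ α ≤ m b ∧ U b ∈ diophantineNumbers (2 + d) α := by
  obtain ⟨G, U, hG, hU, hev, hne⟩ :=
    exists_analyticAt_extensions hrot_an hrot_nc hg_an hg_nc hS ha hfin
  obtain ⟨K, t, ht, hK⟩ := hG.hasStrictDerivAt.hasStrictFDerivAt.exists_lipschitzOnWith
  obtain ⟨ε, hε, hεS⟩ := exists_eventually_le_abs_sub hS ha.2
  have hall : ∀ᶠ b in 𝓝 a, AnalyticAt ℝ G b ∧ AnalyticAt ℝ U b ∧ b ∈ t ∧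
      (∀ s ∈ S, ε ≤ |b - s|) ∧
      (b ∈ J → ∀ᶠ y in 𝓝[J] b, y ∉ S ∧ g y = G y ∧ rot y = (U y : OnePoint ℝ)) ∧
      (b ≠ a → deriv G b ≠ 0 ∧ deriv U b ≠ 0) := by
    filter_upwards [hG.eventually_analyticAt, hU.eventually_analyticAt, ht, hεS,
      eventually_nhdsWithin_iff.1 (eventually_eventually_nhdsWithin.2 hev),
      eventually_nhdsWithin_iff.1 hne] with b hGb hUb htb hεb hevb hneb
    exact ⟨hGb, hUb, htb, hεb, hevb, hneb⟩
  obtain ⟨δ, hδ, hball⟩ := Metric.nhds_basis_closedBall.eventually_iff.1 hall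
  have hgG : EqOn g G (J ∩ Metric.closedBall a δ) := fun b hb =>
    (((hball hb.2).2.2.2.2.1 hb.1).self_of_nhdsWithin hb.1).2.1
  refine ⟨J ∩ Metric.closedBall a δ, inter_mem_nhdsWithin _ (Metric.closedBall_mem_nhds a hδ),
    hJ.inter_right Metric.isClosed_closedBall, ⟨K, ?_⟩,
    fun b => min |deriv U b| |deriv G b|, U, ?_, ?_, ?_, ε, hε, fun α hα b hb => ?_⟩
  · intro x hx y hy
    rw [hgG hx, hgG hy]
    exact hK (hball hx.2).2.2.1 (hball hy.2).2.2.1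
  · exact ContinuousOn.inf
      (fun b hb => (hball hb.2).2.1.deriv.continuousAt.abs.continuousWithinAt)
      fun b hb => (hball hb.2).1.deriv.continuousAt.abs.continuousWithinAt
  · exact fun b hb => (hball hb.2).2.1.continuousAt.continuousWithinAt
  · intro b hb
    obtain ⟨hG', hU'⟩ := (hball hb.1.2).2.2.2.2.2 hb.2
    exact ⟨lt_min (abs_pos.2 hU') (abs_pos.2 hG'), _, hU', (hball hb.1.2).2.1.hasStrictDerivAt⟩
  · obtain ⟨hGb, hUb, -, hεb, hevb, -⟩ := hball hb.2
    rw [mem_regularParams_iff_of_eventuallyEq hJu hb.1 (hevb hb.1) hGb.differentiableAt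
      hUb.differentiableAt, le_min_iff, and_assoc]
    exact and_iff_right fun s hs => hα.trans (hεb s hs)

theorem exists_nhds_tendsto_volume_image_diff_regularParams (hJ : IsCompact J)
    (hJu : UniqueDiffOn ℝ J) (hrot_an : ProjAnalyticOn rot (J \ S))
    (hrot_nc : NonconstantOnComponents rot (J \ S)) (hg_an : AnalyticOn ℝ g (J \ S))
    (hg_nc : NonconstantOnComponents g (J \ S)) (hS : IsClosed S) (hd : 0 < d) {a : ℝ}
    (ha : a ∈ J \ S) (hfin : rot a ≠ OnePoint.infty) :
    ∃ I ∈ 𝓝[J] a,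
      Tendsto (fun α => volume (g '' (I \ regularParams J S rot g α d))) (𝓝[>] 0) (𝓝 0) := by
  obtain ⟨I, hI, hIc, ⟨K, hK⟩, m, U, hm, hU, hne, ε, hε, hiff⟩ :=
    exists_nhds_mem_regularParams_iff hJ hJu hrot_an hrot_nc hg_an hg_nc hS ha hfin d
  refine ⟨I, hI, ?_⟩
  set L := {x : ℝ | ¬ ∃ α > 0, x ∈ diophantineNumbers (2 + d) α}
  have hL : volume ((I \ {a}) ∩ U ⁻¹' L) = 0 :=
    volume_inter_preimage_eq_zero_of_hasStrictDerivAt (fun b hb => (hne b hb).2)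
      (volume_notMem_diophantineNumbers (by linarith))
  have hlim := tendsto_volume_diff_diophantine (τ := 2 + d) hIc hm hU <| by
    refine measure_mono_null (fun b hb => ?_)
      (measure_union_null (Real.volume_singleton (a := a)) hL)
    by_cases hba : b = a
    · exact Or.inl hba
    · exact Or.inr ⟨⟨hb.1, hba⟩, fun hdio => hb.2 ⟨(hne b ⟨hb.1, hba⟩).1, hdio⟩⟩
  have hKlim := ENNReal.Tendsto.const_mul hlim (Or.inr (ENNReal.coe_ne_top (r := K)))
  rw [mul_zero] at hKlim
  refine tendsto_of_tendsto_of_tendsto_of_le_of_le' tendsto_const_nhds hKlim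
    (Eventually.of_forall fun _ => bot_le) ?_
  filter_upwards [nhdsWithin_le_nhds (Iic_mem_nhds hε)] with α hα
  have hsub : I \ regularParams J S rot g α d ⊆
      I \ {b | α ≤ m b ∧ U b ∈ diophantineNumbers (2 + d) α} :=
    fun b hb => ⟨hb.1, fun h => hb.2 ((hiff α hα b hb.1).2 h)⟩
  calc volume (g '' (I \ regularParams J S rot g α d))
      ≤ K * volume (I \ regularParams J S rot g α d) :=
        volume_image_le_of_lipschitzOnWith (hK.mono sdiff_subset)
    _ ≤ _ := by gcongr

theorem countable_rotationNumber_eq_infty (hrot_an : ProjAnalyticOn rot (J \ S))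
    (hrot_nc : NonconstantOnComponents rot (J \ S)) :
    {a ∈ J \ S | rot a = OnePoint.infty}.Countable := by
  obtain ⟨t, -, htc, hst⟩ := TopologicalSpace.countable_cover_nhdsWithin
    (s := {a ∈ J \ S | rot a = OnePoint.infty}) (f := fun a => {a}) fun a ha => by
      rcases hrot_an.isRigidOn a ha.1 OnePoint.infty with h | h
      · exact absurd h (hrot_an.isRigidOn.not_eventually_eq hrot_nc ha.1 _)
      · rw [mem_nhdsWithin_iff_eventually]
        filter_upwards [eventually_nhdsWithin_iff.1 h] with b hb hbP
        by_contra hba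
        exact hb ⟨hbP.1, hba⟩ hbP.2
  exact htc.mono (by simpa using hst)

theorem tendsto_volume_diff_goodValues (hJ : IsCompact J) (hJo : J.OrdConnected)
    (hrot_an : ProjAnalyticOn rot (J \ S)) (hrot_nc : NonconstantOnComponents rot (J \ S))
    (hg_cont : ContinuousOn g J) (hg_an : AnalyticOn ℝ g (J \ S))
    (hg_nc : NonconstantOnComponents g (J \ S)) (hS : IsClosed S) (hSc : S.Countable)
    (hd : 0 < d) :
    Tendsto (fun α : ℝ => volume ((g '' J) \ goodValues J S rot g α d)) (𝓝[>] 0) (𝓝 0) := by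
  simp only [image_diff_goodValues]
  refine tendsto_volume_image_of_locally hJ hg_cont
    (hSc.union (countable_rotationNumber_eq_infty hrot_an hrot_nc)) fun a ha => ?_
  have haS : a ∈ J \ S := ⟨ha.1, fun h => ha.2 (Or.inl h)⟩
  exact exists_nhds_tendsto_volume_image_diff_regularParams hJ
    (uniqueDiffOn_of_nonconstantOnComponents hJo hg_nc ⟨a, haS⟩) hrot_an hrot_nc hg_an hg_nc hS hd
    haS fun h => ha.2 (Or.inr ⟨haS, h⟩)

end RegularParams

/-! ### The sets `Q_∞(a)` -/

section TorusLimit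

variable {ι : Type*} {Q : (ι → ℝ) → ℝ}

theorem TorusPeriodic.range_eq_image_torusBox (hper : TorusPeriodic Q) :
    range Q = Q '' torusBox ι := by
  refine Subset.antisymm ?_ (image_subset_range _ _)
  rintro _ ⟨x, rfl⟩
  obtain ⟨k, hk⟩ := exists_add_two_pi_mem_torusBox x
  exact ⟨_, hk, hper k x⟩

theorem TorusPeriodic.isCompact_range (hper : TorusPeriodic Q) (hQ : Continuous Q) :
    IsCompact (range Q) := by
  rw [hper.range_eq_image_torusBox]
  exact isCompact_torusBox.image hQ

variable [Fintype ι]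

theorem lineAverage_natCast_mul (hQ : Continuous Q) (w : ι → ℝ) (T : ℝ) (n : ℕ) (x : ι → ℝ) :
    lineAverage Q w (n * T) x =
      ∑ j ∈ Finset.range n, (n : ℝ)⁻¹ • lineAverage Q w T (x + (j * T) • w) := by
  have hsum := intervalIntegral.sum_integral_adjacent_intervals (a := fun j : ℕ => (j : ℝ) * T)
    (n := n) fun k _ => intervalIntegrable_line hQ w x _ _
  have hpiece : ∀ j : ℕ, lineAverage Q w T (x + (j * T) • w) =
      T⁻¹ * ∫ t in ((j : ℝ) * T)..((j + 1 : ℕ) : ℝ) * T, Q (x + t • w) := fun j => by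
    have hshift := intervalIntegral.integral_comp_add_right (a := 0) (b := T)
      (fun t : ℝ => Q (x + t • w)) ((j : ℝ) * T)
    rw [zero_add] at hshift
    have hend : ((j + 1 : ℕ) : ℝ) * T = T + j * T := by push_cast; ring
    rw [hend, ← hshift, lineAverage, smul_eq_mul]
    refine congrArg _ (intervalIntegral.integral_congr fun t _ => congrArg Q ?_)
    module
  simp only [Nat.cast_zero, zero_mul] at hsum
  simp only [hpiece, smul_eq_mul, ← Finset.mul_sum]
  rw [hsum, lineAverage, smul_eq_mul, mul_inv, mul_assoc]

theorem exists_tendstoUniformly_lineAverage (hQ : Continuous Q) (hper : TorusPeriodic Q)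
    (w : ι → ℝ) : ∃ L : (ι → ℝ) → ℝ, TendstoUniformly (lineAverage Q w) L atTop := by
  have hcauchy : UniformCauchySeqOn (lineAverage Q w) atTop univ := by
    rw [Metric.uniformCauchySeqOn_iff]
    intro ε hε
    obtain ⟨T₀, -, h⟩ := lineAverage_cauchy hQ hper w (half_pos hε)
    exact ⟨T₀, fun T hT T' hT' x _ => (h T hT T' hT' x).trans_lt (half_lt_self hε)⟩
  choose L hL using fun x => cauchySeq_tendsto_of_complete (hcauchy.cauchySeq (mem_univ x))
  exact ⟨L, tendstoUniformlyOn_univ.1 (hcauchy.tendstoUniformlyOn_of_tendsto fun x _ => hL x)⟩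

theorem iInter_range_subset_range_of_tendstoUniformly {X : Type*} {F : ℝ → X → ℝ} {L : X → ℝ}
    (hF : TendstoUniformly F L atTop) (hL : IsClosed (range L)) :
    ⋂ T ∈ Ici (1 : ℝ), range (F T) ⊆ range L := by
  intro y hy
  rw [← hL.closure_eq, Metric.mem_closure_iff]
  intro ε hε
  obtain ⟨T, hT, hT1⟩ :=
    ((Metric.tendstoUniformly_iff.1 hF ε hε).and (eventually_ge_atTop 1)).exists
  obtain ⟨x, rfl⟩ := mem_iInter₂.1 hy T hT1
  exact ⟨L x, mem_range_self x, by rw [dist_comm]; exact hT x⟩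

theorem mem_range_lineAverage_of_tendsto (hQ : Continuous Q) (hper : TorusPeriodic Q) {w x : ι → ℝ}
    {T y : ℝ} (hT : 0 < T) (hy : Tendsto (fun T => lineAverage Q w T x) atTop (𝓝 y)) :
    y ∈ range (lineAverage Q w T) := by
  have hc := continuous_lineAverage hQ w T
  have hclosed : IsClosed (range (lineAverage Q w T)) :=
    (TorusPeriodic.isCompact_range (fun k => lineAverage_periodic (hper k) w T) hc).isClosed
  have hconv : Convex ℝ (range (lineAverage Q w T)) := (isPreconnected_range hc).ordConnected.convex
  have hlim : Tendsto (fun n : ℕ => lineAverage Q w (n * T) x) atTop (𝓝 y) :=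
    hy.comp (tendsto_natCast_atTop_atTop.atTop_mul_const hT)
  refine hclosed.mem_of_tendsto hlim ?_
  filter_upwards [eventually_gt_atTop 0] with n hn
  -- The average over time `n * T` is a convex combination of averages over time `T`.
  rw [lineAverage_natCast_mul hQ w T n]
  refine hconv.sum_mem (fun _ _ => by positivity) ?_ fun j _ => mem_range_self _
  have hn' : (n : ℝ) ≠ 0 := by exact_mod_cast hn.ne'
  simp [hn']

theorem exists_tendsto_lineAverage_and_iInter_range_eq (hQ : Continuous Q) (hper : TorusPeriodic Q)
    (w : ι → ℝ) : ∃ L : (ι → ℝ) → ℝ,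
      (∀ x, Tendsto (fun T => lineAverage Q w T x) atTop (𝓝 (L x))) ∧
      ⋂ T ∈ Ici (1 : ℝ), range (lineAverage Q w T) = range L := by
  obtain ⟨L, hL⟩ := exists_tendstoUniformly_lineAverage hQ hper w
  have hLx : ∀ x, Tendsto (fun T => lineAverage Q w T x) atTop (𝓝 (L x)) :=
    fun x => hL.tendsto_at x
  have hLc : Continuous L :=
    hL.continuous (Frequently.of_forall fun T => continuous_lineAverage hQ w T)
  have hLper : TorusPeriodic L := fun k x => tendsto_nhds_unique (hLx _) <| by
    simpa only [lineAverage_periodic (hper k) w _ x] using hLx x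
  refine ⟨L, hLx, (iInter_range_subset_range_of_tendstoUniformly hL
    (hLper.isCompact_range hLc).isClosed).antisymm ?_⟩
  rintro _ ⟨x, rfl⟩
  exact mem_iInter₂.2 fun T hT =>
    mem_range_lineAverage_of_tendsto hQ hper (one_pos.trans_le hT) (hLx x)

end TorusLimit

namespace ActionAngleChart

variable {M : Type*} [TopologicalSpace M] [ChartedSpace Plane M] [IsManifold 𝓘(ℝ, Plane) ω M]
  {p f q : Cotangent M → ℝ} {a₀ a : ℝ} (c : ActionAngleChart p f a₀)

theorem isPreconnected_leaf (ha : a ∈ c.V ∩ leafParams p f) : IsPreconnected (leaf p f a) := by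
  rw [c.leaf_eq a ha]
  exact isPreconnected_range (c.continuous_κ_left (c.action_mem a ha))

theorem QInfty_eq [T2Space M] (hp : ContMDiff phaseI 𝓘(ℝ, ℝ) 2 p) (q : Cotangent M → ℝ)
    (ha : a ∈ c.V ∩ leafParams p f) :
    QInfty p f q a = ⋂ T ∈ Ici (1 : ℝ),
      range (lineAverage (fun x => q (c.κ (x, c.action a))) (c.frequencyVector a) T) := by
  have himage : ∀ T : ℝ, flowAverage p q T '' leaf p f a =
      range (lineAverage (fun x => q (c.κ (x, c.action a))) (c.frequencyVector a) T) := fun T => by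
    rw [c.leaf_eq a ha, ← range_comp]
    exact congrArg range (funext fun x => c.flowAverage_κ hp q x (c.action_mem a ha) T)
  have hcomp : ∀ z ∈ leaf p f a, connectedComponentIn (leaf p f a) z = leaf p f a :=
    fun z hz => (c.isPreconnected_leaf ha).connectedComponentIn hz
  have hne : (leaf p f a).Nonempty := by
    rw [c.leaf_eq a ha]
    exact range_nonempty _
  simp only [← himage]
  calc QInfty p f q a = ⋃ z ∈ leaf p f a, ⋂ T ∈ Ici (1 : ℝ), flowAverage p q T '' leaf p f a :=
        iUnion₂_congr fun z hz => by rw [hcomp z hz]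
    _ = ⋂ T ∈ Ici (1 : ℝ), flowAverage p q T '' leaf p f a := biUnion_const hne _

theorem continuous_comp_κ (hq : Continuous q) {ξ : Fin 2 → ℝ} (hξ : ξ ∈ c.B) :
    Continuous fun x => q (c.κ (x, ξ)) := hq.comp (c.continuous_κ_left hξ)

theorem torusPeriodic_comp_κ (q : Cotangent M → ℝ) {ξ : Fin 2 → ℝ} (hξ : ξ ∈ c.B) :
    TorusPeriodic fun x => q (c.κ (x, ξ)) := fun k x => congrArg q (c.κ_periodic x hξ k)

theorem exists_tendsto_flowAverage_and_QInfty_eq [T2Space M]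
    (hp : ContMDiff phaseI 𝓘(ℝ, ℝ) 2 p) (hq : Continuous q) (ha : a ∈ c.V ∩ leafParams p f) :
    ∃ L : Cotangent M → ℝ,
      (∀ z ∈ leaf p f a, Tendsto (fun T => flowAverage p q T z) atTop (𝓝 (L z))) ∧
      QInfty p f q a = L '' leaf p f a := by
  have hB := c.action_mem a ha
  obtain ⟨L, hL, hrange⟩ := exists_tendsto_lineAverage_and_iInter_range_eq
    (c.continuous_comp_κ hq hB) (c.torusPeriodic_comp_κ q hB) (c.frequencyVector a)
  have hlim : ∀ x, Tendsto (fun T => flowAverage p q T (c.κ (x, c.action a))) atTop (𝓝 (L x)) :=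
    fun x => by simpa only [c.flowAverage_κ hp q x hB] using hL x
  refine ⟨fun z => limUnder atTop fun T => flowAverage p q T z, fun z hz => ?_, ?_⟩
  · rw [c.leaf_eq a ha] at hz
    obtain ⟨x, rfl⟩ := hz
    exact tendsto_nhds_limUnder ⟨_, hlim x⟩
  · rw [c.QInfty_eq hp q ha, hrange, c.leaf_eq a ha, ← range_comp]
    exact congrArg range (funext fun x => (hlim x).limUnder_eq.symm)

theorem torusAverage_mem_QInfty [T2Space M] (hp : ContMDiff phaseI 𝓘(ℝ, ℝ) 2 p)
    (hq : Continuous q) (ha : a ∈ c.V ∩ leafParams p f) : c.torusAverage q a ∈ QInfty p f q a := by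
  have hB := c.action_mem a ha
  rw [c.QInfty_eq hp q ha, mem_iInter₂]
  intro T hT
  obtain ⟨x, hx⟩ := exists_lineAverage_eq_mean (c.continuous_comp_κ hq hB)
    (c.torusPeriodic_comp_κ q hB) (c.frequencyVector a) (one_pos.trans_le hT)
  rw [Fintype.card_fin] at hx
  exact ⟨x, hx⟩

theorem diam_QInfty_le [T2Space M] (hp : ContMDiff phaseI 𝓘(ℝ, ℝ) 2 p) (q : Cotangent M → ℝ)
    (ha : a ∈ c.V ∩ leafParams p f) {T D : ℝ} (hT : 1 ≤ T)
    (h : ∀ x y, |lineAverage (fun x => q (c.κ (x, c.action a))) (c.frequencyVector a) T x -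
      lineAverage (fun x => q (c.κ (x, c.action a))) (c.frequencyVector a) T y| ≤ D) :
    Metric.diam (QInfty p f q a) ≤ D := by
  refine Metric.diam_le_of_forall_dist_le ((abs_nonneg _).trans (h 0 0)) fun y hy y' hy' => ?_
  rw [c.QInfty_eq hp q ha, mem_iInter₂] at hy hy'
  obtain ⟨x, rfl⟩ := hy T hT
  obtain ⟨x', rfl⟩ := hy' T hT
  exact h x x'

theorem diam_QInfty_eq_zero_of_nonresonant [T2Space M] (hp : ContMDiff phaseI 𝓘(ℝ, ℝ) 2 p)
    (hq : Continuous q) (ha : a ∈ c.V ∩ leafParams p f)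
    (hw : ∀ k : Fin 2 → ℤ, ∑ i, k i * c.frequencyVector a i = 0 → k = 0) :
    Metric.diam (QInfty p f q a) = 0 := by
  refine le_antisymm (le_of_forall_pos_le_add fun ε hε => ?_) Metric.diam_nonneg
  have hB := c.action_mem a ha
  obtain ⟨T₀, -, h⟩ :=
    lineAverage_osc (c.continuous_comp_κ hq hB) (c.torusPeriodic_comp_κ q hB) hw hε
  rw [zero_add]
  exact c.diam_QInfty_le hp q ha (le_max_right T₀ 1) (h _ (le_max_left _ _))

end ActionAngleChart

section FiberComponents

variable {X Y : Type*} [TopologicalSpace X] [T2Space X] [TopologicalSpace Y]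

theorem exists_isOpen_separation_of_notMem_connectedComponentIn {C : Set X} (hC : IsCompact C)
    {x y : X} (hx : x ∈ C) (hy : y ∈ C) (hxy : y ∉ connectedComponentIn C x) :
    ∃ U V, IsOpen U ∧ IsOpen V ∧ Disjoint U V ∧ C ⊆ U ∪ V ∧ x ∈ U ∧ y ∈ V := by
  have : CompactSpace C := isCompact_iff_compactSpace.1 hC
  obtain ⟨Z, hZ, hxZ, hyZ⟩ : ∃ Z : Set C, IsClopen Z ∧ ⟨x, hx⟩ ∈ Z ∧ ⟨y, hy⟩ ∉ Z := by
    rw [connectedComponentIn_eq_image hx, connectedComponent_eq_iInter_isClopen] at hxy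
    by_contra! hno
    exact hxy ⟨⟨y, hy⟩, mem_iInter.2 fun Z => hno Z.1 Z.2.1 Z.2.2, rfl⟩
  obtain ⟨U, V, hU, hV, hZU, hZV, hUV⟩ := SeparatedNhds.of_isCompact_isCompact
    (hZ.isClosed.isCompact.image continuous_subtype_val)
    (hZ.compl.isClosed.isCompact.image continuous_subtype_val)
    ((disjoint_image_iff Subtype.val_injective).2 disjoint_compl_right)
  refine ⟨U, V, hU, hV, hUV, fun w hw => ?_, hZU ⟨_, hxZ, rfl⟩, hZV ⟨_, hyZ, rfl⟩⟩
  by_cases hwZ : (⟨w, hw⟩ : C) ∈ Z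
  · exact Or.inl (hZU ⟨_, hwZ, rfl⟩)
  · exact Or.inr (hZV ⟨_, hwZ, rfl⟩)

variable [T2Space Y] {K : Set X} {f : X → Y} {s : Y}

omit [T2Space X] in
theorem eventually_inter_preimage_subset (hK : IsCompact K) (hf : Continuous f) {U : Set X}
    (hU : IsOpen U) (hKU : K ∩ f ⁻¹' {s} ⊆ U) : ∀ᶠ a in 𝓝 s, K ∩ f ⁻¹' {a} ⊆ U := by
  have hs : s ∉ f '' (K \ U) := by
    rintro ⟨x, ⟨hx, hxU⟩, hfx⟩
    exact hxU (hKU ⟨hx, hfx⟩)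
  filter_upwards [((hK.diff hU).image hf).isClosed.isOpen_compl.mem_nhds hs] with a ha x hx
  by_contra hxU
  exact ha ⟨x, ⟨hx.1, hxU⟩, hx.2⟩

theorem mem_connectedComponentIn_of_tendsto (hK : IsCompact K) (hf : Continuous f)
    {ι : Type*} {l : Filter ι} [l.NeBot] {a : ι → Y} (ha : Tendsto a l (𝓝 s))
    (hconn : ∀ᶠ i in l, IsPreconnected (K ∩ f ⁻¹' {a i})) {z z' : ι → X} {y y' : X}
    (hz : ∀ᶠ i in l, z i ∈ K ∩ f ⁻¹' {a i}) (hz' : ∀ᶠ i in l, z' i ∈ K ∩ f ⁻¹' {a i})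
    (hy : Tendsto z l (𝓝 y)) (hy' : Tendsto z' l (𝓝 y')) (hys : y ∈ K ∩ f ⁻¹' {s})
    (hys' : y' ∈ K ∩ f ⁻¹' {s}) : y' ∈ connectedComponentIn (K ∩ f ⁻¹' {s}) y := by
  by_contra hnot
  obtain ⟨U, V, hU, hV, hUV, hcover, hyU, hyV⟩ :=
    exists_isOpen_separation_of_notMem_connectedComponentIn
      (hK.inter_right (isClosed_singleton.preimage hf)) hys hys' hnot
  have hsub : ∀ᶠ i in l, K ∩ f ⁻¹' {a i} ⊆ U ∪ V :=
    ha (eventually_inter_preimage_subset hK hf (hU.union hV) hcover)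
  obtain ⟨i, hci, hzi, hzi', hsubi, hziU, hziV⟩ := (hconn.and (hz.and (hz'.and (hsub.and
    ((hy.eventually (hU.mem_nhds hyU)).and (hy'.eventually (hV.mem_nhds hyV))))))).exists
  obtain ⟨x, -, hxU, hxV⟩ := hci U V hU hV hsubi ⟨_, hzi, hziU⟩ ⟨_, hzi', hziV⟩
  exact Set.disjoint_left.1 hUV hxU hxV

end FiberComponents

section Degenerate

variable {M : Type*} [TopologicalSpace M] [ChartedSpace Plane M] [IsManifold 𝓘(ℝ, Plane) ω M]
  {p f q : Cotangent M → ℝ}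

theorem exists_mem_leaf_flowAverage_eq_of_mem_QInfty {a y T : ℝ} (hy : y ∈ QInfty p f q a)
    (hT : 1 ≤ T) : ∃ z ∈ leaf p f a, flowAverage p q T z = y := by
  obtain ⟨z, -, hz⟩ := mem_iUnion₂.1 hy
  obtain ⟨x, hx, hxy⟩ := mem_iInter₂.1 hz T hT
  exact ⟨x, connectedComponentIn_subset _ _ hx, hxy⟩

theorem isBounded_QInfty [T2Space M] (hp : ContMDiff phaseI 𝓘(ℝ, ℝ) 2 p)
    (hcompact : IsCompact (p ⁻¹' {0})) (hq : Continuous q) (a : ℝ) :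
    Bornology.IsBounded (QInfty p f q a) := by
  refine (hcompact.image_of_continuousOn
    (continuousOn_flowAverage hp hcompact hq 1)).isBounded.subset fun y hy => ?_
  obtain ⟨z, hz, hzy⟩ := exists_mem_leaf_flowAverage_eq_of_mem_QInfty hy le_rfl
  exact ⟨z, hz.1, hzy⟩

theorem exists_mem_leaf_tendsto_of_ultrafilter (hcompact : IsCompact (p ⁻¹' {0}))
    (hf : Continuous f) {ι : Type*} {l : Ultrafilter ι} {a : ι → ℝ} {s : ℝ}
    (ha : Tendsto a l (𝓝 s)) {z : ι → Cotangent M} (hz : ∀ i, z i ∈ leaf p f (a i)) :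
    ∃ y ∈ leaf p f s, Tendsto z l (𝓝 y) := by
  obtain ⟨y, hy, hle⟩ := hcompact.ultrafilter_le_nhds (l.map z)
    (le_principal_iff.2 (mem_map.2 (Eventually.of_forall fun i => (hz i).1)))
  refine ⟨y, ⟨hy, tendsto_nhds_unique ((hf.tendsto y).comp hle) ?_⟩, hle⟩
  exact ha.congr fun i => (hz i).2.symm

theorem mem_QInfty_of_mem_closure [T2Space M] (hp : ContMDiff phaseI 𝓘(ℝ, ℝ) 2 p)
    (hcompact : IsCompact (p ⁻¹' {0})) (hf : Continuous f) (hq : Continuous q) {g : ℝ → ℝ} {s : ℝ}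
    {D : Set ℝ} (hs : s ∈ closure D) (hg : ContinuousWithinAt g D s)
    (hconn : ∀ a ∈ D, IsPreconnected (leaf p f a)) (hmem : ∀ a ∈ D, g a ∈ QInfty p f q a) :
    g s ∈ QInfty p f q s := by
  have hne : (comap ((↑) : D → ℝ) (𝓝 s)).NeBot := mem_closure_iff_comap_neBot.1 hs
  set l : Ultrafilter D := Ultrafilter.of (comap (↑) (𝓝 s))
  have hls : Tendsto ((↑) : D → ℝ) l (𝓝 s) := tendsto_comap.mono_left (Ultrafilter.of_le _)
  have hlg : Tendsto (fun a : D => g a) l (𝓝 (g s)) :=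
    hg.tendsto.comp (tendsto_nhdsWithin_iff.2 ⟨hls, Eventually.of_forall Subtype.prop⟩)
  choose ζ hζ hζg using fun (T : Ici (1 : ℝ)) (a : D) =>
    exists_mem_leaf_flowAverage_eq_of_mem_QInfty (hmem a a.2) T.2
  choose y hys hy using fun T => exists_mem_leaf_tendsto_of_ultrafilter hcompact hf hls (hζ T)
  have hval : ∀ T : Ici (1 : ℝ), flowAverage p q T (y T) = g s := fun T => by
    have hlim : Tendsto (fun a => flowAverage p q T (ζ T a)) l (𝓝 (flowAverage p q T (y T))) :=
      ((continuousOn_flowAverage hp hcompact hq T) _ (hys T).1).tendsto.comp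
        (tendsto_nhdsWithin_iff.2 ⟨hy T, Eventually.of_forall fun a => (hζ T a).1⟩)
    exact tendsto_nhds_unique hlim (hlg.congr fun a => (hζg T a).symm)
  refine mem_iUnion₂.2 ⟨y ⟨1, self_mem_Ici⟩, hys _, mem_iInter₂.2 fun T hT =>
    ⟨y ⟨T, hT⟩, ?_, hval ⟨T, hT⟩⟩⟩
  exact mem_connectedComponentIn_of_tendsto hcompact hf hls
    (Eventually.of_forall fun a => hconn a a.2) (Eventually.of_forall (hζ _))
    (Eventually.of_forall (hζ _)) (hy _) (hy _) (hys _) (hys _)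

end Degenerate

/-! ### The lower bound for the distance -/

theorem inv_pow_le_of_diophantine {n : ℕ} (hn : 0 < n) {P α e : ℝ} (hα : 0 < α) {N : ℕ}
    (hN : 2 * P ≤ N) (h : α / (n : ℝ) ^ P ≤ e) : ((n : ℝ)⁻¹) ^ N ≤ (e / α) ^ 2 := by
  have hn_one : (1 : ℝ) ≤ n := Nat.one_le_cast.2 hn
  have hn_pos : (0 : ℝ) < n := Nat.cast_pos.2 hn
  calc ((n : ℝ)⁻¹) ^ N = ((n : ℝ) ^ (N : ℝ))⁻¹ := by rw [Real.rpow_natCast, inv_pow]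
    _ ≤ ((n : ℝ) ^ (2 * P))⁻¹ :=
        inv_anti₀ (Real.rpow_pos_of_pos hn_pos _) (Real.rpow_le_rpow_of_exponent_le hn_one hN)
    _ = (((n : ℝ) ^ P)⁻¹) ^ 2 := by
        rw [mul_comm, Real.rpow_mul hn_pos.le, inv_pow]
        norm_cast
    _ ≤ (e / α) ^ 2 := by
        gcongr
        rwa [le_div_iff₀ hα, inv_mul_eq_div]

namespace ActionAngleChart

variable {M : Type*} [TopologicalSpace M] [ChartedSpace Plane M] [IsManifold 𝓘(ℝ, Plane) ω M]
  {p f q : Cotangent M → ℝ} {a₀ a : ℝ} (c : ActionAngleChart p f a₀)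

theorem frequency_of_rotationNumber_eq_coe {u : ℝ} (h : c.rotationNumber a = (u : OnePoint ℝ)) :
    c.frequency 0 a ≠ 0 ∧ c.frequency 1 a = u * c.frequency 0 a := by
  have hne : c.frequency 0 a ≠ 0 := fun h0 =>
    OnePoint.infty_ne_coe _ ((projRatio_eq_infty_iff.2 h0).symm.trans h)
  exact ⟨hne, sub_eq_zero.1 ((projRatio_eq_coe_iff (Or.inr hne)).1 h)⟩

theorem nonresonant_of_irrational {u : ℝ} (h : c.rotationNumber a = (u : OnePoint ℝ))
    (hu : Irrational u) (k : Fin 2 → ℤ) (hk : ∑ i, k i * c.frequencyVector a i = 0) : k = 0 := by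
  obtain ⟨hne, hfreq⟩ := c.frequency_of_rotationNumber_eq_coe h
  simp only [Fin.sum_univ_two, frequencyVector, hfreq] at hk
  have hlin : (k 0 : ℝ) + k 1 * u = 0 :=
    (mul_eq_zero.1 (by linarith : ((k 0 : ℝ) + k 1 * u) * c.frequency 0 a = 0)).resolve_right hne
  have hk_one : k 1 = 0 := by
    by_contra hk_ne
    have hk_ne' : (k 1 : ℝ) ≠ 0 := Int.cast_ne_zero.2 hk_ne
    refine hu ⟨-(k 0 : ℚ) / (k 1 : ℚ), ?_⟩
    push_cast
    rw [div_eq_iff hk_ne']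
    linarith
  have hk_zero : k 0 = 0 := by simpa [hk_one] using hlin
  funext i
  fin_cases i
  exacts [hk_zero, hk_one]

variable [T2Space M] (hp : ContMDiff phaseI 𝓘(ℝ, ℝ) 2 p)
include hp

theorem diam_QInfty_le_of_rational (hq : ContMDiff phaseI 𝓘(ℝ, ℝ) ω q)
    (ha : a ∈ c.V ∩ leafParams p f) {r : ℚ} (hr : c.rotationNumber a = ((r : ℝ) : OnePoint ℝ))
    {N : ℕ} {C : ℝ} (hC : ∀ (x : Fin 2 → ℝ) (s : ℝ), |iteratedDeriv (N + 1)
      (fun s : ℝ => q (c.κ (x + s • Pi.single 1 1, c.action a))) s| ≤ C) :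
    Metric.diam (QInfty p f q a) ≤ (2 * Real.pi / r.den) ^ (N + 1) * C := by
  have hB := c.action_mem a ha
  obtain ⟨hne, hfreq⟩ := c.frequency_of_rotationNumber_eq_coe hr
  obtain ⟨T, hT, hosc⟩ := exists_lineAverage_osc_le_of_rational (w := c.frequencyVector a) hne hfreq
    (c.continuous_comp_κ hq.continuous hB) (c.torusPeriodic_comp_κ q hB)
    (fun x => c.contDiff_comp_κ_line hq hB (N + 1) x _) hC
  exact c.diam_QInfty_le hp q ha hT hosc

-- The oscillation is of order `n⁻ᴺ` on the torus with rotation number `m / n`, whereas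
-- `|v - m / n| ≥ α / n ^ P`; smoothness of order `N > 2 P` gives the square.
theorem diam_QInfty_le_sq_of_mem_diophantineNumbers (hq : ContMDiff phaseI 𝓘(ℝ, ℝ) ω q)
    (ha : a ∈ c.V ∩ leafParams p f) {u v P α : ℝ} (hα : 0 < α)
    (hu : c.rotationNumber a = (u : OnePoint ℝ)) (hv : v ∈ diophantineNumbers P α) {N : ℕ}
    (hN : 2 * P ≤ N) {C : ℝ} (hC : ∀ (x : Fin 2 → ℝ) (s : ℝ), |iteratedDeriv (N + 1)
      (fun s : ℝ => q (c.κ (x + s • Pi.single 1 1, c.action a))) s| ≤ C) :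
    Metric.diam (QInfty p f q a) ≤ (2 * Real.pi) ^ (N + 1) * C / α ^ 2 * |u - v| ^ 2 := by
  have hC_nonneg : 0 ≤ C := (abs_nonneg _).trans (hC 0 0)
  by_cases hirr : Irrational u
  · rw [c.diam_QInfty_eq_zero_of_nonresonant hp hq.continuous ha
      (c.nonresonant_of_irrational hu hirr)]
    positivity
  obtain ⟨r, rfl⟩ := not_not.1 hirr
  have hdioph : α / (r.den : ℝ) ^ P ≤ |(r : ℝ) - v| := by
    have h := hv r.num r.den r.den_pos
    rwa [← Rat.cast_def, abs_sub_comm] at h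
  calc Metric.diam (QInfty p f q a) ≤ (2 * Real.pi / r.den) ^ (N + 1) * C :=
        c.diam_QInfty_le_of_rational hp hq ha hu hC
    _ = (2 * Real.pi) ^ (N + 1) * C * ((r.den : ℝ)⁻¹) ^ (N + 1) := by
        rw [div_eq_mul_inv, mul_pow]
        ring
    _ ≤ (2 * Real.pi) ^ (N + 1) * C * (|(r : ℝ) - v| / α) ^ 2 := by
        gcongr
        exact inv_pow_le_of_diophantine r.den_pos hα (by push_cast; linarith) hdioph
    _ = (2 * Real.pi) ^ (N + 1) * C / α ^ 2 * |(r : ℝ) - v| ^ 2 := by ring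

theorem exists_eventually_diam_QInfty_le_sq {F : Set (Cotangent M → ℝ)}
    (hF_an : ∀ q ∈ F, ContMDiff phaseI 𝓘(ℝ, ℝ) ω q) (hF_unif : UniformlyAnalyticOn F (p ⁻¹' {0}))
    (ha₀ : a₀ ∈ leafParams p f) (P : ℝ) {α : ℝ} (hα : 0 < α) :
    ∃ C : ℝ, ∀ᶠ a in 𝓝[leafParams p f] a₀, ∀ u : ℝ, c.rotationNumber a = (u : OnePoint ℝ) →
      ∀ v ∈ diophantineNumbers P α, ∀ q ∈ F, Metric.diam (QInfty p f q a) ≤ C * |u - v| ^ 2 := by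
  obtain ⟨N, hN⟩ := exists_nat_ge (2 * P)
  have haV : a₀ ∈ c.V ∩ leafParams p f := ⟨mem_of_mem_nhds c.V_mem, ha₀⟩
  have htorus : ∀ x, c.κ (x, c.action a₀) ∈ p ⁻¹' {0} := fun x =>
    ((c.leaf_eq a₀ haV).ge (mem_range_self x)).1
  have haction : Tendsto c.action (𝓝[leafParams p f] a₀) (𝓝 (c.action a₀)) := by
    have h := (c.analytic_action a₀ haV).continuousWithinAt
    rwa [inter_comm, ContinuousWithinAt,
      nhdsWithin_inter_of_mem' (nhdsWithin_le_nhds c.V_mem)] at h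
  obtain ⟨C, hC⟩ := c.exists_abs_iteratedDeriv_comp_κ_le hF_unif hF_an (c.action_mem a₀ haV) htorus
    (v := Pi.single 1 1) (by rw [Pi.norm_single, norm_one]) (N + 1)
  refine ⟨(2 * Real.pi) ^ (N + 1) * C / α ^ 2, ?_⟩
  filter_upwards [haction hC, nhdsWithin_le_nhds c.V_mem, self_mem_nhdsWithin]
    with a hbound haV haJ u hu v hv q hq
  exact c.diam_QInfty_le_sq_of_mem_diophantineNumbers hp (hF_an q hq) ⟨haV, haJ⟩ hα hu hv hN
    (hbound q hq)

end ActionAngleChart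

section Expansion

theorem eventually_mul_sq_sub_le {G U : ℝ → ℝ} {G' U' a : ℝ} (hG : HasStrictDerivAt G G' a)
    (hG' : G' ≠ 0) (hU : HasStrictDerivAt U U' a) (C : ℝ) :
    ∀ᶠ x in 𝓝 (a, a), C * |U x.1 - U x.2| ^ 2 ≤ |G x.1 - G x.2| / 2 := by
  have hsmall : (fun x : ℝ × ℝ => U x.1 - U x.2) =o[𝓝 (a, a)] fun _ => (1 : ℝ) := by
    refine (Asymptotics.isLittleO_one_iff ℝ).2 ?_
    have hcont := hU.hasDerivAt.continuousAt.tendsto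
    simpa only [sub_self, nhds_prod_eq, Function.comp_apply] using
      (hcont.comp tendsto_fst).sub (hcont.comp (tendsto_snd (f := 𝓝 a)))
  have hUG : (fun x : ℝ × ℝ => U x.1 - U x.2) =O[𝓝 (a, a)] fun x => G x.1 - G x.2 :=
    hU.isBigO_sub.trans (hG.isTheta_sub hG').isBigO_symm
  have hlittle := (hsmall.mul_isBigO hUG).const_mul_left C
  filter_upwards [hlittle.def one_half_pos] with x hx
  rw [one_mul, Real.norm_eq_abs, Real.norm_eq_abs, ← sq] at hx
  rw [sq_abs]
  linarith [le_abs_self (C * (U x.1 - U x.2) ^ 2)]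

theorem eventually_mem_or_abs_sub_le {T : Set ℝ} (hT : T.OrdConnected) {y₀ : ℝ} (hy₀ : y₀ ∈ T) :
    ∀ᶠ y in 𝓝 y₀, y ∈ T ∨ ∀ t ∈ T, |t - y₀| ≤ |t - y| := by
  have hright : ∀ᶠ y in 𝓝 y₀, y₀ ≤ y → y ∈ T ∨ ∀ t ∈ T, t ≤ y₀ := by
    by_cases h : ∀ t ∈ T, t ≤ y₀
    · exact Eventually.of_forall fun y _ => Or.inr h
    push Not at h
    obtain ⟨t, ht, hty⟩ := h
    filter_upwards [gt_mem_nhds hty] with y hyt hy using Or.inl (hT.out hy₀ ht ⟨hy, hyt.le⟩)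
  have hleft : ∀ᶠ y in 𝓝 y₀, y ≤ y₀ → y ∈ T ∨ ∀ t ∈ T, y₀ ≤ t := by
    by_cases h : ∀ t ∈ T, y₀ ≤ t
    · exact Eventually.of_forall fun y _ => Or.inr h
    push Not at h
    obtain ⟨t, ht, hty⟩ := h
    filter_upwards [lt_mem_nhds hty] with y hyt hy using Or.inl (hT.out ht hy₀ ⟨hyt.le, hy⟩)
  filter_upwards [hright, hleft] with y hr hl
  rcases le_total y₀ y with hy | hy
  · refine (hr hy).imp_right fun h t ht => ?_
    rw [abs_of_nonpos (by linarith [h t ht]), abs_of_nonpos (by linarith [h t ht])]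
    linarith
  · refine (hl hy).imp_right fun h t ht => ?_
    rw [abs_of_nonneg (by linarith [h t ht]), abs_of_nonneg (by linarith [h t ht])]
    linarith

variable {ι : Type*} {F : Set ι} {D : ι → ℝ → ℝ} {J K R : Set ℝ} {g : ℝ → ℝ}

theorem eventually_le_half_abs_sub (hJ : J.OrdConnected) (hg : ContinuousOn g J)
    (hR : ∀ a ∈ J, g a ∈ K → a ∈ R) {a₀ : ℝ} (ha₀ : a₀ ∈ J) (hK : g a₀ ∈ K)
    (hD : ∀ᶠ x in 𝓝[J] a₀ ×ˢ 𝓝[J] a₀, x.2 ∈ R → ∀ i ∈ F, D i x.1 ≤ |g x.1 - g x.2| / 2) :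
    ∀ᶠ x in 𝓝[J ×ˢ K] (a₀, g a₀), ∀ i ∈ F, D i x.1 ≤ |g x.1 - x.2| / 2 := by
  obtain ⟨V, hV, hVD⟩ := eventually_prod_self_iff'.1 hD
  obtain ⟨ε, hε, hεV⟩ := Metric.mem_nhdsWithin_iff.1 hV
  set I := J ∩ Metric.ball a₀ ε with hI
  have hIV : I ⊆ V := fun a ha => hεV ⟨ha.2, ha.1⟩
  have haI : a₀ ∈ I := ⟨ha₀, Metric.mem_ball_self hε⟩
  have hI_conn : I.OrdConnected := by
    rw [hI, Real.ball_eq_Ioo]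
    exact hJ.inter ordConnected_Ioo
  have himage : (g '' I).OrdConnected :=
    (hI_conn.isPreconnected.image g (hg.mono inter_subset_left)).ordConnected
  have hnear : ∀ᶠ x in 𝓝[J ×ˢ K] (a₀, g a₀), x.1 ∈ Metric.ball a₀ ε :=
    nhdsWithin_le_nhds (continuousAt_fst.eventually (Metric.ball_mem_nhds a₀ hε))
  filter_upwards [self_mem_nhdsWithin, hnear, nhdsWithin_le_nhds (continuousAt_snd.eventually
    (eventually_mem_or_abs_sub_le himage (mem_image_of_mem g haI)))]
    with ⟨a, y⟩ ⟨ha, hy⟩ haε hval i hi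
  have haI' : a ∈ I := ⟨ha, haε⟩
  rcases hval with ⟨b, hb, rfl⟩ | hval
  · exact hVD a (hIV haI') b (hIV hb) (hR b hb.1 hy) i hi
  · exact (hVD a (hIV haI') a₀ (hIV haI) (hR a₀ ha₀ hK) i hi).trans
      (div_le_div_of_nonneg_right (hval _ (mem_image_of_mem g haI')) two_pos.le)

theorem exists_pos_forall_of_isCompact {X : Type*} [TopologicalSpace X] {s : Set X}
    (hs : IsCompact s) {P : ℝ → X → Prop} (hP : ∀ x, ∀ σ σ', σ' ≤ σ → P σ x → P σ' x)
    (hloc : ∀ x ∈ s, ∃ σ > 0, ∀ᶠ y in 𝓝[s] x, P σ y) : ∃ σ > 0, ∀ x ∈ s, P σ x := by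
  refine hs.induction_on (p := fun A => ∃ σ > 0, ∀ x ∈ A, P σ x) ⟨1, one_pos, by simp⟩ ?_ ?_ ?_
  · rintro A B hAB ⟨σ, hσ, h⟩
    exact ⟨σ, hσ, fun x hx => h x (hAB hx)⟩
  · rintro A B ⟨σ, hσ, h⟩ ⟨σ', hσ', h'⟩
    refine ⟨min σ σ', lt_min hσ hσ', fun x hx => hx.elim (fun hx => ?_) fun hx => ?_⟩
    · exact hP x σ _ (min_le_left _ _) (h x hx)
    · exact hP x σ' _ (min_le_right _ _) (h' x hx)
  · intro x hx
    obtain ⟨σ, hσ, h⟩ := hloc x hx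
    exact ⟨_, h, σ, hσ, fun y hy => hy⟩

theorem exists_le_half_abs_sub_of_le (hJ : IsCompact J) (hJo : J.OrdConnected)
    (hg : ContinuousOn g J) (hK : IsCompact K) (hR : ∀ a ∈ J, g a ∈ K → a ∈ R)
    (hD : ∀ a ∈ J, g a ∈ K →
      ∀ᶠ x in 𝓝[J] a ×ˢ 𝓝[J] a, x.2 ∈ R → ∀ i ∈ F, D i x.1 ≤ |g x.1 - g x.2| / 2) :
    ∃ σ > 0, ∀ x ∈ J ×ˢ K, ∀ i ∈ F, D i x.1 ≤ σ → D i x.1 ≤ |g x.1 - x.2| / 2 := by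
  refine exists_pos_forall_of_isCompact (hJ.prod hK)
    (fun x σ σ' hσ h i hi hD => h i hi (hD.trans hσ)) ?_
  rintro ⟨a, y⟩ ⟨ha, hy⟩
  by_cases hay : g a = y
  · subst hay
    refine ⟨1, one_pos, (eventually_le_half_abs_sub hJo hg hR ha hy (hD a ha hy)).mono ?_⟩
    exact fun x hx i hi _ => hx i hi
  · have hpos : 0 < |g a - y| := abs_pos.2 (sub_ne_zero.2 hay)
    have hcont : ContinuousWithinAt (fun x : ℝ × ℝ => |g x.1 - x.2|) (J ×ˢ K) (a, y) :=
      (((hg a ha).comp (f := Prod.fst) continuousWithinAt_fst fun x hx => hx.1).sub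
        continuousWithinAt_snd).abs
    refine ⟨|g a - y| / 4, by positivity, ?_⟩
    filter_upwards [hcont.eventually (lt_mem_nhds (half_lt_self hpos))] with x hx i _ hσ
    linarith

theorem exists_pos_le_of_half_abs_sub_le (hJ : IsCompact J) (hg : ContinuousOn g J) {y : ℝ}
    {W : Set ℝ} (hW : W ∈ 𝓝ˢ {a | a ∈ J ∧ g a = y}) {E : ℝ → ℝ}
    (hE : ∀ a ∈ J, |g a - y| / 2 ≤ E a) : ∃ C > 0, ∀ a ∈ J \ W, 1 / C ≤ E a := by
  have hfiber : {a | a ∈ J ∧ g a = y} ⊆ interior W := subset_interior_iff_mem_nhdsSet.2 hW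
  obtain ⟨m, hm, hle⟩ := (hJ.diff isOpen_interior).exists_forall_le'
    (f := fun a => |g a - y|) (a := 0)
    (((hg.mono sdiff_subset).sub continuousOn_const).abs)
    fun a ha => abs_pos.2 (sub_ne_zero.2 fun h => ha.2 (hfiber ⟨ha.1, h⟩))
  refine ⟨2 / m, by positivity, fun a ha => ?_⟩
  rw [one_div_div]
  have hma := hle a ⟨ha.1, fun h => ha.2 (interior_subset h)⟩
  linarith [hE a ha.1]

end Expansion

theorem half_dist_le_infDist_of_diam_le {X : Type*} [PseudoMetricSpace X] {s : Set X} {x y : X}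
    (hs : Bornology.IsBounded s) (hx : x ∈ s) (h : Metric.diam s ≤ dist x y / 2) :
    dist x y / 2 ≤ Metric.infDist y s := by
  refine (Metric.le_infDist ⟨x, hx⟩).2 fun z hz => ?_
  linarith [Metric.dist_le_diam_of_mem hs hx hz, dist_triangle_right x y z]

theorem subset_closure_diff_of_countable {J S : Set ℝ} (hJ : J.OrdConnected)
    (hJi : (interior J).Nonempty) (hS : S.Countable) : J ⊆ closure (J \ S) :=
  calc J ⊆ closure (interior J) := subset_closure.trans
        ((hJ.convex (𝕜 := ℝ)).closure_interior_eq_closure_of_nonempty_interior hJi).ge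
    _ ⊆ closure (interior J ∩ Sᶜ) :=
        closure_minimal ((hS.dense_compl ℝ).open_subset_closure_inter isOpen_interior)
          isClosed_closure
    _ ⊆ closure (J \ S) := closure_mono (inter_subset_inter_left _ interior_subset)

theorem mem_diophantineNumbers_of_mem_regularParams {J S : Set ℝ} {rot : ℝ → OnePoint ℝ}
    {g : ℝ → ℝ} {α d b u : ℝ} (hb : b ∈ regularParams J S rot g α d)
    (hu : rot b = (u : OnePoint ℝ)) : u ∈ diophantineNumbers (2 + d) α := fun m n hn => by
  have h := hb.1.2.2.2.2 m n hn
  rwa [hu, finitePart_coe] at h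

section LowerBound

variable {M : Type*} [TopologicalSpace M] [ChartedSpace Plane M]
  [IsManifold 𝓘(ℝ, Plane) ω M] {p f : Cotangent M → ℝ} {S : Set ℝ} {g : ℝ → ℝ}

theorem ActionAngleChart.self_mem {a : ℝ} (c : ActionAngleChart p f a) (ha : a ∈ leafParams p f) :
    a ∈ c.V ∩ leafParams p f :=
  ⟨mem_of_mem_nhds c.V_mem, ha⟩

variable [T2Space M]

theorem eventually_diam_QInfty_le_half (hp : ContMDiff phaseI 𝓘(ℝ, ℝ) 2 p) (hS : IsClosed S)
    {rot : ℝ → OnePoint ℝ} (hrot_an : ProjAnalyticOn rot (leafParams p f \ S))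
    (hrot_nc : NonconstantOnComponents rot (leafParams p f \ S))
    (hg_an : AnalyticOn ℝ g (leafParams p f \ S))
    (hg_nc : NonconstantOnComponents g (leafParams p f \ S))
    (hJu : UniqueDiffOn ℝ (leafParams p f)) {F : Set (Cotangent M → ℝ)}
    (hF_an : ∀ q ∈ F, ContMDiff phaseI 𝓘(ℝ, ℝ) ω q) (hF_unif : UniformlyAnalyticOn F (p ⁻¹' {0}))
    {α d a : ℝ} (hα : 0 < α) (ha : a ∈ regularParams (leafParams p f) S rot g α d)
    (c : ActionAngleChart p f a)
    (hrot : ∀ᶠ b in 𝓝[leafParams p f \ S] a, rot b = c.rotationNumber b) :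
    ∀ᶠ x in 𝓝[leafParams p f] a ×ˢ 𝓝[leafParams p f] a,
      x.2 ∈ regularParams (leafParams p f) S rot g α d →
        ∀ q ∈ F, Metric.diam (QInfty p f q x.1) ≤ |g x.1 - g x.2| / 2 := by
  have haJS : a ∈ leafParams p f \ S := ha.2.1
  rw [nhdsWithin_sdiff_of_isClosed hS haJS.2] at hrot
  obtain ⟨G, U, hG, hU, hev, -⟩ :=
    exists_analyticAt_extensions hrot_an hrot_nc hg_an hg_nc hS haJS ha.1.2.2.1
  have hG' : deriv G a ≠ 0 := abs_pos.1 (hα.trans_le ((mem_regularParams_iff_of_eventuallyEq hJu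
    haJS.1 hev hG.differentiableAt hU.differentiableAt).1 ha).2.2.1)
  obtain ⟨C, hC⟩ :=
    c.exists_eventually_diam_QInfty_le_sq hp hF_an hF_unif haJS.1 (2 + d) hα
  have hsq := eventually_mul_sq_sub_le hG.hasStrictDerivAt hG' hU.hasStrictDerivAt C
  rw [nhds_prod_eq] at hsq
  filter_upwards [(hev.and (hrot.and hC)).prod_mk hev,
    Filter.prod_mono nhdsWithin_le_nhds nhdsWithin_le_nhds hsq]
    with x ⟨⟨⟨_, hgx, hUx⟩, hrotx, hCx⟩, _, hgy, hUy⟩ hsqx hreg q hq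
  rw [hgx, hgy]
  exact (hCx _ (hrotx.symm.trans hUx) _
    (mem_diophantineNumbers_of_mem_regularParams hreg hUy) q hq).trans hsqx

theorem apply_mem_QInfty (hp : ContMDiff phaseI 𝓘(ℝ, ℝ) 2 p) (hcompact : IsCompact (p ⁻¹' {0}))
    (hf : Continuous f) (hJS : leafParams p f ⊆ closure (leafParams p f \ S))
    (chart : ∀ a ∈ leafParams p f \ S, ActionAngleChart p f a)
    (hg : ContinuousOn g (leafParams p f)) {q : Cotangent M → ℝ} (hq : Continuous q)
    (havg : ∀ (a : ℝ) (ha : a ∈ leafParams p f \ S), (chart a ha).torusAverage q a = g a)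
    {a : ℝ} (ha : a ∈ leafParams p f) : g a ∈ QInfty p f q a := by
  refine mem_QInfty_of_mem_closure hp hcompact hf hq (hJS ha) ((hg a ha).mono sdiff_subset)
    (fun b hb => (chart b hb).isPreconnected_leaf ((chart b hb).self_mem hb.1)) fun b hb => ?_
  rw [← havg b hb]
  exact (chart b hb).torusAverage_mem_QInfty hp hq ((chart b hb).self_mem hb.1)

theorem exists_pos_half_abs_sub_le_infDist_QInfty (hp : ContMDiff phaseI 𝓘(ℝ, ℝ) 2 p)
    (hcompact : IsCompact (p ⁻¹' {0})) (hJo : (leafParams p f).OrdConnected)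
    (hf : Continuous f) (hS : IsClosed S) (hSc : S.Countable)
    (chart : ∀ a ∈ leafParams p f \ S, ActionAngleChart p f a) {rot : ℝ → OnePoint ℝ}
    (hrot : ∀ (a : ℝ) (ha : a ∈ leafParams p f \ S),
      ∀ᶠ b in 𝓝[leafParams p f \ S] a, rot b = (chart a ha).rotationNumber b)
    (hrot_an : ProjAnalyticOn rot (leafParams p f \ S))
    (hrot_nc : NonconstantOnComponents rot (leafParams p f \ S))
    (hg_an : AnalyticOn ℝ g (leafParams p f \ S)) (hg_cont : ContinuousOn g (leafParams p f))
    (hg_nc : NonconstantOnComponents g (leafParams p f \ S)) {F : Set (Cotangent M → ℝ)}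
    (hF_an : ∀ q ∈ F, ContMDiff phaseI 𝓘(ℝ, ℝ) ω q) (hF_unif : UniformlyAnalyticOn F (p ⁻¹' {0}))
    (hF_avg : ∀ q ∈ F, ∀ (a : ℝ) (ha : a ∈ leafParams p f \ S),
      (chart a ha).torusAverage q a = g a)
    {α d : ℝ} (hα : 0 < α) {K : Set ℝ} (hKG : K ⊆ goodValues (leafParams p f) S rot g α d)
    (hK : IsCompact K) :
    ∃ σ > 0, ∀ q ∈ F, (∀ a ∈ leafParams p f, Metric.diam (QInfty p f q a) ≤ σ) →
      ∀ y ∈ K, ∀ a ∈ leafParams p f, |g a - y| / 2 ≤ Metric.infDist y (QInfty p f q a) := by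
  have hreg : ∀ a ∈ leafParams p f, g a ∈ K →
      a ∈ regularParams (leafParams p f) S rot g α d := fun a ha hga =>
    mem_regularParams_of_mem_goodValues (hKG hga) ha rfl
  obtain ⟨σ, hσ, hdiam⟩ := exists_le_half_abs_sub_of_le
    (D := fun q a => Metric.diam (QInfty p f q a)) (F := F) (hcompact.image hf) hJo hg_cont hK hreg
    fun a ha hga => have haJS := (hreg a ha hga).2.1
      eventually_diam_QInfty_le_half hp hS hrot_an hrot_nc hg_an hg_nc
        (uniqueDiffOn_of_nonconstantOnComponents hJo hg_nc ⟨a, haJS⟩) hF_an hF_unif hα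
        (hreg a ha hga) (chart a haJS) (hrot a haJS)
  refine ⟨σ, hσ, fun q hq hqσ y hy a ha => ?_⟩
  obtain ⟨b, hb, hby⟩ := (hKG hy).1
  have hbJS : b ∈ leafParams p f \ S := (hreg b hb (hby ▸ hy)).2.1
  have hJS := subset_closure_diff_of_countable hJo
    (interior_nonempty_of_nonconstantOnComponents hJo hg_nc ⟨b, hbJS⟩) hSc
  have hqc := (hF_an q hq).continuous
  exact half_dist_le_infDist_of_diam_le (isBounded_QInfty hp hcompact hqc a)
    (apply_mem_QInfty hp hcompact hf hJS chart hg_cont hqc (hF_avg q hq) ha)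
    (hdiam (a, y) ⟨ha, hy⟩ q hq (hqσ a ha))

end LowerBound

theorem theorem7p2_general
    {M : Type*} [TopologicalSpace M] [T2Space M] [ChartedSpace Plane M]
    [IsManifold 𝓘(ℝ, Plane) ω M]
    (p f : Cotangent M → ℝ)
    (hp : ContMDiff phaseI 𝓘(ℝ, ℝ) 2 p) (hf : Continuous f)
    (hcompact : IsCompact (p ⁻¹' {0})) (hconn : IsPreconnected (p ⁻¹' {0}))
    (S : Set ℝ) (hS : IsClosed S) (hSc : S.Countable)
    (chart : ∀ a ∈ leafParams p f \ S, ActionAngleChart p f a)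
    (rot : ℝ → OnePoint ℝ)
    (hrot : ∀ (a : ℝ) (ha : a ∈ leafParams p f \ S),
      ∀ᶠ a' in 𝓝[leafParams p f \ S] a, rot a' = (chart a ha).rotationNumber a')
    (hrot_an : ProjAnalyticOn rot (leafParams p f \ S))
    (hrot_nc : NonconstantOnComponents rot (leafParams p f \ S))
    (g : ℝ → ℝ) (hg_an : AnalyticOn ℝ g (leafParams p f \ S))
    (hg_cont : ContinuousOn g (leafParams p f))
    (hg_nc : NonconstantOnComponents g (leafParams p f \ S))
    (F : Set (Cotangent M → ℝ))
    (hF_an : ∀ q ∈ F, ContMDiff phaseI 𝓘(ℝ, ℝ) ω q)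
    (hF_unif : UniformlyAnalyticOn F (p ⁻¹' {0}))
    (hF_avg : ∀ q ∈ F, ∀ (a : ℝ) (ha : a ∈ leafParams p f \ S),
      (chart a ha).torusAverage q a = g a)
    (d : ℝ) (hd : 0 < d) :
    Tendsto (fun α : ℝ => volume ((g '' leafParams p f) \
        goodValues (leafParams p f) S rot g α d)) (𝓝[>] 0) (𝓝 0) ∧
    (∀ α > 0, ∀ F₀ ∈ goodValues (leafParams p f) S rot g α d,
      {a | a ∈ leafParams p f ∧ g a = F₀}.Finite) ∧
    (∀ q ∈ F, ∀ a ∈ leafParams p f \ S, ∃ l : Cotangent M → ℝ,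
      (∀ z ∈ leaf p f a, Tendsto (fun T => flowAverage p q T z) atTop (𝓝 (l z))) ∧
      QInfty p f q a = l '' leaf p f a) ∧
    (∀ α > 0, ∀ K ⊆ goodValues (leafParams p f) S rot g α d, IsCompact K →
      ∃ σ > 0, ∀ q ∈ F, (∀ a ∈ leafParams p f, Metric.diam (QInfty p f q a) ≤ σ) →
        ∀ F₀ ∈ K, ∀ W ∈ 𝓝ˢ {a | a ∈ leafParams p f ∧ g a = F₀},
          ∃ C > 0, ∀ a ∈ leafParams p f \ W, 1 / C ≤ Metric.infDist F₀ (QInfty p f q a)) := by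
  have hJ : IsCompact (leafParams p f) := hcompact.image hf
  have hJo : (leafParams p f).OrdConnected := (hconn.image f hf.continuousOn).ordConnected
  refine ⟨tendsto_volume_diff_goodValues hJ hJo hrot_an hrot_nc hg_cont hg_an hg_nc hS hSc hd,
    fun α hα F₀ hF₀ => finite_fiber_of_mem_goodValues hJ hg_cont hα hF₀,
    fun q hq a ha => (chart a ha).exists_tendsto_flowAverage_and_QInfty_eq hp
      (hF_an q hq).continuous ((chart a ha).self_mem ha.1),
    fun α hα K hKG hK => ?_⟩
  obtain ⟨σ, hσ, hdist⟩ := exists_pos_half_abs_sub_le_infDist_QInfty hp hcompact hJo hf hS hSc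
    chart hrot hrot_an hrot_nc hg_an hg_cont hg_nc hF_an hF_unif hF_avg hα hKG hK
  exact ⟨σ, hσ, fun q hq hqσ F₀ hF₀ W hW =>
    exists_pos_le_of_half_abs_sub_le hJ hg_cont hW (hdist q hq hqσ F₀ hF₀)⟩

theorem theorem7p2
    {M : Type*} [TopologicalSpace M] [T2Space M] [ChartedSpace Plane M]
    [IsManifold 𝓘(ℝ, Plane) ω M]
    -- the energy surface `p⁻¹(0)` and the first integral `f`
    (p f : Cotangent M → ℝ)
    (hp : ContMDiff phaseI 𝓘(ℝ, ℝ) ω p) (hf : ContMDiff phaseI 𝓘(ℝ, ℝ) ω f)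
    (hcompact : IsCompact (p ⁻¹' {0})) (hconn : IsConnected (p ⁻¹' {0}))
    (hdp : ∀ z, p z = 0 → differential p z ≠ 0)
    (hpf : ∀ z, differential f z (hamiltonField p z) = 0)
    -- the leaves are tori, with action-angle coordinates, away from a finite set
    (S : Set ℝ) (hSfin : S.Finite) (hSJ : S ⊆ leafParams p f)
    (chart : ∀ a ∈ leafParams p f \ S, ActionAngleChart p f a)
    -- the rotation number
    (rot : ℝ → OnePoint ℝ)
    (hrot : ∀ (a : ℝ) (ha : a ∈ leafParams p f \ S),
      ∀ᶠ a' in 𝓝[leafParams p f \ S] a, rot a' = (chart a ha).rotationNumber a')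
    (hrot_an : ProjAnalyticOn rot (leafParams p f \ S))
    (hrot_nc : NonconstantOnComponents rot (leafParams p f \ S))
    -- the torus average, common to the members of a uniformly analytic family of functions
    (g : ℝ → ℝ) (hg_an : AnalyticOn ℝ g (leafParams p f \ S))
    (hg_cont : ContinuousOn g (leafParams p f))
    (hg_nc : NonconstantOnComponents g (leafParams p f \ S))
    (F : Set (Cotangent M → ℝ))
    (hF_an : ∀ q ∈ F, ContMDiff phaseI 𝓘(ℝ, ℝ) ω q)
    (hF_unif : UniformlyAnalyticOn F (p ⁻¹' {0}))
    (hF_avg : ∀ q ∈ F, ∀ (a : ℝ) (ha : a ∈ leafParams p f \ S),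
      (chart a ha).torusAverage q a = g a)
    (d : ℝ) (hd : 0 < d) :
    -- the complement of the set of good values has small measure
    Tendsto (fun α : ℝ => volume ((g '' leafParams p f) \
        goodValues (leafParams p f) S rot g α d)) (𝓝[>] 0) (𝓝 0) ∧
    -- good values have finitely many preimages
    (∀ α > 0, ∀ F₀ ∈ goodValues (leafParams p f) S rot g α d,
      {a | a ∈ leafParams p f ∧ g a = F₀}.Finite) ∧
    -- `Q_∞(a)` is the range of the limit of the flow averages along the torus `Λ_a`
    (∀ q ∈ F, ∀ a ∈ leafParams p f \ S, ∃ l : Cotangent M → ℝ,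
      (∀ z ∈ leaf p f a, Tendsto (fun T => flowAverage p q T z) atTop (𝓝 (l z))) ∧
      QInfty p f q a = l '' leaf p f a) ∧
    -- the lower bound for the distance
    (∀ α > 0, ∀ K ⊆ goodValues (leafParams p f) S rot g α d, IsCompact K →
      ∃ σ > 0, ∀ q ∈ F, (∀ a ∈ leafParams p f, Metric.diam (QInfty p f q a) ≤ σ) →
        ∀ F₀ ∈ K, ∀ W ∈ 𝓝ˢ {a | a ∈ leafParams p f ∧ g a = F₀},
          ∃ C > 0, ∀ a ∈ leafParams p f \ W, 1 / C ≤ Metric.infDist F₀ (QInfty p f q a)) := by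
  exact theorem7p2_general p f (hp.of_le le_top) hf.continuous hcompact hconn.isPreconnected
    S hSfin.isClosed hSfin.countable chart rot hrot hrot_an hrot_nc g hg_an hg_cont hg_nc
    F hF_an hF_unif hF_avg d hd
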